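/- Let $D_x^{1/2}$ and $D_x^{-1/2}$ be the operators $(D_x^{\pm 1/2}u)^{\wedge}(\xi,\eta)=|\xi|^{\pm1/2}\widehat u(\xi,\eta)$ on functions of $(x,y)\in\mathbb{R}^2$, let $\mathscr{H}$ be the Hilbert transform in the variable $x$, $\mathscr{H}u(x,y)=\frac1\pi\,\mathrm{p.v.}\int_{\mathbb R}\frac{u(z,y)}{x-z}\,dz$ (on $L^2(\mathbb{R}^2)$, the Fourier multiplier with symbol $-i\,\mathrm{sgn}\,\xi$), and let $$\mathscr{Z}=\{u\in L^2(\mathbb{R}^2;\mathbb{R}):\ D_x^{1/2}u,\ D_x^{-1/2}u_y\in L^2(\mathbb{R}^2)\}.$$ Let $c>0$, let $f:\mathbb{R}\to\mathbb{R}$, put $F(u)=\int_0^u f(s)\,ds$, and assume: (A1) $f$ is continuous and $f(0)=0$; (A2) there are $C>0$ and $p\in(2,4)$ with $|f(u)|\le C(|u|+|u|^{p-1})$ for all $u\in\mathbb{R}$, and $f(u)=o(|u|)$ as $u\to0$; (A3) there is $\mu>2$ such that $0<\mu F(u)\le u f(u)$ for every $u\neq0$; (A4) there is $\omega\in\mathscr{Z}$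 such that $\lambda^{-2}\int_{\mathbb{R}^2}F(\lambda\omega)\,dx\,dy\to+\infty$ as $\lambda\to+\infty$. Then the solitary-wave equation $$-c\varphi_x-\mathscr{H}\Delta\varphi+(f(\varphi))_x=0$$ has a nontrivial solution $\varphi\in\mathscr{Z}$: there is $\varphi\in\mathscr{Z}$, $\varphi\ne0$, which satisfies the equation in the sense of tempered distributions on $\mathbb{R}^2$ and also satisfies the weak form of $-c\varphi-\mathscr{H}\partial_x^{-1}\Delta\varphi+f(\varphi)=0$, that is, for every $\chi\in\mathscr{Z}$ the function $f(\varphi)\chi$ is integrable and $$\int_{\mathbb{R}^2}\bigl(c\,\varphi\chi+D_x^{1/2}\varphi\,D_x^{1/2}\chi+D_x^{-1/2}\varphi_y\,D_x^{-1/2}\chi_y\bigr)\,dx\,dy=\int_{\mathbb{R}^2}f(\varphi)\,\chi\,dx\,dy.$$ -/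

import Mathlib

open MeasureTheory FourierTransform SchwartzMap LineDeriv Laplacian Filter Topology

noncomputable section

namespace Shrira

/-- The plane `ℝ²`; a point is `(x, y) = (z 0, z 1)`. -/
abbrev Plane : Type := EuclideanSpace ℝ (Fin 2)

/-- Real-valued `L²(ℝ²)`. -/
abbrev RealL2 : Type := Lp ℝ 2 (volume : Measure Plane)

/-- Complex-valued `L²(ℝ²)`. -/
abbrev ComplexL2 : Type := Lp ℂ 2 (volume : Measure Plane)

/-- A real-valued function in `L²` regarded as a complex-valued one. -/
def toComplex (u : RealL2) : ComplexL2 := Complex.ofRealCLM.compLp u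

/-- The Fourier transform of a real-valued function in `L²(ℝ²)`. It is Mathlib's transform, with
kernel `exp (-2 π i z · ζ)`, so that `∂_x` and `∂_y` are the multiplications by
`2 π i ζ 0` and `2 π i ζ 1`. -/
def hat (u : RealL2) : ComplexL2 := 𝓕 (toComplex u)

/-- The frequency `ξ` dual to `x`: `∂_x` has the symbol `i ξ`. -/
def xi (ζ : Plane) : ℝ := 2 * Real.pi * ζ 0

/-- The frequency `η` dual to `y`: `∂_y` has the symbol `i η`. -/
def eta (ζ : Plane) : ℝ := 2 * Real.pi * ζ 1

/-- The symbol `|ξ|^{1/2}` of `D_x^{1/2}`. -/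
def symDx (ζ : Plane) : ℂ := ((|xi ζ| ^ (1 / 2 : ℝ) : ℝ) : ℂ)

/-- The symbol `|ξ|^{-1/2} i η` of `D_x^{-1/2} ∂_y` (its value on the null set `ξ = 0` is
irrelevant). -/
def symDxInvDy (ζ : Plane) : ℂ := ((|xi ζ| ^ (-1 / 2 : ℝ) : ℝ) : ℂ) * (Complex.I * (eta ζ : ℂ))

/-- The symbol `- i sgn ξ` of the Hilbert transform in the variable `x`, that is, of
`u ↦ (1 / π) p.v. ∫ u (z, y) / (x - z) dz`. -/
def symHilbert (ζ : Plane) : ℂ := -Complex.I * ((Real.sign (xi ζ) : ℝ) : ℂ)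

lemma toComplex_add (u v : RealL2) : toComplex (u + v) = toComplex u + toComplex v :=
  (Complex.ofRealCLM.compLpL 2 (volume : Measure Plane)).map_add u v

lemma toComplex_smul (a : ℝ) (u : RealL2) : toComplex (a • u) = (a : ℂ) • toComplex u := by
  have h : toComplex (a • u) = a • toComplex u :=
    (Complex.ofRealCLM.compLpL 2 (volume : Measure Plane)).map_smul a u
  rw [h]
  ext1
  filter_upwards [Lp.coeFn_smul a (toComplex u), Lp.coeFn_smul (a : ℂ) (toComplex u)]
    with z h1 h2
  rw [h1, h2]
  simp only [Pi.smul_apply, Complex.real_smul, smul_eq_mul]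

lemma hat_add (u v : RealL2) : hat (u + v) = hat u + hat v := by
  rw [hat, toComplex_add, FourierTransform.fourier_add]; rfl

lemma hat_smul (a : ℝ) (u : RealL2) : hat (a • u) = (a : ℂ) • hat u := by
  rw [hat, toComplex_smul, FourierTransform.fourier_smul]; rfl

/-- The space of the real-valued `u ∈ L²(ℝ²)` with `m û ∈ L²(ℝ²)`. -/
def multiplierDomain (m : Plane → ℂ) : Submodule ℝ RealL2 where
  carrier := {u | MemLp (fun ζ => m ζ * hat u ζ) 2 volume}
  add_mem' := by
    intro u v hu hv
    refine MemLp.ae_eq ?_ (MemLp.add hu hv)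
    rw [hat_add]
    filter_upwards [Lp.coeFn_add (hat u) (hat v)] with ζ h
    simp only [h, Pi.add_apply, mul_add]
  zero_mem' := by
    have h : hat 0 = 0 := by simpa using hat_smul 0 0
    refine MemLp.ae_eq ?_ (MemLp.zero (ε := ℂ))
    rw [h]
    filter_upwards [Lp.coeFn_zero ℂ 2 (volume : Measure Plane)] with ζ h
    simp only [h, Pi.zero_apply, mul_zero]
  smul_mem' := by
    intro a u hu
    refine MemLp.ae_eq ?_ (MemLp.const_smul hu (a : ℂ))
    rw [hat_smul]
    filter_upwards [Lp.coeFn_smul (a : ℂ) (hat u)] with ζ h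
    simp only [h, Pi.smul_apply, smul_eq_mul]
    ring

/-- The Fourier multiplier operator with symbol `m`: the function in `L²(ℝ²)` with Fourier
transform `m û`. -/
def multiplier (m : Plane → ℂ) (u : RealL2) (hu : u ∈ multiplierDomain m) : ComplexL2 :=
  𝓕⁻ (MemLp.toLp (fun ζ => m ζ * hat u ζ) hu)

lemma mem_domain_hilbert (u : RealL2) : u ∈ multiplierDomain symHilbert := by
  have hm : Measurable symHilbert := by
    have h0 : Measurable xi := by unfold xi; fun_prop
    have hs : Measurable Real.sign := by
      unfold Real.sign
      exact Measurable.ite measurableSet_Iio measurable_const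
        (Measurable.ite measurableSet_Ioi measurable_const measurable_const)
    exact measurable_const.mul (Complex.measurable_ofReal.comp (hs.comp h0))
  refine MemLp.of_le (Lp.memLp (hat u))
    (hm.aestronglyMeasurable.mul (Lp.aestronglyMeasurable (hat u)))
    (Eventually.of_forall fun ζ => ?_)
  have h1 : ‖symHilbert ζ‖ ≤ 1 := by
    rcases Real.sign_apply_eq (xi ζ) with h | h | h <;> simp [symHilbert, h]
  calc ‖symHilbert ζ * hat u ζ‖ = ‖symHilbert ζ‖ * ‖hat u ζ‖ := norm_mul _ _
    _ ≤ 1 * ‖hat u ζ‖ := by gcongr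
    _ = ‖hat u ζ‖ := one_mul _

/-- The Hilbert transform in the variable `x` on `L²(ℝ²)`. -/
def hilbertX (u : RealL2) : ComplexL2 := multiplier symHilbert u (mem_domain_hilbert u)

/-- The energy space `𝒵 = {u ∈ L²(ℝ²) : D_x^{1/2} u, D_x^{-1/2} u_y ∈ L²(ℝ²)}` of real-valued
functions. -/
def energySpace : Submodule ℝ RealL2 := multiplierDomain symDx ⊓ multiplierDomain symDxInvDy

/-- `D_x^{1/2} u`. -/
def halfDx (u : energySpace) : ComplexL2 := multiplier symDx u u.2.1

/-- `D_x^{-1/2} u_y`. -/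
def invHalfDxDy (u : energySpace) : ComplexL2 := multiplier symDxInvDy u u.2.2

/-- The scalar product
`(u, v)_𝒵 = ∫ (c u v + D_x^{1/2} u D_x^{1/2} v + D_x^{-1/2} u_y D_x^{-1/2} v_y) dx dy` of `𝒵`.
The functions involved are real-valued, so the real parts only serve to obtain a real number. -/
def energyInner (c : ℝ) (u v : energySpace) : ℝ :=
  c * inner ℝ (u : RealL2) (v : RealL2) + (inner ℂ (halfDx u) (halfDx v)).re
    + (inner ℂ (invHalfDxDy u) (invHalfDxDy v)).re

/-- The primitive `F (s) = ∫₀ˢ f (t) dt` of `f`. -/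
def primitive (f : ℝ → ℝ) (s : ℝ) : ℝ := ∫ t in (0 : ℝ)..s, f t

/-- The unit vector in the direction of `x`. -/
def ex : Plane := EuclideanSpace.single 0 1

/-- `-c φ_x - ℋ Δ φ + (f(φ))_x = 0` in the sense of tempered distributions. Derivatives are moved
to the test function, `ℋ` and `Δ` commute, and `ℋ φ` is a function in `L²(ℝ²)`; the first
conjunct says that `f(φ)` acts on test functions by integration. -/
def SolvesSolitaryWaveEq (c : ℝ) (f : ℝ → ℝ) (φ : RealL2) : Prop :=
  (∀ ψ : 𝓢(Plane, ℂ), Integrable (fun z => ((f (φ z) : ℝ) : ℂ) * ψ z) volume) ∧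
  ∀ ψ : 𝓢(Plane, ℂ),
    (c : ℂ) * (∫ z, ((φ z : ℝ) : ℂ) * (∂_{ex} ψ) z) - (∫ z, hilbertX φ z * (Δ ψ) z)
      - (∫ z, ((f (φ z) : ℝ) : ℂ) * (∂_{ex} ψ) z) = 0

/-- The weak form in `𝒵` of `-c φ - ℋ ∂_x^{-1} Δ φ + f(φ) = 0`, that is, the Euler-Lagrange
equation of the action `u ↦ ‖u‖²_𝒵 / 2 - ∫ F(u)`. -/
def SolvesWeakForm (c : ℝ) (f : ℝ → ℝ) (φ : energySpace) : Prop :=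
  ∀ χ : energySpace,
    Integrable (fun z => f ((φ : RealL2) z) * (χ : RealL2) z) volume ∧
    energyInner c φ χ = ∫ z, f ((φ : RealL2) z) * (χ : RealL2) z

end Shrira

end

/-! The weak form is the Euler-Lagrange equation of S(u) = ‖u‖²/2 - ∫ F(u) (`action`) on the Hilbert
space `Energy c`. A nonzero critical point of S comes from a mountain pass argument combined with
recentring by translations.

Everything rests on the elementary inequality |ζ| ≤ |ξ| + η²/|ξ| between symbols (`norm_le_symbol`):
the energy norm controls the isotropic homogeneous Sobolev energy of order 1/2, hence the L² and L⁴
norms in the plane (`lintegral_four_le`). Since p < 4 and f(u) = o(|u|), for every ε there is K with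
|f(u)| ≤ ε(|u| + |u|³) + K|u|² (`exists_quadratic_bound`). Therefore S(u) ≥ ‖u‖²/8 near the origin,
while S is negative far out along ω. The mountain pass theorem, derived from Ekeland's principle on
the space of paths, yields points at levels between a > 0 and B at which S' is as small as desired;
the condition μ > 2 bounds them in norm.

The plane is unbounded and the problem is invariant under translations, so such a sequence may
converge weakly to 0. A positive level together with the quadratic bound gives ∫ |u|³ ≥ δ, and
`integral_three_le` converts this into a point x at which the part of u with frequencies below a
fixed A has size at least M. After translating x to the origin, the value at 0 of the low-frequency
part is a weakly continuous functional bounded away from 0, so the weak limit is nonzero. Low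
frequencies converge pointwise under weak convergence and high frequencies are uniformly small in
L², so a subsequence converges almost everywhere; with the bound in L² ∩ L⁴ this passes to the limit
in ∫ f(u) χ, and the limit is critical.

For the distributional equation the weak form is tested with χ = g_x, g Schwartz. The factor ξ
cancels the singularity of |ξ|^{-1/2}, so g_x lies in the energy space, and Plancherel turns the two
derivative terms into -∫ ℋφ Δg (`integral_hilbertX_laplacian`). -/

/-! ### Ekeland's principle, mountain pass, weak compactness -/

/-- Ekeland's variational principle, weak form. -/
theorem ekeland_variational_principle {X : Type*} [MetricSpace X] [CompleteSpace X] {Ψ : X → ℝ}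
    (hΨ : LowerSemicontinuous Ψ) {m : ℝ} (hm : ∀ x, m ≤ Ψ x) {ε : ℝ} (hε : 0 < ε) (x₀ : X) :
    ∃ x, Ψ x ≤ Ψ x₀ ∧ ∀ y, Ψ x ≤ Ψ y + ε * dist x y := by
  -- `y ∈ A x` is a partial order. The sequence `s` moves down it, each step almost minimizing `Ψ`
  -- among the points below; its limit lies below every `s n` and is minimal.
  let A : X → Set X := fun x => {y | Ψ y + ε * dist x y ≤ Ψ x}
  have hself : ∀ x, x ∈ A x := fun x => by simp [A]
  have htrans : ∀ {x y z}, y ∈ A x → z ∈ A y → z ∈ A x := by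
    intro x y z hy hz
    simp only [A, Set.mem_ofPred_eq] at hy hz ⊢
    have := mul_le_mul_of_nonneg_left (dist_triangle x y z) hε.le
    linarith
  have hbdd : ∀ x, BddBelow (Ψ '' A x) := fun x => ⟨m, by rintro _ ⟨y, -, rfl⟩; exact hm y⟩
  have hstep : ∀ (n : ℕ) (x : X), ∃ y ∈ A x, ∀ z ∈ A x, Ψ y ≤ Ψ z + 1 / ((n : ℝ) + 1) := by
    intro n x
    have hne : (Ψ '' A x).Nonempty := ⟨_, x, hself x, rfl⟩
    have hpos : (0 : ℝ) < 1 / ((n : ℝ) + 1) := by positivity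
    obtain ⟨_, ⟨y, hy, rfl⟩, hlt⟩ := Real.lt_sInf_add_pos hne hpos
    refine ⟨y, hy, fun z hz => ?_⟩
    have := csInf_le (hbdd x) ⟨z, hz, rfl⟩
    linarith
  choose g hgA hg using hstep
  let s : ℕ → X := fun n => Nat.rec x₀ (fun k x => g k x) n
  have hs : ∀ n, s (n + 1) = g n (s n) := fun n => rfl
  have hsA : ∀ n k, s (n + k) ∈ A (s n) := by
    intro n k
    induction k with
    | zero => exact hself _
    | succ k ih => exact htrans ih (by rw [← add_assoc, hs]; exact hgA _ _)
  have hdist : ∀ n k, n ≤ k → ε * dist (s n) (s k) ≤ Ψ (s n) - Ψ (s k) := by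
    intro n k hnk
    obtain ⟨j, rfl⟩ := Nat.exists_eq_add_of_le hnk
    have := hsA n j
    simp only [A, Set.mem_ofPred_eq] at this
    linarith
  have hanti : Antitone fun n => Ψ (s n) := by
    intro n k hnk
    have h1 := hdist n k hnk
    have h2 : 0 ≤ ε * dist (s n) (s k) := by positivity
    show Ψ (s k) ≤ Ψ (s n)
    linarith
  have hconv := tendsto_atTop_ciInf hanti ⟨m, by rintro _ ⟨n, rfl⟩; exact hm _⟩
  have hcauchy : CauchySeq s := by
    rw [Metric.cauchySeq_iff']
    intro δ hδ
    have hc := hconv.cauchySeq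
    rw [Metric.cauchySeq_iff'] at hc
    obtain ⟨N, hN⟩ := hc (ε * δ) (by positivity)
    refine ⟨N, fun n hn => ?_⟩
    have h1 := hN n hn
    rw [Real.dist_eq, abs_lt] at h1
    have h2 := hdist N n hn
    rw [dist_comm]
    exact lt_of_mul_lt_mul_left (by linarith : ε * dist (s N) (s n) < ε * δ) hε.le
  obtain ⟨x, hx⟩ := cauchySeq_tendsto_of_complete hcauchy
  have hxA : ∀ n, x ∈ A (s n) := by
    intro n
    have hcl : IsClosed (A (s n)) := by
      have : LowerSemicontinuous fun y => Ψ y + ε * dist (s n) y :=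
        hΨ.add (by fun_prop : Continuous fun y => ε * dist (s n) y).lowerSemicontinuous
      exact this.isClosed_preimage (Ψ (s n))
    exact hcl.mem_of_tendsto hx (eventually_atTop.2 ⟨n, fun k hk => by
      obtain ⟨j, rfl⟩ := Nat.exists_eq_add_of_le hk; exact hsA n j⟩)
  refine ⟨x, ?_, fun y => ?_⟩
  · have := hxA 0
    simp only [A, Set.mem_ofPred_eq] at this
    have h2 : 0 ≤ ε * dist (s 0) x := by positivity
    have h3 : s 0 = x₀ := rfl
    rw [h3] at this h2
    linarith
  · by_contra! hlt
    have hy : y ∈ A x := hlt.le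
    -- By transitivity `y` lies below every `s n`, so it competes in the choice of `s (n + 1)`,
    -- whose value is at least `Ψ x`.
    have key : ∀ n : ℕ, Ψ x ≤ Ψ y + 1 / ((n : ℝ) + 1) := by
      intro n
      have h1 := hg n (s n) y (htrans (hxA n) hy)
      have h2 := hxA (n + 1)
      rw [hs] at h2
      simp only [A, Set.mem_ofPred_eq] at h2
      have h3 : 0 ≤ ε * dist (g n (s n)) x := by positivity
      linarith
    have hle : Ψ x ≤ Ψ y := by
      have ht : Tendsto (fun n : ℕ => Ψ y + 1 / ((n : ℝ) + 1)) atTop (𝓝 (Ψ y + 0)) :=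
        tendsto_const_nhds.add tendsto_one_div_add_atTop_nhds_zero_nat
      rw [add_zero] at ht
      exact ge_of_tendsto' ht key
    have h4 : 0 ≤ ε * dist x y := by positivity
    linarith

/-- The mountain pass theorem in the form of almost critical points, for functionals with a
derivative along strongly convergent sequences of base points and directions. -/
theorem exists_almost_critical_of_mountain_pass {H : Type*} [NormedAddCommGroup H]
    [NormedSpace ℝ H] [CompleteSpace H] {S : H → ℝ} {S' : H → H →ₗ[ℝ] ℝ} (hS : Continuous S)
    (hS' : ∀ h, Continuous fun u => S' u h)
    (hD : ∀ (u h : H) (v k : ℕ → H) (s : ℕ → ℝ), Tendsto v atTop (𝓝 u) → Tendsto k atTop (𝓝 h) →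
      Tendsto s atTop (𝓝 0) → (∀ n, 0 < s n) →
      ∃ r : ℕ → ℕ, Tendsto r atTop atTop ∧
        Tendsto (fun n => (S (v (r n) + s (r n) • k (r n)) - S (v (r n))) / s (r n)) atTop
          (𝓝 (S' u h)))
    {a ρ : ℝ} {e : H} (h0 : S 0 < a) (he : S e < a) (hρ : 0 ≤ ρ) (hρe : ρ ≤ ‖e‖)
    (ha : ∀ u, ‖u‖ = ρ → a ≤ S u) :
    ∃ B, ∀ ε > 0, ∃ u, a ≤ S u ∧ S u ≤ B ∧ ∀ h, |S' u h| ≤ ε * ‖h‖ := by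
  -- The paths from 0 to `e` form a complete metric space. Ekeland's principle is applied to the
  -- maximum of `S` along a path, which is at least `a` because every path meets the sphere of
  -- radius `ρ`.
  let X : Set C(unitInterval, H) := {γ | γ 0 = 0 ∧ γ 1 = e}
  have hX : IsClosed X := by
    have h1 : IsClosed {γ : C(unitInterval, H) | γ 0 = 0} :=
      isClosed_eq (continuous_eval_const _) continuous_const
    have h2 : IsClosed {γ : C(unitInterval, H) | γ 1 = e} :=
      isClosed_eq (continuous_eval_const _) continuous_const
    exact h1.inter h2
  have : CompleteSpace X := hX.completeSpace_coe
  let Ψ : X → ℝ := fun γ => ⨆ t, S (γ.1 t)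
  have hbdd : ∀ γ : X, BddAbove (Set.range fun t => S (γ.1 t)) := fun γ =>
    (isCompact_range (hS.comp γ.1.continuous)).bddAbove
  have hΨ : LowerSemicontinuous Ψ := by
    refine lowerSemicontinuous_ciSup (f := fun t (γ : X) => S (γ.1 t)) hbdd fun t => ?_
    exact (hS.comp ((continuous_eval_const t).comp
      continuous_subtype_val)).lowerSemicontinuous
  have hlow : ∀ γ : X, a ≤ Ψ γ := by
    intro γ
    have hc : Continuous fun t => ‖γ.1 t‖ := by fun_prop
    have hmem : ρ ∈ Set.Icc ‖γ.1 0‖ ‖γ.1 1‖ := by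
      rw [γ.2.1, γ.2.2]; simpa using ⟨hρ, hρe⟩
    obtain ⟨t, ht⟩ := mem_range_of_exists_le_of_exists_ge hc ⟨0, hmem.1⟩ ⟨1, hmem.2⟩
    exact (ha _ ht).trans (le_ciSup (hbdd γ) t)
  let γ₀ : X := ⟨⟨fun t => (t : ℝ) • e, by fun_prop⟩, by simp [X]⟩
  refine ⟨Ψ γ₀, fun ε hε => ?_⟩
  obtain ⟨γ, hγ₀, hγ⟩ := ekeland_variational_principle hΨ hlow hε γ₀
  obtain ⟨tm, htm⟩ : ∃ t, Ψ γ = S (γ.1 t) := by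
    obtain ⟨t, -, ht⟩ := isCompact_univ.exists_isMaxOn Set.univ_nonempty
      (hS.comp γ.1.continuous).continuousOn
    exact ⟨t, le_antisymm (ciSup_le fun s => ht (Set.mem_univ s)) (le_ciSup (hbdd γ) t)⟩
  by_contra! hcon
  have hneg : ∀ t, S (γ.1 t) = Ψ γ → ∃ h, ‖h‖ ≤ 1 ∧ S' (γ.1 t) h < -ε := by
    intro t ht
    obtain ⟨h, hh⟩ := hcon (γ.1 t) (by rw [ht]; exact hlow γ) (by rw [ht]; exact hγ₀)
    have hne : 0 < ‖h‖ := by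
      rw [norm_pos_iff]; rintro rfl; simp at hh
    rcases le_or_gt 0 (S' (γ.1 t) h) with hs | hs
    · rw [abs_of_nonneg hs] at hh
      refine ⟨(-‖h‖⁻¹) • h, ?_, ?_⟩
      · rw [norm_smul, norm_neg, norm_inv, norm_norm, inv_mul_cancel₀ hne.ne']
      · rw [map_smul, smul_eq_mul, neg_mul, neg_lt_neg_iff, lt_inv_mul_iff₀ hne, mul_comm]
        exact hh
    · rw [abs_of_neg hs] at hh
      refine ⟨‖h‖⁻¹ • h, ?_, ?_⟩
      · rw [norm_smul, norm_inv, norm_norm, inv_mul_cancel₀ hne.ne']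
      · rw [map_smul, smul_eq_mul, lt_neg, ← mul_neg, lt_inv_mul_iff₀ hne, mul_comm]
        exact hh
  have hM : ∀ t, S (γ.1 t) = Ψ γ → t ≠ 0 ∧ t ≠ 1 := by
    intro t ht
    have h1 := hlow γ
    constructor
    · rintro rfl; rw [γ.2.1] at ht; linarith
    · rintro rfl; rw [γ.2.2] at ht; linarith
  -- Admissible descent directions: steep where the path attains its maximum, zero at the endpoints.
  -- The sets are convex because `S'` is linear in the direction. A single vector works near each
  -- parameter, because `S'` is continuous in the base point and the maximum is not attained at the
  -- ends; a partition of unity then gives a continuous choice.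
  let T : unitInterval → Set H := fun t =>
    {h | ‖h‖ ≤ 1 ∧ (S (γ.1 t) = Ψ γ → S' (γ.1 t) h < -ε) ∧ (t = 0 ∨ t = 1 → h = 0)}
  have hTconv : ∀ t, Convex ℝ (T t) := by
    intro t x hx y hy p q hp hq hpq
    refine ⟨?_, fun ht => ?_, fun ht => ?_⟩
    · calc ‖p • x + q • y‖ ≤ ‖p • x‖ + ‖q • y‖ := norm_add_le _ _
        _ = p * ‖x‖ + q * ‖y‖ := by rw [norm_smul, norm_smul, Real.norm_of_nonneg hp,
            Real.norm_of_nonneg hq]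
        _ ≤ p * 1 + q * 1 := by gcongr; exacts [hx.1, hy.1]
        _ = 1 := by linarith
    · have h1 := hx.2.1 ht
      have h2 := hy.2.1 ht
      rw [map_add, map_smul, map_smul, smul_eq_mul, smul_eq_mul]
      rcases hp.eq_or_lt with rfl | hp'
      · have : q = 1 := by linarith
        subst this; linarith
      · nlinarith [mul_lt_mul_of_pos_left h1 hp', mul_le_mul_of_nonneg_left h2.le hq]
    · rw [hx.2.2 ht, hy.2.2 ht]; simp
  have hTloc : ∀ t, ∃ h, ∀ᶠ s in 𝓝 t, h ∈ T s := by
    intro t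
    by_cases ht : S (γ.1 t) = Ψ γ
    · obtain ⟨h, h1, h2⟩ := hneg t ht
      obtain ⟨h3, h4⟩ := hM t ht
      refine ⟨h, ?_⟩
      have hc : Continuous fun s => S' (γ.1 s) h := (hS' h).comp γ.1.continuous
      filter_upwards [hc.continuousAt.eventually_lt continuousAt_const h2,
        isOpen_ne.mem_nhds h3, isOpen_ne.mem_nhds h4] with s hs1 hs2 hs3
      exact ⟨h1, fun _ => hs1, fun hs => (hs.elim hs2 hs3).elim⟩
    · refine ⟨0, ?_⟩
      have hc : Continuous fun s => S (γ.1 s) := hS.comp γ.1.continuous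
      filter_upwards [(isOpen_ne_fun hc continuous_const).mem_nhds ht] with s hs
      exact ⟨by simp, fun h => (hs h).elim, fun _ => rfl⟩
  obtain ⟨g, hg⟩ := exists_continuous_forall_mem_convex_of_local_const hTconv hTloc
  let δ : ℕ → ℝ := fun n => 1 / ((n : ℝ) + 1)
  have hδ : ∀ n, 0 < δ n := fun n => by positivity
  let Γ : ℕ → X := fun n => ⟨γ.1 + δ n • g, by
    simp [X, γ.2.1, γ.2.2, (hg 0).2.2 (Or.inl rfl), (hg 1).2.2 (Or.inr rfl)]⟩
  -- The perturbed path is within `δ n` of `γ`, so Ekeland's inequality limits the decrease of the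
  -- maximum to `ε * δ n`.
  have hΓ : ∀ n, Ψ γ ≤ Ψ (Γ n) + ε * δ n := by
    intro n
    refine (hγ (Γ n)).trans ?_
    have : dist γ (Γ n) ≤ δ n := by
      rw [Subtype.dist_eq, dist_eq_norm]
      have h1 : γ.1 - (Γ n).1 = -(δ n • g) := by simp [Γ]
      rw [h1, norm_neg, ContinuousMap.norm_le _ (hδ n).le]
      intro t
      rw [ContinuousMap.smul_apply, norm_smul, Real.norm_of_nonneg (hδ n).le]
      calc δ n * ‖g t‖ ≤ δ n * 1 := mul_le_mul_of_nonneg_left (hg t).1 (hδ n).le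
        _ = δ n := mul_one _
    gcongr
  have hmax : ∀ n, ∃ t, Ψ (Γ n) = S ((Γ n).1 t) := by
    intro n
    obtain ⟨t, -, ht⟩ := isCompact_univ.exists_isMaxOn Set.univ_nonempty
      (hS.comp (Γ n).1.continuous).continuousOn
    exact ⟨t, le_antisymm (ciSup_le fun s => ht (Set.mem_univ s)) (le_ciSup (hbdd (Γ n)) t)⟩
  choose τ hτ using hmax
  obtain ⟨t, -, σ, hσ, hσt⟩ := isCompact_univ.tendsto_subseq (x := τ) fun n => Set.mem_univ _
  have hδ0 : Tendsto (fun n => δ (σ n)) atTop (𝓝 0) :=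
    tendsto_one_div_add_atTop_nhds_zero_nat.comp hσ.tendsto_atTop
  have hv : Tendsto (fun n => γ.1 (τ (σ n))) atTop (𝓝 (γ.1 t)) :=
    (γ.1.continuous.tendsto t).comp hσt
  have hk : Tendsto (fun n => g (τ (σ n))) atTop (𝓝 (g t)) := (g.continuous.tendsto t).comp hσt
  have hval : ∀ n, Ψ γ - ε * δ (σ n) ≤ S (γ.1 (τ (σ n)) + δ (σ n) • g (τ (σ n))) := by
    intro n
    have h1 := hΓ (σ n)
    rw [hτ] at h1
    have h2 : (Γ (σ n)).1 (τ (σ n)) = γ.1 (τ (σ n)) + δ (σ n) • g (τ (σ n)) := rfl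
    rw [h2] at h1
    linarith
  have ht : S (γ.1 t) = Ψ γ := by
    refine le_antisymm (le_ciSup (hbdd γ) t) ?_
    have h1 : Tendsto (fun n => S (γ.1 (τ (σ n)) + δ (σ n) • g (τ (σ n)))) atTop
        (𝓝 (S (γ.1 t + (0 : ℝ) • g t))) := (hS.tendsto _).comp (hv.add (hδ0.smul hk))
    have h2 : Tendsto (fun n => Ψ γ - ε * δ (σ n)) atTop (𝓝 (Ψ γ - ε * 0)) :=
      tendsto_const_nhds.sub (hδ0.const_mul ε)
    have := le_of_tendsto_of_tendsto' h2 h1 hval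
    simpa using this
  obtain ⟨r, -, hlim⟩ := hD _ _ _ _ _ hv hk hδ0 fun n => hδ _
  -- At the maximizers of the perturbed paths the difference quotients of `S` are at least `-ε`;
  -- their limit contradicts the steepness of `g t` at the maximum point `t`.
  have hge : -ε ≤ S' (γ.1 t) (g t) := by
    refine ge_of_tendsto' hlim fun n => ?_
    rw [le_div_iff₀ (hδ _)]
    have h1 := hval (r n)
    have h2 := le_ciSup (hbdd γ) (τ (σ (r n)))
    simp only [Ψ] at h1
    linarith
  exact absurd ((hg t).2.1 ht) (not_lt.2 hge)

/-- Bounded sequences in a separable Hilbert space have weakly convergent subsequences. -/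
theorem exists_weakly_convergent_subseq {H : Type*} [NormedAddCommGroup H]
    [InnerProductSpace ℝ H] [CompleteSpace H] [TopologicalSpace.SeparableSpace H] {v : ℕ → H}
    {R : ℝ} (hv : ∀ n, ‖v n‖ ≤ R) :
    ∃ (u : H) (r : ℕ → ℕ), StrictMono r ∧
      ∀ h, Tendsto (fun n => inner ℝ (v (r n)) h) atTop (𝓝 (inner ℝ u h)) := by
  obtain ⟨φ, -, r, hr, hlim⟩ := WeakDual.isSeqCompact_closedBall ℝ H 0 R
    (x := fun n => StrongDual.toWeakDual (InnerProductSpace.toDual ℝ H (v n)))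
    (fun n => by simpa using hv n)
  refine ⟨(InnerProductSpace.toDual ℝ H).symm (WeakDual.toStrongDual φ), r, hr, fun h => ?_⟩
  rw [InnerProductSpace.toDual_symm_apply]
  have := ((WeakDual.eval_continuous (𝕜 := ℝ) h).tendsto φ).comp hlim
  refine this.congr fun n => ?_
  simp [Function.comp]

/-! ### Nonlinear integrals on L² ∩ L⁴ -/

section Nemytskii

variable {α : Type*} [MeasurableSpace α] {ν : Measure α}

/-- A nonnegative sequence converging to zero almost everywhere has integrals tending to zero if
it is dominated, up to errors of arbitrarily small integral, by fixed integrable functions. -/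
theorem tendsto_integral_zero_of_almost_dominated {d : ℕ → α → ℝ}
    (hd : ∀ n, Integrable (d n) ν) (hd0 : ∀ n x, 0 ≤ d n x)
    (hlim : ∀ᵐ x ∂ν, Tendsto (fun n => d n x) atTop (𝓝 0))
    (hdom : ∀ ε > 0, ∃ (W : ℕ → α → ℝ) (D : α → ℝ), (∀ n, Integrable (W n) ν) ∧ Integrable D ν ∧
      (∀ x, 0 ≤ D x) ∧ (∀ n, ∀ᵐ x ∂ν, d n x ≤ W n x + D x) ∧ (∀ n x, 0 ≤ W n x) ∧
      ∀ᶠ n in atTop, ∫ x, W n x ∂ν ≤ ε) :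
    Tendsto (fun n => ∫ x, d n x ∂ν) atTop (𝓝 0) := by
  have hnn : ∀ n, 0 ≤ ∫ x, d n x ∂ν := fun n => integral_nonneg (hd0 n)
  rw [Metric.tendsto_atTop']
  intro ε hε
  obtain ⟨W, D, hW, hD, hD0, hle, hW0, hWε⟩ := hdom (ε / 2) (by positivity)
  -- `d ≤ W + min d D`: the truncated term falls under dominated convergence, and the rest has small
  -- integral.
  have hmin : Tendsto (fun n => ∫ x, min (d n x) (D x) ∂ν) atTop (𝓝 (∫ _, (0 : ℝ) ∂ν)) := by
    refine tendsto_integral_of_dominated_convergence D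
      (fun n => ((hd n).inf hD).aestronglyMeasurable) hD (fun n => ?_) ?_
    · refine Eventually.of_forall fun x => ?_
      rw [Real.norm_of_nonneg (le_min (hd0 n x) (hD0 x))]
      exact min_le_right _ _
    · filter_upwards [hlim] with x hx
      exact squeeze_zero (fun n => le_min (hd0 n x) (hD0 x)) (fun n => min_le_left _ _) hx
  rw [integral_zero] at hmin
  obtain ⟨N, hN⟩ := eventually_atTop.1 (hWε.and (hmin.eventually_lt_const (half_pos hε)))
  refine ⟨N, fun n hn => ?_⟩
  obtain ⟨h1, h2⟩ := hN n hn.le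
  rw [Real.dist_eq, sub_zero, abs_of_nonneg (hnn n)]
  calc ∫ x, d n x ∂ν ≤ ∫ x, (W n x + min (d n x) (D x)) ∂ν := by
        refine integral_mono_ae (hd n) ((hW n).add ((hd n).inf hD)) ?_
        filter_upwards [hle n] with x hx
        rcases le_total (d n x) (D x) with h | h
        · simp only [min_eq_left h]; linarith [hW0 n x]
        · simp only [min_eq_right h]; exact hx
    _ = ∫ x, W n x ∂ν + ∫ x, min (d n x) (D x) ∂ν := integral_add (hW n) ((hd n).inf hD)
    _ < ε := by linarith

/-- Convergence in square mean implies convergence almost everywhere along a subsequence. -/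
theorem exists_subseq_ae_of_tendsto_integral_sq {v : ℕ → α → ℝ} {u : α → ℝ}
    (hv : ∀ n, AEStronglyMeasurable (v n) ν) (hu : AEStronglyMeasurable u ν)
    (hi : ∀ n, Integrable (fun x => (v n x - u x) ^ 2) ν)
    (hlim : Tendsto (fun n => ∫ x, (v n x - u x) ^ 2 ∂ν) atTop (𝓝 0)) :
    ∃ r : ℕ → ℕ, StrictMono r ∧ ∀ᵐ x ∂ν, Tendsto (fun n => v (r n) x) atTop (𝓝 (u x)) := by
  refine TendstoInMeasure.exists_seq_tendsto_ae
    (tendstoInMeasure_of_tendsto_eLpNorm (p := 2) two_ne_zero hv hu ?_)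
  have h1 : ∀ n, eLpNorm (v n - u) 2 ν = ENNReal.ofReal ((∫ x, (v n x - u x) ^ 2 ∂ν) ^ (1 / 2 : ℝ)) := by
    intro n
    have hm : MemLp (v n - u) 2 ν := (memLp_two_iff_integrable_sq ((hv n).sub hu)).2 (hi n)
    rw [hm.eLpNorm_eq_integral_rpow_norm two_ne_zero ENNReal.ofNat_ne_top]
    simp
  simp_rw [h1]
  have h2 := (hlim.rpow_const (p := (1 / 2 : ℝ)) (Or.inr (by norm_num)))
  have h3 := (ENNReal.continuous_ofReal.tendsto _).comp h2
  simpa [Function.comp_def] using h3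

/-- Square and fourth power integrable functions. -/
structure MemTwoFour (u : α → ℝ) (ν : Measure α) : Prop where
  meas : AEStronglyMeasurable u ν
  sq : Integrable (fun x => u x ^ 2) ν
  four : Integrable (fun x => u x ^ 4) ν

/-- The density `u² + u⁴`. -/
def twoFour (s : ℝ) : ℝ := s ^ 2 + s ^ 4

theorem twoFour_nonneg (s : ℝ) : 0 ≤ twoFour s := by unfold twoFour; positivity

theorem MemTwoFour.integrable {u : α → ℝ} (hu : MemTwoFour u ν) :
    Integrable (fun x => twoFour (u x)) ν := hu.sq.add hu.four

theorem twoFour_add_le (a b : ℝ) : twoFour (a + b) ≤ 8 * twoFour a + 8 * twoFour b := by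
  unfold twoFour
  have h1 : (a + b) ^ 2 ≤ 2 * a ^ 2 + 2 * b ^ 2 := by nlinarith [sq_nonneg (a - b)]
  have h2 : (a + b) ^ 4 ≤ 8 * a ^ 4 + 8 * b ^ 4 := by
    have : (a + b) ^ 4 = ((a + b) ^ 2) ^ 2 := by ring
    rw [this]
    nlinarith [pow_le_pow_left₀ (sq_nonneg (a + b)) h1 2, sq_nonneg (a ^ 2 - b ^ 2)]
  nlinarith [sq_nonneg a, sq_nonneg b]

theorem twoFour_abs (a : ℝ) : twoFour |a| = twoFour a := by
  unfold twoFour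
  rw [sq_abs, show |a| ^ 4 = (|a| ^ 2) ^ 2 by ring, sq_abs]; ring

theorem twoFour_mono {a b : ℝ} (h : |a| ≤ |b|) : twoFour a ≤ twoFour b := by
  rw [← twoFour_abs a, ← twoFour_abs b]
  unfold twoFour
  gcongr

/-- Young's inequality for the pairing of a function of cubic growth. -/
theorem mul_le_twoFour (a b : ℝ) :
    (|a| + |a| ^ 3) * |b| ≤ twoFour a + twoFour b := by
  rw [← twoFour_abs a, ← twoFour_abs b]
  unfold twoFour
  have ha := abs_nonneg a
  have hb := abs_nonneg b
  generalize |a| = s at *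
  generalize |b| = t at *
  have h1 : s * t ≤ s ^ 2 + t ^ 2 := by nlinarith [sq_nonneg (s - t)]
  have h2 : s ^ 3 * t ≤ s ^ 4 + t ^ 4 := by
    rcases le_total s t with h | h
    · have : s ^ 3 ≤ t ^ 3 := by gcongr
      nlinarith [pow_nonneg ha 4, mul_le_mul_of_nonneg_right this hb]
    · nlinarith [mul_le_mul_of_nonneg_left h (pow_nonneg ha 3), pow_nonneg hb 4]
  linarith

/-- If |b| ≤ ε|a| the factor b is absorbed by the first term; otherwise |a| ≤ ε⁻¹|b|, and the worst
term |a|³|b| costs ε⁻³. The small weight falls on `a`, so that a merely bounded sequence contributes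
little when paired with a fixed function. -/
theorem mul_le_twoFour_weighted {ε : ℝ} (hε : 0 < ε) (hε1 : ε ≤ 1) (a b : ℝ) :
    (|a| + |a| ^ 3) * |b| ≤ ε * twoFour a + ε⁻¹ ^ 3 * twoFour b := by
  rw [← twoFour_abs a, ← twoFour_abs b]
  unfold twoFour
  have ha := abs_nonneg a
  have hb := abs_nonneg b
  generalize |a| = s at *
  generalize |b| = t at *
  obtain ⟨q, hq⟩ : ∃ q, q = ε⁻¹ := ⟨_, rfl⟩
  have hq1 : 1 ≤ q := hq ▸ (one_le_inv₀ hε).2 hε1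
  have hεq : ε * q = 1 := hq ▸ mul_inv_cancel₀ hε.ne'
  rw [← hq]
  have hq3 : q ≤ q ^ 3 := by nlinarith [sq_nonneg q]
  have h1 : s * t ≤ ε * s ^ 2 + q ^ 3 * t ^ 2 := by
    rcases le_total t (ε * s) with h | h
    · nlinarith [mul_le_mul_of_nonneg_left h ha, mul_nonneg (pow_nonneg (zero_le_one.trans hq1) 3) (sq_nonneg t)]
    · have h' : s ≤ q * t := by
        have := mul_le_mul_of_nonneg_left h (zero_le_one.trans hq1)
        nlinarith
      have := mul_le_mul_of_nonneg_right h' hb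
      nlinarith [mul_nonneg hε.le (sq_nonneg s), mul_le_mul_of_nonneg_right hq3 (sq_nonneg t)]
  have h2 : s ^ 3 * t ≤ ε * s ^ 4 + q ^ 3 * t ^ 4 := by
    rcases le_total t (ε * s) with h | h
    · nlinarith [mul_le_mul_of_nonneg_left h (pow_nonneg ha 3), mul_nonneg (pow_nonneg (zero_le_one.trans hq1) 3) (pow_nonneg hb 4)]
    · have h' : s ≤ q * t := by
        have := mul_le_mul_of_nonneg_left h (zero_le_one.trans hq1)
        nlinarith
      have h3 := mul_le_mul_of_nonneg_right (pow_le_pow_left₀ ha h' 3) hb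
      nlinarith [mul_nonneg hε.le (pow_nonneg ha 4)]
  linarith

theorem MemTwoFour.add {u v : α → ℝ} (hu : MemTwoFour u ν) (hv : MemTwoFour v ν) :
    MemTwoFour (fun x => u x + v x) ν := by
  have hm : AEStronglyMeasurable (fun x => u x + v x) ν := hu.meas.add hv.meas
  have hdom : Integrable (fun x => 8 * twoFour (u x) + 8 * twoFour (v x)) ν :=
    (hu.integrable.const_mul 8).add (hv.integrable.const_mul 8)
  refine ⟨hm, hdom.mono' (hm.pow 2) ?_, hdom.mono' (hm.pow 4) ?_⟩
  all_goals
    refine Eventually.of_forall fun x => ?_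
    refine le_trans ?_ (twoFour_add_le (u x) (v x))
    rw [Real.norm_of_nonneg (by positivity)]
    unfold twoFour
    nlinarith [sq_nonneg (u x + v x), pow_nonneg (sq_nonneg (u x + v x)) 2]

theorem MemTwoFour.const_mul {u : α → ℝ} (hu : MemTwoFour u ν) (a : ℝ) :
    MemTwoFour (fun x => a * u x) ν := by
  refine ⟨hu.meas.const_mul a, ?_, ?_⟩
  · simp_rw [mul_pow]; exact hu.sq.const_mul _
  · simp_rw [mul_pow]; exact hu.four.const_mul _

theorem MemTwoFour.sub {u v : α → ℝ} (hu : MemTwoFour u ν) (hv : MemTwoFour v ν) :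
    MemTwoFour (fun x => u x - v x) ν := by
  have := hu.add (hv.const_mul (-1))
  simpa [sub_eq_add_neg] using this

/-- Dominated convergence with respect to sequences converging in `L² ∩ L⁴`. -/
theorem tendsto_integral_of_strong_bound {v w : ℕ → α → ℝ} {u h : α → ℝ}
    {k : ℕ → α → ℝ} {k₀ : α → ℝ} {C : ℝ} (hC : 0 ≤ C)
    (hv : ∀ n, MemTwoFour (v n) ν) (hu : MemTwoFour u ν)
    (hw : ∀ n, MemTwoFour (w n) ν) (hh : MemTwoFour h ν)
    (hvu : Tendsto (fun n => ∫ x, twoFour (v n x - u x) ∂ν) atTop (𝓝 0))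
    (hwh : Tendsto (fun n => ∫ x, twoFour (w n x - h x) ∂ν) atTop (𝓝 0))
    (hk : ∀ n, AEStronglyMeasurable (k n) ν) (hk₀ : Integrable k₀ ν)
    (hbound : ∀ n x, |k n x| ≤ C * (twoFour (v n x) + twoFour (w n x)))
    (hbound₀ : ∀ x, |k₀ x| ≤ C * (twoFour (u x) + twoFour (h x)))
    (hlim : ∀ᵐ x ∂ν, Tendsto (fun n => k n x) atTop (𝓝 (k₀ x))) :
    Tendsto (fun n => ∫ x, k n x ∂ν) atTop (𝓝 (∫ x, k₀ x ∂ν)) := by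
  have hki : ∀ n, Integrable (k n) ν := fun n =>
    (((hv n).integrable.add (hw n).integrable).const_mul C).mono' (hk n)
      (Eventually.of_forall (hbound n))
  have key : Tendsto (fun n => ∫ x, |k n x - k₀ x| ∂ν) atTop (𝓝 0) := by
    refine tendsto_integral_zero_of_almost_dominated (fun n => ((hki n).sub hk₀).abs)
      (fun n x => abs_nonneg _) ?_ fun ε hε => ?_
    · filter_upwards [hlim] with x hx
      simpa using (hx.sub_const (k₀ x)).abs
    -- The 8 comes from `twoFour_add_le` applied to v = (v - u) + u; the 9 adds the bound of `k₀`
    -- itself.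
    refine ⟨fun n x => C * (8 * twoFour (v n x - u x) + 8 * twoFour (w n x - h x)),
      fun x => C * (9 * twoFour (u x) + 9 * twoFour (h x)), fun n => ?_, ?_, fun x => ?_,
      fun n => ?_, fun n x => ?_, ?_⟩
    · exact ((((hv n).sub hu).integrable.const_mul 8).add
        (((hw n).sub hh).integrable.const_mul 8)).const_mul C
    · exact ((hu.integrable.const_mul 9).add (hh.integrable.const_mul 9)).const_mul C
    · have := twoFour_nonneg (u x); have := twoFour_nonneg (h x); positivity
    · refine Eventually.of_forall fun x => ?_
      have h1 := twoFour_add_le (v n x - u x) (u x)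
      have h2 := twoFour_add_le (w n x - h x) (h x)
      rw [sub_add_cancel] at h1 h2
      have h3 := abs_sub (k n x) (k₀ x)
      have h4 := hbound n x
      have h5 := hbound₀ x
      have h6 : C * (twoFour (v n x) + twoFour (w n x)) ≤
          C * (8 * twoFour (v n x - u x) + 8 * twoFour (u x) +
            (8 * twoFour (w n x - h x) + 8 * twoFour (h x))) := by gcongr
      nlinarith
    · have := twoFour_nonneg (v n x - u x); have := twoFour_nonneg (w n x - h x); positivity
    · have h1 : Tendsto (fun n => ∫ x, C * (8 * twoFour (v n x - u x) +
          8 * twoFour (w n x - h x)) ∂ν) atTop (𝓝 (C * (8 * 0 + 8 * 0))) := by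
        refine (((hvu.const_mul 8).add (hwh.const_mul 8)).const_mul C).congr fun n => ?_
        rw [integral_const_mul, integral_add (((hv n).sub hu).integrable.const_mul 8)
          (((hw n).sub hh).integrable.const_mul 8), integral_const_mul, integral_const_mul]
      refine (h1.eventually_lt_const ?_).mono fun n hn => hn.le
      simpa using hε
  rw [tendsto_iff_norm_sub_tendsto_zero]
  refine squeeze_zero (fun n => norm_nonneg _) (fun n => ?_) key
  rw [← integral_sub (hki n) hk₀]
  exact norm_integral_le_integral_norm _

variable {f : ℝ → ℝ} {C : ℝ}

theorem integrable_comp_mul (hf : Continuous f) (hfC : ∀ s, |f s| ≤ C * (|s| + |s| ^ 3))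
    {u h : α → ℝ} (hu : MemTwoFour u ν) (hh : MemTwoFour h ν) (hC : 0 ≤ C) :
    Integrable (fun x => f (u x) * h x) ν := by
  refine ((hu.integrable.add hh.integrable).const_mul C).mono'
    ((hf.comp_aestronglyMeasurable hu.meas).mul hh.meas) (Eventually.of_forall fun x => ?_)
  rw [Real.norm_eq_abs, abs_mul]
  calc |f (u x)| * |h x| ≤ C * (|u x| + |u x| ^ 3) * |h x| := by gcongr; exact hfC _
    _ = C * ((|u x| + |u x| ^ 3) * |h x|) := by ring
    _ ≤ C * (twoFour (u x) + twoFour (h x)) := by gcongr; exact mul_le_twoFour _ _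

/-- Bounded sequences in `L² ∩ L⁴` that converge almost everywhere: the Nemytskii operator of a
function of cubic growth is weakly continuous along them. -/
theorem tendsto_integral_comp_mul_of_bounded (hf : Continuous f)
    (hfC : ∀ s, |f s| ≤ C * (|s| + |s| ^ 3)) (hC : 0 ≤ C)
    {v : ℕ → α → ℝ} {u h : α → ℝ} {K : ℝ}
    (hv : ∀ n, MemTwoFour (v n) ν) (hu : MemTwoFour u ν) (hh : MemTwoFour h ν)
    (hK : ∀ n, ∫ x, twoFour (v n x) ∂ν ≤ K)
    (hlim : ∀ᵐ x ∂ν, Tendsto (fun n => v n x) atTop (𝓝 (u x))) :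
    Tendsto (fun n => ∫ x, f (v n x) * h x ∂ν) atTop (𝓝 (∫ x, f (u x) * h x ∂ν)) := by
  have hi : ∀ n, Integrable (fun x => f (v n x) * h x) ν := fun n =>
    integrable_comp_mul hf hfC (hv n) hh hC
  have hi0 : Integrable (fun x => f (u x) * h x) ν := integrable_comp_mul hf hfC hu hh hC
  have hK0 : 0 ≤ K := (integral_nonneg fun x => twoFour_nonneg _).trans (hK 0)
  have hb : ∀ ε, 0 < ε → ε ≤ 1 → ∀ a b : ℝ, |f a * b| ≤ C * (ε * twoFour a + ε⁻¹ ^ 3 * twoFour b) := by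
    intro ε h1 h2 a b
    rw [abs_mul]
    calc |f a| * |b| ≤ C * (|a| + |a| ^ 3) * |b| := by gcongr; exact hfC _
      _ = C * ((|a| + |a| ^ 3) * |b|) := by ring
      _ ≤ _ := by gcongr; exact mul_le_twoFour_weighted h1 h2 _ _
  have key : Tendsto (fun n => ∫ x, |f (v n x) * h x - f (u x) * h x| ∂ν) atTop (𝓝 0) := by
    refine tendsto_integral_zero_of_almost_dominated (fun n => ((hi n).sub hi0).abs)
      (fun n x => abs_nonneg _) ?_ fun ε hε => ?_
    · filter_upwards [hlim] with x hx
      have h1 : Tendsto (fun n => f (v n x) * h x) atTop (𝓝 (f (u x) * h x)) :=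
        ((hf.tendsto _).comp hx).mul_const _
      simpa using (h1.sub_const (f (u x) * h x)).abs
    -- With this weight the bounded sequence accounts for at most `ε`, and everything else depends
    -- only on the fixed functions `u` and `h`.
    obtain ⟨δ, hδ, hδ1, hδε⟩ : ∃ δ > 0, δ ≤ 1 ∧ C * (δ * K) ≤ ε := by
      refine ⟨min 1 (ε / (C * K + 1)), lt_min one_pos (by positivity), min_le_left _ _, ?_⟩
      calc C * (min 1 (ε / (C * K + 1)) * K) ≤ C * (ε / (C * K + 1) * K) := by
            gcongr; exact min_le_right _ _
        _ = ε * (C * K / (C * K + 1)) := by ring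
        _ ≤ ε * 1 := by
            gcongr
            rw [div_le_one (by positivity)]; linarith
        _ = ε := mul_one _
    refine ⟨fun n x => C * (δ * twoFour (v n x)),
      fun x => C * (δ⁻¹ ^ 3 * twoFour (h x)) + |f (u x) * h x|, fun n => ?_, ?_, fun x => ?_,
      fun n => ?_, fun n x => ?_, ?_⟩
    · exact ((hv n).integrable.const_mul δ).const_mul C
    · exact ((hh.integrable.const_mul _).const_mul C).add hi0.abs
    · have := twoFour_nonneg (h x); positivity
    · refine Eventually.of_forall fun x => ?_
      have h1 := abs_sub (f (v n x) * h x) (f (u x) * h x)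
      have h2 := hb δ hδ hδ1 (v n x) (h x)
      nlinarith
    · have := twoFour_nonneg (v n x); positivity
    · refine Eventually.of_forall fun n => ?_
      rw [integral_const_mul, integral_const_mul]
      refine le_trans ?_ hδε
      gcongr
      exact hK n
  rw [tendsto_iff_norm_sub_tendsto_zero]
  refine squeeze_zero (fun n => norm_nonneg _) (fun n => ?_) key
  rw [← integral_sub (hi n) hi0]
  exact norm_integral_le_integral_norm _

namespace Shrira

theorem hasDerivAt_primitive (hf : Continuous f) (s : ℝ) : HasDerivAt (primitive f) (f s) s :=
  intervalIntegral.integral_hasDerivAt_right (hf.intervalIntegrable _ _)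
    hf.aestronglyMeasurable.stronglyMeasurableAtFilter hf.continuousAt

theorem continuous_primitive (hf : Continuous f) : Continuous (primitive f) :=
  continuous_iff_continuousAt.2 fun s => (hasDerivAt_primitive hf s).continuousAt

/-- The mean value theorem for endpoints in either order, through which growth bounds for `f` become
bounds for increments of its primitive. -/
theorem exists_primitive_sub_eq (hf : Continuous f) (a b : ℝ) :
    ∃ c ∈ Set.uIcc a b, primitive f b - primitive f a = f c * (b - a) := by
  rcases lt_trichotomy a b with h | h | h
  · obtain ⟨c, hc, h1⟩ := exists_hasDerivAt_eq_slope (primitive f) f h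
      (continuous_primitive hf).continuousOn fun x _ => hasDerivAt_primitive hf x
    refine ⟨c, Set.Icc_subset_uIcc (Set.Ioo_subset_Icc_self hc), ?_⟩
    rw [h1, div_mul_cancel₀ _ (sub_ne_zero.2 h.ne')]
  · exact ⟨a, Set.left_mem_uIcc, by simp [h]⟩
  · obtain ⟨c, hc, h1⟩ := exists_hasDerivAt_eq_slope (primitive f) f h
      (continuous_primitive hf).continuousOn fun x _ => hasDerivAt_primitive hf x
    refine ⟨c, Set.Icc_subset_uIcc' (Set.Ioo_subset_Icc_self hc), ?_⟩
    rw [h1]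
    field_simp [sub_ne_zero.2 h.ne']
    ring

theorem abs_le_add_of_mem_uIcc {a b c : ℝ} (hc : c ∈ Set.uIcc a b) : |c| ≤ |a| + |b - a| := by
  have h1 : |c - a| ≤ |b - a| := Set.abs_sub_left_of_mem_uIcc hc
  have h2 := abs_add_le a (c - a)
  rw [add_sub_cancel] at h2
  linarith

/-- As s ≤ 1, the mean value point is at most |a| + |b| in absolute value. The result majorizes the
difference quotients uniformly in `s`; 9 is the 8 of `twoFour_add_le` plus one from Young's
inequality. -/
theorem abs_primitive_add_sub_le (hf : Continuous f) (hfC : ∀ s, |f s| ≤ C * (|s| + |s| ^ 3))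
    (hC : 0 ≤ C) {s : ℝ} (hs : 0 < s) (hs1 : s ≤ 1) (a b : ℝ) :
    |(primitive f (a + s * b) - primitive f a) / s| ≤ C * 9 * (twoFour a + twoFour b) := by
  obtain ⟨c, hc, h1⟩ := exists_primitive_sub_eq hf a (a + s * b)
  have h2 := abs_le_add_of_mem_uIcc hc
  rw [h1, show f c * (a + s * b - a) / s = f c * b by field_simp; ring, abs_mul]
  have h3 : |c| ≤ |(|a| + |b|)| := by
    rw [abs_of_nonneg (add_nonneg (abs_nonneg a) (abs_nonneg b))]
    refine h2.trans ?_
    rw [add_sub_cancel_left, abs_mul, abs_of_pos hs]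
    nlinarith [abs_nonneg b]
  calc |f c| * |b| ≤ C * (|c| + |c| ^ 3) * |b| := by gcongr; exact hfC _
    _ = C * ((|c| + |c| ^ 3) * |b|) := by ring
    _ ≤ C * (twoFour c + twoFour b) := by gcongr; exact mul_le_twoFour _ _
    _ ≤ C * ((8 * twoFour a + 8 * twoFour b) + twoFour b) := by
        gcongr
        refine (twoFour_mono h3).trans ((twoFour_add_le _ _).trans_eq ?_)
        rw [twoFour_abs, twoFour_abs]
    _ ≤ C * 9 * (twoFour a + twoFour b) := by
        have := twoFour_nonneg a
        nlinarith

theorem abs_primitive_le (hf : Continuous f) (hfC : ∀ s, |f s| ≤ C * (|s| + |s| ^ 3))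
    (hC : 0 ≤ C) (a : ℝ) : |primitive f a| ≤ C * twoFour a := by
  obtain ⟨c, hc, h1⟩ := exists_primitive_sub_eq hf 0 a
  have h2 := abs_le_add_of_mem_uIcc hc
  have h0 : primitive f 0 = 0 := by simp [primitive]
  rw [h0, sub_zero, sub_zero] at h1
  rw [abs_zero, zero_add, sub_zero] at h2
  rw [h1, abs_mul, ← twoFour_abs a]
  calc |f c| * |a| ≤ C * (|c| + |c| ^ 3) * |a| := by gcongr; exact hfC _
    _ ≤ C * (|a| + |a| ^ 3) * |a| := by gcongr
    _ = _ := by unfold twoFour; ring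

theorem integrable_primitive (hf : Continuous f) (hfC : ∀ s, |f s| ≤ C * (|s| + |s| ^ 3))
    (hC : 0 ≤ C) {u : α → ℝ} (hu : MemTwoFour u ν) :
    Integrable (fun x => primitive f (u x)) ν :=
  (hu.integrable.const_mul C).mono' ((continuous_primitive hf).comp_aestronglyMeasurable hu.meas)
    (Eventually.of_forall fun _ => abs_primitive_le hf hfC hC _)

/-- `v n → u` and `w n → h` almost everywhere and in `L² ∩ L⁴`: the difference quotients of
`∫ F` converge. -/
theorem tendsto_integral_primitive_slope (hf : Continuous f)
    (hfC : ∀ s, |f s| ≤ C * (|s| + |s| ^ 3)) (hC : 0 ≤ C)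
    {v w : ℕ → α → ℝ} {u h : α → ℝ} {s : ℕ → ℝ}
    (hv : ∀ n, MemTwoFour (v n) ν) (hu : MemTwoFour u ν)
    (hw : ∀ n, MemTwoFour (w n) ν) (hh : MemTwoFour h ν)
    (hvu : Tendsto (fun n => ∫ x, twoFour (v n x - u x) ∂ν) atTop (𝓝 0))
    (hwh : Tendsto (fun n => ∫ x, twoFour (w n x - h x) ∂ν) atTop (𝓝 0))
    (hva : ∀ᵐ x ∂ν, Tendsto (fun n => v n x) atTop (𝓝 (u x)))
    (hwa : ∀ᵐ x ∂ν, Tendsto (fun n => w n x) atTop (𝓝 (h x)))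
    (hs : Tendsto s atTop (𝓝 0)) (hs0 : ∀ n, 0 < s n) (hs1 : ∀ n, s n ≤ 1) :
    Tendsto (fun n => (∫ x, primitive f (v n x + s n * w n x) ∂ν - ∫ x, primitive f (v n x) ∂ν)
      / s n) atTop (𝓝 (∫ x, f (u x) * h x ∂ν)) := by
  have hF := continuous_primitive hf
  have heq : ∀ n, (∫ x, primitive f (v n x + s n * w n x) ∂ν - ∫ x, primitive f (v n x) ∂ν) / s n
      = ∫ x, (primitive f (v n x + s n * w n x) - primitive f (v n x)) / s n ∂ν := by
    intro n
    rw [integral_div, integral_sub (integrable_primitive hf hfC hC ((hv n).add ((hw n).const_mul _)))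
      (integrable_primitive hf hfC hC (hv n))]
  simp_rw [heq]
  refine tendsto_integral_of_strong_bound (C := C * 9) (by positivity) hv hu hw hh hvu hwh
    (fun n => ?_) (integrable_comp_mul hf hfC hu hh hC)
    (fun n x => abs_primitive_add_sub_le hf hfC hC (hs0 n) (hs1 n) _ _) (fun x => ?_) ?_
  · simp_rw [div_eq_mul_inv]
    exact AEStronglyMeasurable.mul_const ((hF.comp_aestronglyMeasurable
      ((hv n).add ((hw n).const_mul _)).meas).sub
      (hF.comp_aestronglyMeasurable (hv n).meas)) _
  · rw [abs_mul]
    have h1 := twoFour_nonneg (u x)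
    have h2 := twoFour_nonneg (h x)
    calc |f (u x)| * |h x| ≤ C * (|u x| + |u x| ^ 3) * |h x| := by gcongr; exact hfC _
      _ = C * ((|u x| + |u x| ^ 3) * |h x|) := by ring
      _ ≤ C * (twoFour (u x) + twoFour (h x)) := by gcongr; exact mul_le_twoFour _ _
      _ ≤ C * 9 * (twoFour (u x) + twoFour (h x)) := by gcongr; linarith
  · filter_upwards [hva, hwa] with x hx1 hx2
    have hc : ∀ n, ∃ c ∈ Set.uIcc (v n x) (v n x + s n * w n x),
        (primitive f (v n x + s n * w n x) - primitive f (v n x)) / s n = f c * w n x := by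
      intro n
      obtain ⟨c, hc, h1⟩ := exists_primitive_sub_eq hf (v n x) (v n x + s n * w n x)
      refine ⟨c, hc, ?_⟩
      have := (hs0 n).ne'
      rw [h1]
      field_simp
      ring
    choose c hc1 hc2 using hc
    simp_rw [hc2]
    refine ((hf.tendsto _).comp ?_).mul hx2
    have h1 : Tendsto (fun n => v n x + s n * w n x) atTop (𝓝 (u x)) := by
      simpa using hx1.add (hs.mul hx2)
    have h2 : Tendsto (fun n => c n - v n x) atTop (𝓝 0) := by
      refine squeeze_zero_norm (a := fun n => |v n x + s n * w n x - v n x|)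
        (fun n => Set.abs_sub_left_of_mem_uIcc (hc1 n)) ?_
      simpa using (h1.sub hx1).abs
    simpa using h2.add hx1

theorem tendsto_integral_primitive (hf : Continuous f)
    (hfC : ∀ s, |f s| ≤ C * (|s| + |s| ^ 3)) (hC : 0 ≤ C)
    {v : ℕ → α → ℝ} {u : α → ℝ}
    (hv : ∀ n, MemTwoFour (v n) ν) (hu : MemTwoFour u ν)
    (hvu : Tendsto (fun n => ∫ x, twoFour (v n x - u x) ∂ν) atTop (𝓝 0))
    (hva : ∀ᵐ x ∂ν, Tendsto (fun n => v n x) atTop (𝓝 (u x))) :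
    Tendsto (fun n => ∫ x, primitive f (v n x) ∂ν) atTop (𝓝 (∫ x, primitive f (u x) ∂ν)) := by
  have hF := continuous_primitive hf
  have hb : ∀ a, |primitive f a| ≤ C * (twoFour a + twoFour a) := fun a =>
    (abs_primitive_le hf hfC hC a).trans (by gcongr; linarith [twoFour_nonneg a])
  refine tendsto_integral_of_strong_bound hC hv hu hv hu hvu hvu
    (fun n => hF.comp_aestronglyMeasurable (hv n).meas) (integrable_primitive hf hfC hC hu)
    (fun n x => hb _) (fun x => hb _) ?_
  filter_upwards [hva] with x hx
  exact (hF.tendsto _).comp hx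

end Shrira
end Nemytskii

/-! ### Fourier transform on L², translations, frequency cut-offs -/

noncomputable section

namespace Shrira

open scoped RealInnerProductSpace ContDiff

/-- Compactly supported test functions suffice to identify locally integrable functions, and their
products with smooth functions are again Schwartz. -/
theorem ae_eq_of_integral_schwartz_smul_eq {a b : Plane → ℂ} (ha : LocallyIntegrable a)
    (hb : LocallyIntegrable b) (h : ∀ ψ : 𝓢(Plane, ℂ), HasCompactSupport ψ →
      ∫ z, ψ z • a z = ∫ z, ψ z • b z) : a =ᵐ[volume] b := by
  refine ae_eq_of_integral_contDiff_smul_eq ha hb fun g hg hgc => ?_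
  have hgc' : HasCompactSupport (fun z => (g z : ℂ)) := hgc.comp_left Complex.ofReal_zero
  have := h (hgc'.toSchwartzMap (Complex.ofRealCLM.contDiff.comp hg)) hgc'
  simp only [smul_eq_mul, Complex.real_smul] at this ⊢
  exact this

theorem integral_schwartz_smul_fourier (u : ComplexL2) (ψ : 𝓢(Plane, ℂ)) :
    ∫ z, ψ z • (𝓕 u : ComplexL2) z = ∫ z, (𝓕 ψ) z • u z := by
  have h := congrArg (fun T => T ψ) (Lp.fourier_toTemperedDistribution_eq u)
  simpa using h.symm

theorem integral_schwartz_smul_fourierInv (u : ComplexL2) (ψ : 𝓢(Plane, ℂ)) :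
    ∫ z, ψ z • (𝓕⁻ u : ComplexL2) z = ∫ z, (𝓕⁻ ψ) z • u z := by
  have h := congrArg (fun T => T ψ) (Lp.fourierInv_toTemperedDistribution_eq u)
  simpa using h.symm

theorem locallyIntegrable_complexL2 (u : ComplexL2) : LocallyIntegrable (u : Plane → ℂ) volume :=
  (Lp.memLp u).locallyIntegrable (by norm_num)

theorem continuous_neg_inner : Continuous fun p : Plane × Plane => (-innerₗ Plane) p.1 p.2 := by
  have : Continuous fun p : Plane × Plane => -(⟪p.1, p.2⟫ : ℝ) := by fun_prop
  exact this

/-- Fubini: the inverse transform is the Fourier integral of the pairing `-innerₗ`, which is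
symmetric. -/
theorem integral_fourierInv_smul_flip {g ψ : Plane → ℂ} (hg : Integrable g) (hψ : Integrable ψ) :
    ∫ z, ψ z • (𝓕⁻ g) z = ∫ z, (𝓕⁻ ψ) z • g z := by
  have h := VectorFourier.integral_fourierIntegral_smul_eq_flip (μ := (volume : Measure Plane))
    (ν := (volume : Measure Plane)) (L := -innerₗ Plane) (f := ψ) (g := g)
    Real.continuous_fourierChar continuous_neg_inner hψ hg
  have h1 : (-innerₗ Plane).flip = -innerₗ Plane := by
    refine LinearMap.ext fun x => LinearMap.ext fun y => ?_
    simp [real_inner_comm]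
  rw [h1] at h
  have h2 : ∀ k : Plane → ℂ, VectorFourier.fourierIntegral 𝐞 volume (-innerₗ Plane) k = 𝓕⁻ k := by
    intro k
    ext w
    rw [Real.fourierInv_eq]
    simp [VectorFourier.fourierIntegral]
  rw [h2, h2] at h
  exact h.symm

/-- On `L¹ ∩ L²` the inverse Fourier transform is given by the integral. -/
theorem fourierInv_toLp_ae_eq {g : Plane → ℂ} (hg : Integrable g) (hg2 : MemLp g 2) :
    (𝓕⁻ (hg2.toLp g) : ComplexL2) =ᵐ[volume] 𝓕⁻ g := by
  have hc : Continuous (𝓕⁻ g) := by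
    have := VectorFourier.fourierIntegral_continuous (μ := (volume : Measure Plane))
      (L := -innerₗ Plane) (f := g) Real.continuous_fourierChar
      continuous_neg_inner hg
    convert this using 1
    ext w
    rw [Real.fourierInv_eq]
    simp [VectorFourier.fourierIntegral]
  refine ae_eq_of_integral_schwartz_smul_eq (locallyIntegrable_complexL2 _)
    hc.locallyIntegrable fun ψ _ => ?_
  rw [integral_schwartz_smul_fourierInv, integral_fourierInv_smul_flip hg ψ.integrable]
  refine integral_congr_ae ?_
  filter_upwards [hg2.coeFn_toLp] with z hz
  rw [hz, SchwartzMap.fourierInv_coe]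

/-- The character `ζ ↦ exp (2 π i a · ζ)`. -/
def phase (a ζ : Plane) : ℂ := (𝐞 ⟪ζ, a⟫ : ℂ)

theorem norm_phase (a ζ : Plane) : ‖phase a ζ‖ = 1 := Circle.norm_coe _

theorem phase_add (a b ζ : Plane) : phase (a + b) ζ = phase a ζ * phase b ζ := by
  simp [phase, inner_add_right, AddChar.map_add_eq_mul]

theorem contDiff_phase (a : Plane) : ContDiff ℝ ∞ (phase a) := by
  have : phase a = fun ζ => Complex.exp (2 * Real.pi * ((⟪ζ, a⟫ : ℝ) : ℂ) * Complex.I) := by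
    ext ζ; rw [phase, Real.fourierChar_apply]; push_cast; rfl
  rw [this]
  have h : ContDiff ℝ ∞ fun ζ : Plane => ((⟪ζ, a⟫ : ℝ) : ℂ) :=
    Complex.ofRealCLM.contDiff.comp (contDiff_id.inner ℝ contDiff_const)
  exact ((contDiff_const.mul h).mul contDiff_const).cexp

theorem continuous_phase (a : Plane) : Continuous (phase a) := (contDiff_phase a).continuous

theorem measurePreserving_add_right_plane (a : Plane) :
    MeasurePreserving (fun z : Plane => z + a) volume volume :=
  measurePreserving_add_right volume a

/-- The translation `u ↦ u(· + a)` of `L²`. -/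
def translate (a : Plane) (u : RealL2) : RealL2 :=
  Lp.compMeasurePreserving (fun z => z + a) (measurePreserving_add_right_plane a) u

theorem coeFn_translate (a : Plane) (u : RealL2) :
    translate a u =ᵐ[volume] fun z => u (z + a) :=
  Lp.coeFn_compMeasurePreserving u (measurePreserving_add_right_plane a)

theorem coeFn_toComplex (u : RealL2) : toComplex u =ᵐ[volume] fun z => (u z : ℂ) :=
  Complex.ofRealCLM.coeFn_compLp u

theorem fourier_phase_mul (a : Plane) (ψ : Plane → ℂ) (z : Plane) :
    𝓕 (fun ζ => phase a ζ * ψ ζ) z = 𝓕 ψ (z - a) := by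
  rw [Real.fourier_eq, Real.fourier_eq]
  refine integral_congr_ae (Eventually.of_forall fun ζ => ?_)
  simp only [phase, Circle.smul_def, smul_eq_mul, inner_sub_right, neg_sub]
  rw [← mul_assoc, ← Circle.coe_mul, ← AddChar.map_add_eq_mul]
  congr 3
  ring_nf

/-- By duality: the Fourier transform of a test function multiplied by the phase is a translate of
the original transform, and a change of variables moves the translation to `u`. -/
theorem hat_translate (a : Plane) (u : RealL2) :
    hat (translate a u) =ᵐ[volume] fun ζ => phase a ζ * hat u ζ := by
  have hm : MemLp (fun ζ => phase a ζ * hat u ζ) 2 volume := by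
    refine MemLp.of_le (Lp.memLp (hat u))
      ((continuous_phase a).aestronglyMeasurable.mul (Lp.aestronglyMeasurable (hat u)))
      (Eventually.of_forall fun ζ => ?_)
    rw [norm_mul, norm_phase, one_mul]
  refine ae_eq_of_integral_schwartz_smul_eq (locallyIntegrable_complexL2 _)
    (hm.locallyIntegrable (by norm_num)) fun ψ hψ => ?_
  have hc : HasCompactSupport (fun ζ => phase a ζ * ψ ζ) := hψ.mul_left
  let ψa : 𝓢(Plane, ℂ) := hc.toSchwartzMap ((contDiff_phase a).mul (ψ.smooth ⊤))
  have hψa : ∀ ζ, ψa ζ = phase a ζ * ψ ζ := fun ζ => rfl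
  have h1 : ∫ ζ, ψ ζ • (phase a ζ * hat u ζ) = ∫ ζ, ψa ζ • hat u ζ := by
    refine integral_congr_ae (Eventually.of_forall fun ζ => ?_)
    simp only [hψa, smul_eq_mul]; ring
  have h2 : ∀ z, (𝓕 ψa) z = (𝓕 ψ) (z - a) := fun z => by
    rw [SchwartzMap.fourier_coe, SchwartzMap.fourier_coe]
    exact fourier_phase_mul a ψ z
  rw [h1, hat, hat, integral_schwartz_smul_fourier, integral_schwartz_smul_fourier]
  calc ∫ z, (𝓕 ψ) z • toComplex (translate a u) z
      = ∫ z, (𝓕 ψ) (z + a - a) • toComplex u (z + a) := by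
        refine integral_congr_ae ?_
        have h3 := (measurePreserving_add_right_plane a).quasiMeasurePreserving.ae (coeFn_toComplex u)
        filter_upwards [coeFn_toComplex (translate a u), coeFn_translate a u, h3] with z hz1 hz2 hz3
        rw [hz1, hz2, hz3, add_sub_cancel_right]
    _ = ∫ z, (𝓕 ψ) (z - a) • toComplex u z :=
        integral_add_right_eq_self (fun z => (𝓕 ψ) (z - a) • toComplex u z) a
    _ = ∫ z, (𝓕 ψa) z • toComplex u z := by simp_rw [h2]

/-- The part of `G` supported in the ball of radius `A`. -/
def lowPart (A : ℝ) (G : ComplexL2) : ComplexL2 :=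
  ((Lp.memLp G).indicator (measurableSet_ball (x := (0 : Plane)) (ε := A))).toLp _

/-- The part of `G` supported off the ball of radius `A`. -/
def highPart (A : ℝ) (G : ComplexL2) : ComplexL2 :=
  ((Lp.memLp G).indicator (measurableSet_ball (x := (0 : Plane)) (ε := A)).compl).toLp _

theorem coeFn_lowPart (A : ℝ) (G : ComplexL2) :
    lowPart A G =ᵐ[volume] (Metric.ball 0 A).indicator G := MemLp.coeFn_toLp _

theorem coeFn_highPart (A : ℝ) (G : ComplexL2) :
    highPart A G =ᵐ[volume] (Metric.ball 0 A)ᶜ.indicator G := MemLp.coeFn_toLp _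

theorem lowPart_add_highPart (A : ℝ) (G : ComplexL2) : lowPart A G + highPart A G = G := by
  ext1
  filter_upwards [Lp.coeFn_add (lowPart A G) (highPart A G), coeFn_lowPart A G,
    coeFn_highPart A G] with ζ h1 h2 h3
  rw [h1, Pi.add_apply, h2, h3, Set.indicator_self_add_compl_apply]

/-- The inverse Fourier transform of the part of `G` in the ball of radius `A`, at the point
`x`. -/
def lowPass (A : ℝ) (G : ComplexL2) (x : Plane) : ℂ :=
  ∫ ζ in Metric.ball 0 A, phase x ζ * G ζ

theorem integrableOn_ball (A : ℝ) (G : ComplexL2) :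
    IntegrableOn G (Metric.ball 0 A) volume :=
  (locallyIntegrable_complexL2 G).integrableOn_isCompact (isCompact_closedBall 0 A) |>.mono_set
    Metric.ball_subset_closedBall

theorem fourierInv_lowPart (A : ℝ) (G : ComplexL2) :
    (𝓕⁻ (lowPart A G) : ComplexL2) =ᵐ[volume] lowPass A G := by
  have h1 : Integrable ((Metric.ball 0 A).indicator G) (volume : Measure Plane) :=
    (integrable_indicator_iff measurableSet_ball).2 (integrableOn_ball A G)
  filter_upwards [fourierInv_toLp_ae_eq h1
    ((Lp.memLp G).indicator (measurableSet_ball (x := (0 : Plane)) (ε := A)))] with x hx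
  rw [lowPart, hx, Real.fourierInv_eq, lowPass, ← integral_indicator measurableSet_ball]
  refine integral_congr_ae (Eventually.of_forall fun ζ => ?_)
  by_cases hζ : ζ ∈ Metric.ball 0 A <;> simp [hζ, phase, Circle.smul_def]

theorem memLp_cutoff (A : ℝ) (x : Plane) :
    MemLp ((Metric.ball 0 A).indicator fun ζ => (starRingEnd ℂ) (phase x ζ)) 2
      (volume : Measure Plane) := by
  rw [memLp_indicator_iff_restrict measurableSet_ball]
  have : IsFiniteMeasure ((volume : Measure Plane).restrict (Metric.ball 0 A)) :=
    ⟨by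
    rw [Measure.restrict_apply_univ]; exact measure_ball_lt_top⟩
  refine MemLp.of_bound ?_ 1 (Eventually.of_forall fun ζ => ?_)
  · exact (Complex.continuous_conj.comp (continuous_phase x)).aestronglyMeasurable
  · rw [RCLike.norm_conj, norm_phase]

/-- The function representing `G ↦ lowPass A G x` on `L²`. -/
def cutoff (A : ℝ) (x : Plane) : ComplexL2 := (memLp_cutoff A x).toLp _

/-- The value of the low-frequency part at a point is a bounded functional of the function, hence it
passes to weak limits. This is the source of all compactness below. -/
theorem lowPass_eq_inner (A : ℝ) (G : ComplexL2) (x : Plane) :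
    lowPass A G x = inner ℂ (cutoff A x) G := by
  rw [L2.inner_def, lowPass, ← integral_indicator measurableSet_ball]
  refine integral_congr_ae ?_
  filter_upwards [(memLp_cutoff A x).coeFn_toLp] with ζ hζ
  rw [cutoff, hζ]
  by_cases h : ζ ∈ Metric.ball 0 A <;> simp [h, mul_comm]

theorem norm_cutoff (A : ℝ) (x : Plane) : ‖cutoff A x‖ = ‖cutoff A 0‖ := by
  rw [cutoff, cutoff, Lp.norm_toLp, Lp.norm_toLp]
  congr 1
  refine eLpNorm_congr_norm_ae (Eventually.of_forall fun ζ => ?_)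
  by_cases h : ζ ∈ Metric.ball 0 A <;> simp [h, norm_phase]

theorem norm_lowPass_le (A : ℝ) (G : ComplexL2) (x : Plane) :
    ‖lowPass A G x‖ ≤ ‖cutoff A 0‖ * ‖G‖ := by
  rw [lowPass_eq_inner, ← norm_cutoff A x]
  exact norm_inner_le_norm _ _

/-- Lets a point of concentration be moved to the origin. -/
theorem lowPass_hat_translate (A : ℝ) (a : Plane) (u : RealL2) (x : Plane) :
    lowPass A (hat (translate a u)) x = lowPass A (hat u) (x + a) := by
  rw [lowPass, lowPass]
  refine integral_congr_ae (ae_restrict_of_ae ?_)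
  filter_upwards [hat_translate a u] with ζ hζ
  rw [hζ, phase_add]; ring

end Shrira

/-! ### The Sobolev embedding of order one half, and vanishing in L³ -/

namespace Shrira

/-- In polar coordinates in the plane the Jacobian r cancels the weight 1/r. -/
theorem integral_ball_norm_inv {A : ℝ} (hA : 0 ≤ A) :
    IntegrableOn (fun ζ : Plane => ‖ζ‖⁻¹) (Metric.ball 0 A) volume ∧
      ∫ ζ in Metric.ball (0 : Plane) A, ‖ζ‖⁻¹ = 2 * Real.pi * A := by
  have hfun : (Metric.ball (0 : Plane) A).indicator (fun ζ : Plane => ‖ζ‖⁻¹) =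
      fun ζ => (Set.Iio A).indicator (fun r : ℝ => r⁻¹) ‖ζ‖ := by
    ext ζ
    by_cases h : ‖ζ‖ < A <;> simp [h]
  have hfin : Module.finrank ℝ Plane = 2 := by simp
  have hrad : (Set.Ioi (0 : ℝ)).indicator (fun y : ℝ => y ^ (2 - 1) • (Set.Iio A).indicator
      (fun r : ℝ => r⁻¹) y) = (Set.Ioo 0 A).indicator fun _ => (1 : ℝ) := by
    ext y
    by_cases h1 : 0 < y
    · by_cases h2 : y < A <;> simp [h1, h2, h1.ne']
    · simp [h1]
  have hvol : (volume : Measure Plane).real (Metric.ball 0 1) = Real.pi := by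
    rw [measureReal_def, EuclideanSpace.volume_ball_fin_two]
    simp [Real.pi_pos.le]
  constructor
  · rw [← integrable_indicator_iff measurableSet_ball, hfun, integrable_fun_norm_addHaar, hfin,
      ← integrable_indicator_iff measurableSet_Ioi, hrad,
      integrable_indicator_iff measurableSet_Ioo]
    exact integrableOn_const (by simp) (by simp)
  · rw [← integral_indicator measurableSet_ball, hfun, integral_fun_norm_addHaar, hfin, hvol,
      ← integral_indicator measurableSet_Ioi, hrad, integral_indicator measurableSet_Ioo]
    simp [hA]
    ring

/-- The homogeneous Sobolev energy of order one half is at most `N`. -/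
structure HalfEnergyLE (G : ComplexL2) (N : ℝ) : Prop where
  integrable : Integrable (fun ζ => ‖ζ‖ * ‖G ζ‖ ^ 2) volume
  le : ∫ ζ, ‖ζ‖ * ‖G ζ‖ ^ 2 ≤ N

/-- Pointwise |G| ≤ (t/|ζ| + |ζ||G|²/t)/2, integrated over the ball. The parameter `t` is left free
so that the two terms can be balanced. -/
theorem norm_lowPass_le_of_halfEnergy {G : ComplexL2} {N A t : ℝ} (hG : HalfEnergyLE G N)
    (hA : 0 ≤ A) (ht : 0 < t) (x : Plane) :
    ‖lowPass A G x‖ ≤ (t * (2 * Real.pi * A) + N / t) / 2 := by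
  obtain ⟨h1, h2⟩ := integral_ball_norm_inv hA
  have hi : IntegrableOn (fun ζ => (t * ‖ζ‖⁻¹ + (‖ζ‖ * ‖G ζ‖ ^ 2) / t) / 2) (Metric.ball 0 A)
      volume := ((h1.const_mul t).add (hG.integrable.integrableOn.div_const t)).div_const 2
  calc ‖lowPass A G x‖ ≤ ∫ ζ in Metric.ball 0 A, ‖phase x ζ * G ζ‖ :=
        norm_integral_le_integral_norm _
    _ = ∫ ζ in Metric.ball 0 A, ‖G ζ‖ := by simp_rw [norm_mul, norm_phase, one_mul]
    _ ≤ ∫ ζ in Metric.ball 0 A, (t * ‖ζ‖⁻¹ + (‖ζ‖ * ‖G ζ‖ ^ 2) / t) / 2 := by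
        refine integral_mono_ae (integrableOn_ball A G).norm hi (ae_restrict_of_ae ?_)
        have h0 : ∀ᵐ ζ : Plane, ζ ≠ 0 := by
          rw [ae_iff]; simp
        filter_upwards [h0] with ζ hζ
        have hζ' : 0 < ‖ζ‖ := norm_pos_iff.2 hζ
        have : (t * ‖ζ‖⁻¹ + (‖ζ‖ * ‖G ζ‖ ^ 2) / t) / 2 - ‖G ζ‖ =
            (t - ‖ζ‖ * ‖G ζ‖) ^ 2 / (2 * t * ‖ζ‖) := by
          field_simp; ring
        have h3 : 0 ≤ (t - ‖ζ‖ * ‖G ζ‖) ^ 2 / (2 * t * ‖ζ‖) := by positivity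
        linarith
    _ = (t * (2 * Real.pi * A) + (∫ ζ in Metric.ball 0 A, ‖ζ‖ * ‖G ζ‖ ^ 2) / t) / 2 := by
        rw [integral_div, integral_add (h1.const_mul t)
          (hG.integrable.integrableOn.div_const t), integral_const_mul, integral_div, h2]
    _ ≤ (t * (2 * Real.pi * A) + N / t) / 2 := by
        have h3 : ∫ ζ in Metric.ball 0 A, ‖ζ‖ * ‖G ζ‖ ^ 2 ≤ N :=
          (setIntegral_le_integral hG.integrable
            (Eventually.of_forall fun ζ => by simp only [Pi.zero_apply]; positivity)).trans hG.le
        gcongr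

theorem sq_norm_complexL2 (u : ComplexL2) : ‖u‖ ^ 2 = ∫ z, ‖u z‖ ^ 2 := by
  have h : (inner ℂ u u).re = ‖u‖ ^ 2 := by
    rw [inner_self_eq_norm_sq_to_K]; norm_cast
  rw [← h, L2.inner_def]
  have h2 : ∀ z, inner ℂ (u z) (u z) = ((‖u z‖ ^ 2 : ℝ) : ℂ) := fun z => by
    rw [inner_self_eq_norm_sq_to_K]; norm_cast
  simp_rw [h2, integral_complex_ofReal, Complex.ofReal_re]

theorem integrable_sq_norm (u : ComplexL2) : Integrable (fun z => ‖u z‖ ^ 2) volume :=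
  (memLp_two_iff_integrable_sq_norm (Lp.aestronglyMeasurable u)).1 (Lp.memLp u)

theorem lintegral_sq_norm_eq (u : ComplexL2) :
    ∫⁻ z, ENNReal.ofReal (‖u z‖ ^ 2) = ENNReal.ofReal (‖u‖ ^ 2) := by
  rw [sq_norm_complexL2, ofReal_integral_eq_lintegral_ofReal (integrable_sq_norm u)
    (Eventually.of_forall fun z => by simp only [Pi.zero_apply]; positivity)]

theorem norm_fourierInv_complexL2 (G : ComplexL2) : ‖(𝓕⁻ G : ComplexL2)‖ = ‖G‖ :=
  (Lp.fourierTransformₗᵢ Plane ℂ).symm.norm_map G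

theorem lintegral_sq_highPart (A : ℝ) (G : ComplexL2) :
    ENNReal.ofReal (‖highPart A G‖ ^ 2) =
      ∫⁻ ζ, (Metric.ball (0 : Plane) A)ᶜ.indicator (fun ζ => ENNReal.ofReal (‖G ζ‖ ^ 2)) ζ := by
  rw [← lintegral_sq_norm_eq]
  refine lintegral_congr_ae ?_
  filter_upwards [coeFn_highPart A G] with ζ hζ
  rw [hζ]
  by_cases h : ζ ∈ (Metric.ball (0 : Plane) A)ᶜ
  · rw [Set.indicator_of_mem h, Set.indicator_of_mem h]
  · rw [Set.indicator_of_notMem h, Set.indicator_of_notMem h]; simp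

/-- Off the ball |ζ|/A ≥ 1, so the energy dominates: high frequencies are small in L² uniformly on
bounded sets of the energy. -/
theorem sq_norm_highPart_le {G : ComplexL2} {N A : ℝ} (hG : HalfEnergyLE G N) (hA : 0 < A) :
    ‖highPart A G‖ ^ 2 ≤ N / A := by
  rw [sq_norm_complexL2]
  calc ∫ ζ, ‖highPart A G ζ‖ ^ 2 ≤ ∫ ζ, (‖ζ‖ * ‖G ζ‖ ^ 2) / A := by
        refine integral_mono_ae (integrable_sq_norm _) (hG.integrable.div_const A) ?_
        filter_upwards [coeFn_highPart A G] with ζ hζ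
        simp only [hζ]
        by_cases h : ζ ∈ (Metric.ball (0 : Plane) A)ᶜ
        · rw [Set.indicator_of_mem h, le_div_iff₀ hA, mul_comm]
          gcongr
          simpa using h
        · rw [Set.indicator_of_notMem h]
          simp only [norm_zero, ne_eq, OfNat.ofNat_ne_zero, not_false_eq_true, zero_pow]
          positivity
    _ = (∫ ζ, ‖ζ‖ * ‖G ζ‖ ^ 2) / A := integral_div _ _
    _ ≤ N / A := by gcongr; exact hG.le

theorem HalfEnergyLE.highPart {G : ComplexL2} {N : ℝ} (hG : HalfEnergyLE G N) (A : ℝ) :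
    HalfEnergyLE (highPart A G) N := by
  have h : ∀ᵐ ζ, ‖ζ‖ * ‖Shrira.highPart A G ζ‖ ^ 2 ≤ ‖ζ‖ * ‖G ζ‖ ^ 2 := by
    filter_upwards [coeFn_highPart A G] with ζ hζ
    rw [hζ]
    gcongr
    exact norm_indicator_le_norm_self _ _
  have hi : Integrable (fun ζ => ‖ζ‖ * ‖Shrira.highPart A G ζ‖ ^ 2) volume := by
    refine hG.integrable.mono' ?_ ?_
    · exact continuous_norm.aestronglyMeasurable.mul
        ((Lp.aestronglyMeasurable _).norm.pow 2)
    · filter_upwards [h] with ζ hζ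
      rwa [Real.norm_of_nonneg (by positivity)]
  exact ⟨hi, (integral_mono_ae hi hG.integrable h).trans hG.le⟩

theorem fourierInv_lowPart_add_highPart (A : ℝ) (u : ComplexL2) :
    ∀ᵐ z, u z = lowPass A (𝓕 u) z + (𝓕⁻ (highPart A (𝓕 u)) : ComplexL2) z := by
  have h : u = (𝓕⁻ (lowPart A (𝓕 u)) : ComplexL2) + 𝓕⁻ (highPart A (𝓕 u)) := by
    rw [← FourierTransform.fourierInv_add, lowPart_add_highPart]
    exact (FourierTransform.fourierInv_fourier_eq u).symm
  have h2 : (u : Plane → ℂ) =ᵐ[volume]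
      ((𝓕⁻ (lowPart A (𝓕 u)) : ComplexL2) + 𝓕⁻ (highPart A (𝓕 u)) : ComplexL2) := by rw [← h]
  filter_upwards [h2, Lp.coeFn_add (𝓕⁻ (lowPart A (𝓕 u)) : ComplexL2)
    (𝓕⁻ (highPart A (𝓕 u)) : ComplexL2), fourierInv_lowPart A (𝓕 u)] with z h3 h4 h5
  rw [h3, h4, Pi.add_apply, h5]

/-- The distribution function of a function with finite homogeneous Sobolev energy. -/
theorem volume_norm_gt_le {u : ComplexL2} {N r : ℝ} (hu : HalfEnergyLE (𝓕 u) N) (hN : 0 < N)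
    (hr : 0 < r) :
    volume {z | r < ‖u z‖} * ENNReal.ofReal (r ^ 2) ≤
      4 * ∫⁻ ζ, (Metric.ball (0 : Plane) (r ^ 2 / (8 * Real.pi * N)))ᶜ.indicator
        (fun ζ => ENNReal.ofReal (‖(𝓕 u : ComplexL2) ζ‖ ^ 2)) ζ := by
  have hpi := Real.pi_pos
  set A := r ^ 2 / (8 * Real.pi * N) with hA
  have hA0 : 0 < A := by positivity
  set h : ComplexL2 := 𝓕⁻ (highPart A (𝓕 u)) with hh
  rw [← lintegral_sq_highPart, ← norm_fourierInv_complexL2, ← hh, ← lintegral_sq_norm_eq]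
  -- The radius `A` and `t = 2N/r` make the low-frequency part at most r/2 everywhere, so where |u|
  -- > r the high part is at least r/2; Chebyshev's inequality then gives the factor 4.
  have hsub : ∀ᵐ z, r < ‖u z‖ → ENNReal.ofReal (r ^ 2 / 4) ≤ ENNReal.ofReal (‖h z‖ ^ 2) := by
    filter_upwards [fourierInv_lowPart_add_highPart A u] with z hz hlt
    have h1 := norm_lowPass_le_of_halfEnergy hu hA0.le (t := 2 * N / r) (by positivity) z
    have h2 : (2 * N / r * (2 * Real.pi * A) + N / (2 * N / r)) / 2 = r / 2 := by
      rw [hA]; field_simp; ring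
    rw [h2] at h1
    rw [hz] at hlt
    have h3 := norm_add_le (lowPass A (𝓕 u) z) (h z)
    have h4 : r / 2 ≤ ‖h z‖ := by linarith
    apply ENNReal.ofReal_le_ofReal
    have := pow_le_pow_left₀ (by positivity) h4 2
    linarith
  have hmeas : AEMeasurable (fun z => ENNReal.ofReal (‖h z‖ ^ 2)) volume :=
    ((Lp.aestronglyMeasurable h).norm.pow 2).aemeasurable.ennreal_ofReal
  have h5 := mul_meas_ge_le_lintegral₀ hmeas (ENNReal.ofReal (r ^ 2 / 4))
  have h6 : volume {z | r < ‖u z‖} ≤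
      volume {z | ENNReal.ofReal (r ^ 2 / 4) ≤ ENNReal.ofReal (‖h z‖ ^ 2)} := measure_mono_ae hsub
  have h7 : ENNReal.ofReal (r ^ 2) = 4 * ENNReal.ofReal (r ^ 2 / 4) := by
    rw [show (4 : ENNReal) = ENNReal.ofReal 4 by simp, ← ENNReal.ofReal_mul (by norm_num)]
    congr 1; ring
  rw [h7, mul_comm, mul_assoc]
  gcongr
  exact (mul_le_mul_right h6 _).trans h5

/-- The embedding of the Sobolev space of order one half of the plane in `L⁴`. -/
theorem lintegral_four_le {u : ComplexL2} {N : ℝ} (hu : HalfEnergyLE (𝓕 u) N) (hN : 0 < N) :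
    ∫⁻ z, ENNReal.ofReal (‖u z‖ ^ 4) ≤ ENNReal.ofReal (64 * Real.pi * N ^ 2) := by
  have hpi := Real.pi_pos
  set G : ComplexL2 := 𝓕 u with hG
  have hlayer := lintegral_rpow_eq_lintegral_meas_lt_mul (volume : Measure Plane)
    (f := fun z => ‖u z‖) (Eventually.of_forall fun z => norm_nonneg _)
    (Lp.aestronglyMeasurable u).norm.aemeasurable (p := 4) (by norm_num)
  have e1 : ∀ z, ‖u z‖ ^ (4 : ℝ) = ‖u z‖ ^ 4 := fun z => by
    rw [show (4 : ℝ) = ((4 : ℕ) : ℝ) by norm_num, Real.rpow_natCast]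
  have e2 : ∀ r : ℝ, r ^ ((4 : ℝ) - 1) = r ^ 3 := fun r => by
    rw [show (4 : ℝ) - 1 = ((3 : ℕ) : ℝ) by norm_num, Real.rpow_natCast]
  simp_rw [e1, e2] at hlayer
  rw [hlayer]
  have hGm : AEMeasurable (fun ζ => ENNReal.ofReal (‖G ζ‖ ^ 2)) volume :=
    ((Lp.aestronglyMeasurable G).norm.pow 2).aemeasurable.ennreal_ofReal
  let g : Plane → ENNReal := fun ζ => ENNReal.ofReal (‖G ζ‖ ^ 2)
  -- The level sets bring in the cut-off radius r²/(8πN). Exchanging the integrations in level and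
  -- frequency leaves ∫ r dr over 0 < r ≤ √(8πN|ζ|), which is 4πN|ζ|: exactly the weight of the
  -- energy.
  let Q : Set (ℝ × Plane) := {p | p.1 ^ 2 / (8 * Real.pi * N) ≤ ‖p.2‖}
  have hQ : MeasurableSet Q := (isClosed_le (by fun_prop) (by fun_prop)).measurableSet
  let k : ℝ → Plane → ENNReal := fun r ζ => Q.indicator (fun p => ENNReal.ofReal p.1) (r, ζ) * g ζ
  have hk : AEMeasurable (Function.uncurry k)
      ((volume.restrict (Set.Ioi (0 : ℝ))).prod (volume : Measure Plane)) := by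
    refine AEMeasurable.mul ?_ hGm.comp_snd
    exact ((measurable_fst.ennreal_ofReal).indicator hQ).aemeasurable
  have hstep : ∀ r ∈ Set.Ioi (0 : ℝ), volume {z | r < ‖u z‖} * ENNReal.ofReal (r ^ 3) ≤
      4 * ∫⁻ ζ, k r ζ := by
    intro r hr
    have hr' : 0 < r := hr
    have h1 := volume_norm_gt_le hu hN hr'
    calc volume {z | r < ‖u z‖} * ENNReal.ofReal (r ^ 3)
        = (volume {z | r < ‖u z‖} * ENNReal.ofReal (r ^ 2)) * ENNReal.ofReal r := by
          rw [mul_assoc, ← ENNReal.ofReal_mul (by positivity), pow_succ]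
      _ ≤ (4 * ∫⁻ ζ, (Metric.ball (0 : Plane) (r ^ 2 / (8 * Real.pi * N)))ᶜ.indicator g ζ) *
          ENNReal.ofReal r := by gcongr
      _ = 4 * ∫⁻ ζ, (Metric.ball (0 : Plane) (r ^ 2 / (8 * Real.pi * N)))ᶜ.indicator g ζ *
          ENNReal.ofReal r := by
          rw [mul_assoc, lintegral_mul_const'' _ (hGm.indicator measurableSet_ball.compl)]
      _ = 4 * ∫⁻ ζ, k r ζ := by
          congr 1
          refine lintegral_congr fun ζ => ?_
          by_cases h : r ^ 2 / (8 * Real.pi * N) ≤ ‖ζ‖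
          · have h2 : ζ ∈ (Metric.ball (0 : Plane) (r ^ 2 / (8 * Real.pi * N)))ᶜ := by simpa using h
            have h3 : (r, ζ) ∈ Q := h
            simp only [k, Set.indicator_of_mem h2, Set.indicator_of_mem h3]
            exact mul_comm _ _
          · have h2 : ζ ∉ (Metric.ball (0 : Plane) (r ^ 2 / (8 * Real.pi * N)))ᶜ := by simpa using h
            have h3 : (r, ζ) ∉ Q := h
            simp only [k, Set.indicator_of_notMem h2, Set.indicator_of_notMem h3, zero_mul]
  have hinner : ∀ ζ, ∫⁻ r in Set.Ioi (0 : ℝ), k r ζ ≤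
      ENNReal.ofReal (4 * Real.pi * N * (‖ζ‖ * ‖G ζ‖ ^ 2)) := by
    intro ζ
    have hc : 0 ≤ 8 * Real.pi * N * ‖ζ‖ := by positivity
    have hb : ∀ r ∈ Set.Ioi (0 : ℝ), k r ζ ≤
        (Set.Ioc 0 (Real.sqrt (8 * Real.pi * N * ‖ζ‖))).indicator (fun r => ENNReal.ofReal r) r
          * g ζ := by
      intro r hr
      have hr' : 0 < r := hr
      by_cases h : r ^ 2 / (8 * Real.pi * N) ≤ ‖ζ‖
      · have h1 : r ≤ Real.sqrt (8 * Real.pi * N * ‖ζ‖) := by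
          apply Real.le_sqrt_of_sq_le
          rw [div_le_iff₀ (by positivity)] at h
          linarith
        have h2 : r ∈ Set.Ioc 0 (Real.sqrt (8 * Real.pi * N * ‖ζ‖)) := ⟨hr', h1⟩
        have h3 : (r, ζ) ∈ Q := h
        simp only [k, Set.indicator_of_mem h2, Set.indicator_of_mem h3, le_refl]
      · have h3 : (r, ζ) ∉ Q := h
        simp only [k, Set.indicator_of_notMem h3, zero_mul, zero_le]
    calc ∫⁻ r in Set.Ioi (0 : ℝ), k r ζ
        ≤ ∫⁻ r in Set.Ioi (0 : ℝ), (Set.Ioc 0 (Real.sqrt (8 * Real.pi * N * ‖ζ‖))).indicator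
            (fun r => ENNReal.ofReal r) r * g ζ :=
          setLIntegral_mono' measurableSet_Ioi hb
      _ ≤ ∫⁻ r, (Set.Ioc 0 (Real.sqrt (8 * Real.pi * N * ‖ζ‖))).indicator
            (fun r => ENNReal.ofReal r) r * g ζ := setLIntegral_le_lintegral _ _
      _ = (∫⁻ r in Set.Ioc 0 (Real.sqrt (8 * Real.pi * N * ‖ζ‖)), ENNReal.ofReal r) * g ζ := by
          rw [lintegral_mul_const _ (ENNReal.measurable_ofReal.indicator measurableSet_Ioc),
            lintegral_indicator measurableSet_Ioc]
      _ = ENNReal.ofReal (8 * Real.pi * N * ‖ζ‖ / 2) * g ζ := by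
          congr 1
          rw [← ofReal_integral_eq_lintegral_ofReal, ← intervalIntegral.integral_of_le
            (Real.sqrt_nonneg _), integral_id, Real.sq_sqrt hc]
          · simp
          · exact (continuous_id.integrableOn_Icc).mono_set Set.Ioc_subset_Icc_self
          · exact (ae_restrict_iff' measurableSet_Ioc).2 (Eventually.of_forall fun r hr => hr.1.le)
      _ = ENNReal.ofReal (4 * Real.pi * N * (‖ζ‖ * ‖G ζ‖ ^ 2)) := by
          rw [← ENNReal.ofReal_mul (by positivity)]
          congr 1; ring
  calc ENNReal.ofReal 4 * ∫⁻ r in Set.Ioi (0 : ℝ), volume {z | r < ‖u z‖} * ENNReal.ofReal (r ^ 3)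
      ≤ ENNReal.ofReal 4 * ∫⁻ r in Set.Ioi (0 : ℝ), 4 * ∫⁻ ζ, k r ζ := by
        gcongr 1
        exact setLIntegral_mono' measurableSet_Ioi hstep
    _ = ENNReal.ofReal 16 * ∫⁻ r in Set.Ioi (0 : ℝ), ∫⁻ ζ, k r ζ := by
        rw [lintegral_const_mul' _ _ (by norm_num), ← mul_assoc]
        congr 1
        rw [show (4 : ENNReal) = ENNReal.ofReal 4 by simp, ← ENNReal.ofReal_mul (by norm_num)]
        norm_num
    _ = ENNReal.ofReal 16 * ∫⁻ ζ, ∫⁻ r in Set.Ioi (0 : ℝ), k r ζ := by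
        rw [lintegral_lintegral_swap hk]
    _ ≤ ENNReal.ofReal 16 * ∫⁻ ζ, ENNReal.ofReal (4 * Real.pi * N * (‖ζ‖ * ‖G ζ‖ ^ 2)) := by
        gcongr 1
        exact lintegral_mono hinner
    _ = ENNReal.ofReal 16 * ENNReal.ofReal (4 * Real.pi * N * ∫ ζ, ‖ζ‖ * ‖G ζ‖ ^ 2) := by
        rw [← ofReal_integral_eq_lintegral_ofReal (hu.integrable.const_mul _)
          (Eventually.of_forall fun ζ => by simp only [Pi.zero_apply]; positivity),
          integral_const_mul]
    _ ≤ ENNReal.ofReal 16 * ENNReal.ofReal (4 * Real.pi * N * N) := by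
        gcongr
        exact hu.le
    _ = ENNReal.ofReal (64 * Real.pi * N ^ 2) := by
        rw [← ENNReal.ofReal_mul (by norm_num)]
        congr 1; ring

theorem integrable_four {u : ComplexL2} {N : ℝ} (hu : HalfEnergyLE (𝓕 u) N) (hN : 0 < N) :
    Integrable (fun z => ‖u z‖ ^ 4) volume := by
  refine ⟨(Lp.aestronglyMeasurable u).norm.pow 4, ?_⟩
  rw [hasFiniteIntegral_iff_ofReal (Eventually.of_forall fun z => by
    simp only [Pi.zero_apply]; positivity)]
  exact (lintegral_four_le hu hN).trans_lt ENNReal.ofReal_lt_top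

theorem integral_four_le {u : ComplexL2} {N : ℝ} (hu : HalfEnergyLE (𝓕 u) N) (hN : 0 < N) :
    ∫ z, ‖u z‖ ^ 4 ≤ 64 * Real.pi * N ^ 2 := by
  have h := lintegral_four_le hu hN
  rwa [← ofReal_integral_eq_lintegral_ofReal (integrable_four hu hN)
    (Eventually.of_forall fun z => by simp only [Pi.zero_apply]; positivity),
    ENNReal.ofReal_le_ofReal_iff (by positivity)] at h

/-- If the low frequencies of `u` are uniformly small, so is `u` in `L³`. -/
theorem integral_three_le {u : ComplexL2} {N A M s : ℝ} (hu : HalfEnergyLE (𝓕 u) N) (hN : 0 < N)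
    (hA : 0 < A) (hs : 0 < s) (hM : ∀ x, ‖lowPass A (𝓕 u) x‖ ≤ M) :
    ∫ z, ‖u z‖ ^ 3 ≤ 4 * M * ‖u‖ ^ 2 + 2 * (N / A / s + s * (64 * Real.pi * N ^ 2)) := by
  set G : ComplexL2 := 𝓕 u with hG
  set l : ComplexL2 := 𝓕⁻ (lowPart A G) with hl
  set h : ComplexL2 := 𝓕⁻ (highPart A G) with hh
  have hM0 : 0 ≤ M := (norm_nonneg _).trans (hM 0)
  have hFh : (𝓕 h : ComplexL2) = highPart A G := FourierTransform.fourier_fourierInv_eq _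
  have hhE : HalfEnergyLE (𝓕 h) N := by rw [hFh]; exact hu.highPart A
  have hl2 : ‖l‖ ^ 2 ≤ ‖u‖ ^ 2 := by
    have h1 : ‖l‖ = ‖lowPart A G‖ := norm_fourierInv_complexL2 _
    have h2 : ‖lowPart A G‖ ≤ ‖G‖ := by
      refine Lp.norm_le_norm_of_ae_le ?_
      filter_upwards [coeFn_lowPart A G] with ζ hζ
      rw [hζ]
      exact norm_indicator_le_norm_self _ _
    have h3 : ‖G‖ = ‖u‖ := Lp.norm_fourier_eq u
    rw [h1, ← h3]
    gcongr
  have hh2 : ‖h‖ ^ 2 ≤ N / A := by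
    rw [hh, norm_fourierInv_complexL2]; exact sq_norm_highPart_le hu hA
  have hi : Integrable (fun z => 4 * (M * ‖l z‖ ^ 2) +
      2 * (‖h z‖ ^ 2 / s + s * ‖h z‖ ^ 4)) volume :=
    (((integrable_sq_norm l).const_mul M).const_mul 4).add
      ((((integrable_sq_norm h).div_const s).add ((integrable_four hhE hN).const_mul s)).const_mul 2)
  have hle : ∀ᵐ z, ‖u z‖ ^ 3 ≤ 4 * (M * ‖l z‖ ^ 2) + 2 * (‖h z‖ ^ 2 / s + s * ‖h z‖ ^ 4) := by
    filter_upwards [fourierInv_lowPart_add_highPart A u, fourierInv_lowPart A G] with z hz hlz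
    rw [← hG, ← hlz, ← hl, ← hh] at hz
    have hlM : ‖l z‖ ≤ M := by rw [hl, hlz]; exact hM z
    have h1 : ‖u z‖ ≤ ‖l z‖ + ‖h z‖ := by rw [hz]; exact norm_add_le _ _
    have ha := norm_nonneg (l z)
    have hb := norm_nonneg (h z)
    generalize ‖l z‖ = a at *
    generalize ‖h z‖ = b at *
    have h2 : ‖u z‖ ^ 3 ≤ (a + b) ^ 3 := pow_le_pow_left₀ (norm_nonneg _) h1 3
    have h3 : (a + b) ^ 3 ≤ 4 * a ^ 3 + 4 * b ^ 3 := by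
      nlinarith [mul_nonneg (add_nonneg ha hb) (sq_nonneg (a - b))]
    have h4 : a ^ 3 ≤ M * a ^ 2 := by nlinarith [mul_le_mul_of_nonneg_right hlM (sq_nonneg a)]
    -- The perfect square interpolates the cube of the high part between L², where it is small, and
    -- L⁴, where it is bounded; the low part loses one power to its uniform bound `M`.
    have h5 : b ^ 2 / s + s * b ^ 4 - 2 * b ^ 3 = b ^ 2 * (1 - s * b) ^ 2 / s := by
      field_simp; ring
    have h6 : 0 ≤ b ^ 2 * (1 - s * b) ^ 2 / s := by positivity
    linarith
  calc ∫ z, ‖u z‖ ^ 3 ≤ ∫ z, (4 * (M * ‖l z‖ ^ 2) + 2 * (‖h z‖ ^ 2 / s + s * ‖h z‖ ^ 4)) :=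
        integral_mono_of_nonneg (Eventually.of_forall fun z => by
          simp only [Pi.zero_apply]; positivity) hi hle
    _ = 4 * (M * ‖l‖ ^ 2) + 2 * (‖h‖ ^ 2 / s + s * ∫ z, ‖h z‖ ^ 4) := by
        have hi1 : Integrable (fun z => ‖h z‖ ^ 2 / s) volume := (integrable_sq_norm h).div_const s
        have hi2 : Integrable (fun z => s * ‖h z‖ ^ 4) volume :=
          (integrable_four hhE hN).const_mul s
        have hi3 : Integrable (fun z => 2 * (‖h z‖ ^ 2 / s + s * ‖h z‖ ^ 4)) volume :=
          (hi1.add hi2).const_mul 2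
        rw [integral_add (((integrable_sq_norm l).const_mul M).const_mul 4) hi3,
          integral_const_mul, integral_const_mul, integral_const_mul, integral_add hi1 hi2,
          integral_const_mul, integral_div, ← sq_norm_complexL2, ← sq_norm_complexL2]
    _ ≤ 4 * M * ‖u‖ ^ 2 + 2 * (N / A / s + s * (64 * Real.pi * N ^ 2)) := by
        rw [mul_assoc]
        gcongr
        exact integral_four_le hhE hN

end Shrira

/-! ### The energy space as a separable Hilbert space -/

namespace Shrira

theorem real_smul_complexL2 (a : ℝ) (u : ComplexL2) : (a : ℂ) • u = a • u := by
  ext1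
  filter_upwards [Lp.coeFn_smul a u, Lp.coeFn_smul (a : ℂ) u] with z h1 h2
  rw [h1, h2]
  simp only [Pi.smul_apply, Complex.real_smul, smul_eq_mul]

theorem norm_toComplex (u : RealL2) : ‖toComplex u‖ = ‖u‖ := by
  rw [Lp.norm_def, Lp.norm_def]
  congr 1
  refine eLpNorm_congr_norm_ae ?_
  filter_upwards [coeFn_toComplex u] with z hz
  rw [hz, Complex.norm_real]

theorem norm_hat (u : RealL2) : ‖hat u‖ = ‖u‖ := by
  rw [hat, Lp.norm_fourier_eq, norm_toComplex]

/-- The Fourier transform of real-valued functions as a linear isometry. -/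
def hatL : RealL2 →ₗᵢ[ℝ] ComplexL2 where
  toFun := hat
  map_add' := hat_add
  map_smul' a u := by rw [hat_smul, real_smul_complexL2]; rfl
  norm_map' := norm_hat

theorem fourier_multiplier (m : Plane → ℂ) (u : RealL2) (hu : u ∈ multiplierDomain m) :
    (𝓕 (multiplier m u hu) : ComplexL2) =ᵐ[volume] fun ζ => m ζ * hat u ζ := by
  rw [multiplier, FourierTransform.fourier_fourierInv_eq]
  exact MemLp.coeFn_toLp _

theorem fourier_injective_complexL2 {a b : ComplexL2} (h : (𝓕 a : ComplexL2) = 𝓕 b) : a = b :=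
  (Lp.fourierTransformₗᵢ Plane ℂ).injective h

theorem multiplier_add (m : Plane → ℂ) {u v : RealL2} (hu : u ∈ multiplierDomain m)
    (hv : v ∈ multiplierDomain m) :
    multiplier m (u + v) (add_mem hu hv) = multiplier m u hu + multiplier m v hv := by
  apply fourier_injective_complexL2
  rw [FourierTransform.fourier_add]
  ext1
  filter_upwards [fourier_multiplier m (u + v) (add_mem hu hv), fourier_multiplier m u hu,
    fourier_multiplier m v hv, Lp.coeFn_add (𝓕 (multiplier m u hu) : ComplexL2)
      (𝓕 (multiplier m v hv)), Lp.coeFn_add (hat u) (hat v)] with ζ h1 h2 h3 h4 h5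
  rw [h1, h4, Pi.add_apply, h2, h3, hat_add, h5, Pi.add_apply, mul_add]

theorem multiplier_smul (m : Plane → ℂ) (a : ℝ) {u : RealL2} (hu : u ∈ multiplierDomain m) :
    multiplier m (a • u) (Submodule.smul_mem _ a hu) = a • multiplier m u hu := by
  rw [← real_smul_complexL2]
  apply fourier_injective_complexL2
  rw [FourierTransform.fourier_smul]
  ext1
  filter_upwards [fourier_multiplier m (a • u) (Submodule.smul_mem _ a hu),
    fourier_multiplier m u hu, Lp.coeFn_smul (a : ℂ) (𝓕 (multiplier m u hu) : ComplexL2),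
    Lp.coeFn_smul (a : ℂ) (hat u)] with ζ h1 h2 h3 h4
  rw [h1, h3, Pi.smul_apply, h2, hat_smul, h4, Pi.smul_apply, smul_eq_mul, smul_eq_mul]
  ring

/-- Fourier multipliers are closed operators. -/
theorem multiplier_closed (m : Plane → ℂ) {u : ℕ → RealL2} (hu : ∀ n, u n ∈ multiplierDomain m)
    {U : RealL2} {a : ComplexL2} (hU : Tendsto u atTop (𝓝 U))
    (ha : Tendsto (fun n => multiplier m (u n) (hu n)) atTop (𝓝 a)) :
    ∃ h : U ∈ multiplierDomain m, multiplier m U h = a := by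
  have h1 : Tendsto (fun n => hat (u n)) atTop (𝓝 (hat U)) :=
    (hatL.continuous.tendsto U).comp hU
  have h2 : Tendsto (fun n => (𝓕 (multiplier m (u n) (hu n)) : ComplexL2)) atTop (𝓝 (𝓕 a)) :=
    ((Lp.fourierTransformₗᵢ Plane ℂ).continuous.tendsto a).comp ha
  -- Along a common subsequence both transforms converge almost everywhere, where multiplication by
  -- the symbol passes to the limit without any bound on `m`.
  obtain ⟨r, hr, hr1⟩ := (tendstoInMeasure_of_tendsto_Lp h1).exists_seq_tendsto_ae
  obtain ⟨s, hs, hs1⟩ := (tendstoInMeasure_of_tendsto_Lp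
    (h2.comp hr.tendsto_atTop)).exists_seq_tendsto_ae
  have hmul : ∀ᵐ ζ, ∀ n, (𝓕 (multiplier m (u n) (hu n)) : ComplexL2) ζ = m ζ * hat (u n) ζ :=
    ae_all_iff.2 fun n => fourier_multiplier m (u n) (hu n)
  have key : (𝓕 a : ComplexL2) =ᵐ[volume] fun ζ => m ζ * hat U ζ := by
    filter_upwards [hr1, hs1, hmul] with ζ h3 h4 h5
    refine tendsto_nhds_unique h4 ?_
    simp only [Function.comp, h5]
    exact (h3.comp hs.tendsto_atTop).const_mul _
  have hm : U ∈ multiplierDomain m := (Lp.memLp (𝓕 a : ComplexL2)).ae_eq key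
  refine ⟨hm, fourier_injective_complexL2 ?_⟩
  ext1
  exact (fourier_multiplier m U hm).trans key.symm

theorem halfDx_add (u v : energySpace) : halfDx (u + v) = halfDx u + halfDx v :=
  multiplier_add symDx u.2.1 v.2.1

theorem halfDx_smul (a : ℝ) (u : energySpace) : halfDx (a • u) = a • halfDx u :=
  multiplier_smul symDx a u.2.1

theorem invHalfDxDy_add (u v : energySpace) :
    invHalfDxDy (u + v) = invHalfDxDy u + invHalfDxDy v :=
  multiplier_add symDxInvDy u.2.2 v.2.2

theorem invHalfDxDy_smul (a : ℝ) (u : energySpace) : invHalfDxDy (a • u) = a • invHalfDxDy u :=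
  multiplier_smul symDxInvDy a u.2.2

theorem re_inner_symm (a b : ComplexL2) : (inner ℂ a b).re = (inner ℂ b a).re := by
  rw [← inner_conj_symm, Complex.conj_re]

theorem re_inner_self (a : ComplexL2) : (inner ℂ a a).re = ‖a‖ ^ 2 := by
  rw [inner_self_eq_norm_sq_to_K]; norm_cast

theorem energyInner_self (c : ℝ) (u : energySpace) :
    energyInner c u u = c * ‖(u : RealL2)‖ ^ 2 + ‖halfDx u‖ ^ 2 + ‖invHalfDxDy u‖ ^ 2 := by
  rw [energyInner, re_inner_self, re_inner_self, real_inner_self_eq_norm_sq]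

/-- The energy space, to be equipped with the scalar product `energyInner c`. -/
def Energy (_c : ℝ) : Type := energySpace

instance (c : ℝ) : AddCommGroup (Energy c) := inferInstanceAs (AddCommGroup energySpace)

instance (c : ℝ) : Module ℝ (Energy c) := inferInstanceAs (Module ℝ energySpace)

/-- The element of `energySpace` underlying an element of `Energy c`. -/
def Energy.val {c : ℝ} (u : Energy c) : energySpace := u

/-- The function underlying an element of `Energy c`. -/
def Energy.fn {c : ℝ} (u : Energy c) : RealL2 := u.val

theorem Energy.fn_add {c : ℝ} (u v : Energy c) : (u + v).fn = u.fn + v.fn := rfl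

theorem Energy.fn_smul {c : ℝ} (a : ℝ) (u : Energy c) : (a • u).fn = a • u.fn := rfl

variable {c : ℝ} [hc : Fact (0 < c)]

/-- The axioms of a scalar product for `energyInner c`. -/
@[reducible] def Energy.core : InnerProductSpace.Core ℝ (Energy c) where
  inner u v := energyInner c u.val v.val
  conj_inner_symm u v := by
    simp only [energyInner, conj_trivial]
    rw [real_inner_comm, re_inner_symm, re_inner_symm (invHalfDxDy _)]
  re_inner_nonneg u := by
    have := hc.out
    simp only [energyInner_self, RCLike.re_to_real]
    positivity
  add_left u v w := by
    have h1 : (u + v).val = u.val + v.val := rfl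
    simp only [energyInner, h1, halfDx_add, invHalfDxDy_add, Submodule.coe_add, inner_add_left,
      Complex.add_re]
    ring
  smul_left u v a := by
    have h1 : (a • u).val = a • u.val := rfl
    simp only [energyInner, h1, halfDx_smul, invHalfDxDy_smul, Submodule.coe_smul,
      ← real_smul_complexL2, inner_smul_left, conj_trivial, Complex.conj_ofReal,
      Complex.re_ofReal_mul]
    ring
  definite u h := by
    have := hc.out
    rw [energyInner_self] at h
    have h2 : ‖(u.val : RealL2)‖ ^ 2 = 0 := by
      have h3 : 0 ≤ ‖(u.val : RealL2)‖ ^ 2 := by positivity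
      have h4 : 0 ≤ ‖halfDx u.val‖ ^ 2 := by positivity
      have h5 : 0 ≤ ‖invHalfDxDy u.val‖ ^ 2 := by positivity
      nlinarith
    have h3 : (u.val : RealL2) = 0 := by simpa using h2
    exact Subtype.ext h3

instance : NormedAddCommGroup (Energy c) := Energy.core.toNormedAddCommGroup

instance : InnerProductSpace ℝ (Energy c) := InnerProductSpace.ofCore Energy.core.toCore

theorem Energy.inner_def (u v : Energy c) : inner ℝ u v = energyInner c u.val v.val := rfl

theorem Energy.norm_sq (u : Energy c) :
    ‖u‖ ^ 2 = c * ‖u.fn‖ ^ 2 + ‖halfDx u.val‖ ^ 2 + ‖invHalfDxDy u.val‖ ^ 2 := by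
  rw [← real_inner_self_eq_norm_sq, Energy.inner_def, energyInner_self]; rfl

theorem Energy.norm_fn_sq_le (u : Energy c) : ‖u.fn‖ ^ 2 ≤ c⁻¹ * ‖u‖ ^ 2 := by
  have := hc.out
  rw [le_inv_mul_iff₀ this, Energy.norm_sq]
  have h4 : 0 ≤ ‖halfDx u.val‖ ^ 2 := by positivity
  have h5 : 0 ≤ ‖invHalfDxDy u.val‖ ^ 2 := by positivity
  linarith

/-- The inclusion of the energy space in `L²`. -/
def Energy.fnL : Energy c →L[ℝ] RealL2 :=
  LinearMap.mkContinuous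
    { toFun := Energy.fn
      map_add' := Energy.fn_add
      map_smul' := Energy.fn_smul } (Real.sqrt c⁻¹) fun u => by
    have := hc.out
    rw [← abs_of_nonneg (norm_nonneg u), ← Real.sqrt_sq_eq_abs,
      ← Real.sqrt_mul (inv_nonneg.2 this.le)]
    exact Real.le_sqrt_of_sq_le u.norm_fn_sq_le

/-- The operator `D_x^{1/2}` on the energy space. -/
def Energy.halfDxL : Energy c →L[ℝ] ComplexL2 :=
  LinearMap.mkContinuous
    { toFun := fun u => halfDx u.val
      map_add' := fun u v => halfDx_add u.val v.val
      map_smul' := fun a u => halfDx_smul a u.val } 1 fun u => by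
    have := hc.out
    rw [one_mul]
    refine le_of_sq_le_sq ?_ (norm_nonneg u)
    rw [Energy.norm_sq]
    have h5 : 0 ≤ ‖invHalfDxDy u.val‖ ^ 2 := by positivity
    have h6 : 0 ≤ c * ‖u.fn‖ ^ 2 := by positivity
    change ‖halfDx u.val‖ ^ 2 ≤ _
    linarith

/-- The operator `D_x^{-1/2} ∂_y` on the energy space. -/
def Energy.invHalfDxDyL : Energy c →L[ℝ] ComplexL2 :=
  LinearMap.mkContinuous
    { toFun := fun u => invHalfDxDy u.val
      map_add' := fun u v => invHalfDxDy_add u.val v.val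
      map_smul' := fun a u => invHalfDxDy_smul a u.val } 1 fun u => by
    have := hc.out
    rw [one_mul]
    refine le_of_sq_le_sq ?_ (norm_nonneg u)
    rw [Energy.norm_sq]
    have h5 : 0 ≤ ‖halfDx u.val‖ ^ 2 := by positivity
    have h6 : 0 ≤ c * ‖u.fn‖ ^ 2 := by positivity
    change ‖invHalfDxDy u.val‖ ^ 2 ≤ _
    linarith

theorem Energy.norm_sq_eq (u : Energy c) :
    ‖u‖ ^ 2 = c * ‖fnL u‖ ^ 2 + ‖halfDxL u‖ ^ 2 + ‖invHalfDxDyL u‖ ^ 2 := u.norm_sq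

/-- A Cauchy sequence converges in L² together with both of its derivative terms, and the
multipliers are closed operators. -/
instance : CompleteSpace (Energy c) := by
  refine Metric.complete_of_cauchySeq_tendsto fun u hu => ?_
  obtain ⟨U, hU⟩ := cauchySeq_tendsto_of_complete (Energy.fnL.uniformContinuous.comp_cauchySeq hu)
  obtain ⟨a, ha⟩ := cauchySeq_tendsto_of_complete (Energy.halfDxL.uniformContinuous.comp_cauchySeq hu)
  obtain ⟨b, hb⟩ := cauchySeq_tendsto_of_complete (Energy.invHalfDxDyL.uniformContinuous.comp_cauchySeq hu)
  obtain ⟨h1, h1'⟩ := multiplier_closed symDx (fun n => (u n).val.2.1) hU ha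
  obtain ⟨h2, h2'⟩ := multiplier_closed symDxInvDy (fun n => (u n).val.2.2) hU hb
  let V : Energy c := (⟨U, h1, h2⟩ : energySpace)
  refine ⟨V, ?_⟩
  have hV1 : Energy.fnL V = U := rfl
  have hV2 : Energy.halfDxL V = a := h1'
  have hV3 : Energy.invHalfDxDyL V = b := h2'
  rw [tendsto_iff_norm_sub_tendsto_zero]
  have hlim : Tendsto (fun n => ‖u n - V‖ ^ 2) atTop (𝓝 0) := by
    have e1 := ((tendsto_iff_norm_sub_tendsto_zero.1 hU).pow 2).const_mul c
    have e2 := (tendsto_iff_norm_sub_tendsto_zero.1 ha).pow 2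
    have e3 := (tendsto_iff_norm_sub_tendsto_zero.1 hb).pow 2
    have e := (e1.add e2).add e3
    simp only [ne_eq, OfNat.ofNat_ne_zero, not_false_eq_true, zero_pow, mul_zero, add_zero] at e
    refine e.congr fun n => ?_
    rw [Energy.norm_sq_eq, map_sub, map_sub, map_sub, hV1, hV2, hV3]
    rfl
  have := (Real.continuous_sqrt.tendsto 0).comp hlim
  rw [Real.sqrt_zero] at this
  exact this.congr fun n => Real.sqrt_sq (norm_nonneg _)

/-- The map to the function and its two derivative terms embeds the space in a product of separable
L² spaces. -/
instance : TopologicalSpace.SeparableSpace (Energy c) := by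
  have hcpos := hc.out
  let J : Energy c →L[ℝ] RealL2 × ComplexL2 × ComplexL2 :=
    Energy.fnL.prod (Energy.halfDxL.prod Energy.invHalfDxDyL)
  have hJ : AntilipschitzWith (Real.toNNReal (Real.sqrt (c + 2))) J := by
    refine AddMonoidHomClass.antilipschitz_of_bound J fun u => ?_
    rw [Real.coe_toNNReal _ (Real.sqrt_nonneg _), ← abs_of_nonneg (norm_nonneg (J u)),
      ← Real.sqrt_sq_eq_abs, ← Real.sqrt_mul (by positivity)]
    refine Real.le_sqrt_of_sq_le ?_
    have h1 : ‖Energy.fnL u‖ ≤ ‖J u‖ := le_max_left _ _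
    have h2 : ‖Energy.halfDxL u‖ ≤ ‖J u‖ := (le_max_left _ _).trans (le_max_right _ _)
    have h3 : ‖Energy.invHalfDxDyL u‖ ≤ ‖J u‖ := (le_max_right _ _).trans (le_max_right _ _)
    rw [Energy.norm_sq_eq]
    calc c * ‖Energy.fnL u‖ ^ 2 + ‖Energy.halfDxL u‖ ^ 2 + ‖Energy.invHalfDxDyL u‖ ^ 2
        ≤ c * ‖J u‖ ^ 2 + ‖J u‖ ^ 2 + ‖J u‖ ^ 2 := by gcongr
      _ = (c + 2) * ‖J u‖ ^ 2 := by ring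
  have : Fact ((2 : ENNReal) ≠ ⊤) := ⟨ENNReal.ofNat_ne_top⟩
  have : SecondCountableTopology RealL2 := Lp.SecondCountableTopology
  have : SecondCountableTopology ComplexL2 := Lp.SecondCountableTopology
  have := (hJ.isUniformInducing J.uniformContinuous).isInducing.secondCountableTopology
  infer_instance

/-- The line ξ = 0 is a proper subspace, hence null, so the singularity of |ξ|^{-1/2} there is
harmless. -/
theorem ae_xi_ne_zero : ∀ᵐ ζ : Plane, xi ζ ≠ 0 := by
  let P : Submodule ℝ Plane := LinearMap.ker (EuclideanSpace.proj (𝕜 := ℝ) (0 : Fin 2)).toLinearMap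
  have hP : P ≠ ⊤ := by
    intro h
    have : (EuclideanSpace.single 0 1 : Plane) ∈ P := h ▸ Submodule.mem_top
    simp [P] at this
  rw [ae_iff]
  refine measure_mono_null ?_ (Measure.addHaar_submodule volume P hP)
  intro ζ hζ
  have h : 2 * Real.pi * ζ 0 = 0 := by simpa [xi] using hζ
  have h2 : ζ 0 = 0 := by simpa [Real.pi_ne_zero] using h
  simpa [P] using h2

theorem sq_norm_symDx_mul (ζ : Plane) (w : ℂ) : ‖symDx ζ * w‖ ^ 2 = |xi ζ| * ‖w‖ ^ 2 := by
  rw [norm_mul, mul_pow, symDx, Complex.norm_real, Real.norm_of_nonneg (by positivity),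
    ← Real.rpow_natCast, ← Real.rpow_mul (abs_nonneg _)]
  norm_num

theorem sq_norm_symDxInvDy_mul (ζ : Plane) (w : ℂ) :
    ‖symDxInvDy ζ * w‖ ^ 2 = |xi ζ|⁻¹ * eta ζ ^ 2 * ‖w‖ ^ 2 := by
  rw [norm_mul, mul_pow, symDxInvDy, norm_mul, mul_pow, Complex.norm_real,
    Real.norm_of_nonneg (by positivity), ← Real.rpow_natCast, ← Real.rpow_mul (abs_nonneg _),
    norm_mul, Complex.norm_I, one_mul, Complex.norm_real, Real.norm_eq_abs, sq_abs]
  norm_num [Real.rpow_neg_one]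

/-- The right side is (ξ² + η²)/|ξ| ≥ |ζ|²/|ξ|, which suffices when |ξ| ≤ |ζ|; otherwise |ξ| alone
suffices. The anisotropic energy thus controls an isotropic one. -/
theorem norm_le_symbol {ζ : Plane} (h : xi ζ ≠ 0) : ‖ζ‖ ≤ |xi ζ| + |xi ζ|⁻¹ * eta ζ ^ 2 := by
  have hpi := Real.pi_gt_three
  have hx : 0 < |xi ζ| := abs_pos.2 h
  have h1 : ‖ζ‖ ^ 2 = ζ 0 ^ 2 + ζ 1 ^ 2 := by
    rw [EuclideanSpace.norm_sq_eq]; simp [Fin.sum_univ_two]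
  have h2 : ‖ζ‖ ^ 2 ≤ |xi ζ| ^ 2 + eta ζ ^ 2 := by
    rw [h1, sq_abs, xi, eta]
    have : 1 ≤ (2 * Real.pi) ^ 2 := by nlinarith
    rw [mul_pow (2 * Real.pi), mul_pow (2 * Real.pi)]
    nlinarith [sq_nonneg (ζ 0), sq_nonneg (ζ 1)]
  have h3 : |xi ζ| + |xi ζ|⁻¹ * eta ζ ^ 2 = (|xi ζ| ^ 2 + eta ζ ^ 2) / |xi ζ| := by
    field_simp
  rw [h3, le_div_iff₀ hx]
  rcases le_total |xi ζ| ‖ζ‖ with h4 | h4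
  · nlinarith [norm_nonneg ζ]
  · nlinarith [norm_nonneg ζ, sq_nonneg (eta ζ)]

theorem Energy.halfEnergyLE (u : Energy c) : HalfEnergyLE (hat u.fn) (‖u‖ ^ 2) := by
  have hcpos := hc.out
  set a : ComplexL2 := 𝓕 (halfDx u.val) with ha
  set b : ComplexL2 := 𝓕 (invHalfDxDy u.val) with hb
  have hle : ∀ᵐ ζ, ‖ζ‖ * ‖hat u.fn ζ‖ ^ 2 ≤ ‖a ζ‖ ^ 2 + ‖b ζ‖ ^ 2 := by
    filter_upwards [fourier_multiplier symDx u.fn u.val.2.1,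
      fourier_multiplier symDxInvDy u.fn u.val.2.2, ae_xi_ne_zero] with ζ h1 h2 h3
    have h4 : a ζ = symDx ζ * hat u.fn ζ := h1
    have h5 : b ζ = symDxInvDy ζ * hat u.fn ζ := h2
    rw [h4, h5, sq_norm_symDx_mul, sq_norm_symDxInvDy_mul, ← add_mul]
    gcongr
    exact norm_le_symbol h3
  have hi := (integrable_sq_norm a).add (integrable_sq_norm b)
  have hi2 : Integrable (fun ζ => ‖ζ‖ * ‖hat u.fn ζ‖ ^ 2) volume := by
    refine hi.mono' (continuous_norm.aestronglyMeasurable.mul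
      ((Lp.aestronglyMeasurable _).norm.pow 2)) ?_
    filter_upwards [hle] with ζ hζ
    rwa [Real.norm_of_nonneg (by positivity)]
  refine ⟨hi2, (integral_mono_ae hi2 hi hle).trans ?_⟩
  rw [integral_add' (integrable_sq_norm a) (integrable_sq_norm b), ← sq_norm_complexL2,
    ← sq_norm_complexL2, ha, hb, Lp.norm_fourier_eq, Lp.norm_fourier_eq, Energy.norm_sq]
  have : 0 ≤ c * ‖u.fn‖ ^ 2 := by positivity
  linarith

theorem HalfEnergyLE.mono {G : ComplexL2} {N N' : ℝ} (h : HalfEnergyLE G N) (hN : N ≤ N') :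
    HalfEnergyLE G N' := ⟨h.integrable, h.le.trans hN⟩

theorem ae_norm_toComplex (u : RealL2) : ∀ᵐ z, ‖toComplex u z‖ = |u z| := by
  filter_upwards [coeFn_toComplex u] with z hz
  rw [hz, Complex.norm_real, Real.norm_eq_abs]

theorem Energy.memTwoFour (u : Energy c) : MemTwoFour u.fn volume := by
  refine ⟨Lp.aestronglyMeasurable _, (Lp.memLp u.fn).integrable_sq, ?_⟩
  have h : HalfEnergyLE (hat u.fn) (‖u‖ ^ 2 + 1) := u.halfEnergyLE.mono (by linarith)
  refine (integrable_four h (by positivity)).congr ?_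
  filter_upwards [ae_norm_toComplex u.fn] with z hz
  rw [hz, show |u.fn z| ^ 4 = (|u.fn z| ^ 2) ^ 2 by ring, sq_abs]; ring

theorem sq_norm_realL2 (u : RealL2) : ‖u‖ ^ 2 = ∫ z, u z ^ 2 := by
  rw [← real_inner_self_eq_norm_sq, L2.inner_def]
  simp [sq]

theorem Energy.integral_four_le (u : Energy c) : ∫ z, u.fn z ^ 4 ≤ 64 * Real.pi * ‖u‖ ^ 4 := by
  have hpi := Real.pi_pos
  have e : ∫ z, u.fn z ^ 4 = ∫ z, ‖toComplex u.fn z‖ ^ 4 := by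
    refine integral_congr_ae ?_
    filter_upwards [ae_norm_toComplex u.fn] with z hz
    rw [hz, show |u.fn z| ^ 4 = (|u.fn z| ^ 2) ^ 2 by ring, sq_abs]; ring
  rw [e]
  -- The embedding requires a positive energy bound. Letting δ → 0 keeps the estimate homogeneous of
  -- degree four, as needed near the origin.
  have hlim : Tendsto (fun δ : ℝ => 64 * Real.pi * (‖u‖ ^ 2 + δ) ^ 2) (𝓝[>] 0)
      (𝓝 (64 * Real.pi * (‖u‖ ^ 2 + 0) ^ 2)) :=
    ((by fun_prop : Continuous fun δ : ℝ => 64 * Real.pi * (‖u‖ ^ 2 + δ) ^ 2).tendsto 0).mono_left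
      nhdsWithin_le_nhds
  have hge := ge_of_tendsto hlim (b := ∫ z, ‖toComplex u.fn z‖ ^ 4) (by
    filter_upwards [self_mem_nhdsWithin] with δ hδ
    have hδ' : (0 : ℝ) < δ := hδ
    exact Shrira.integral_four_le (u.halfEnergyLE.mono (by linarith)) (by positivity))
  refine hge.trans_eq ?_
  ring

theorem Energy.integral_twoFour_le (u : Energy c) :
    ∫ z, twoFour (u.fn z) ≤ c⁻¹ * ‖u‖ ^ 2 + 64 * Real.pi * ‖u‖ ^ 4 := by
  have h : ∫ z, twoFour (u.fn z) = (∫ z, u.fn z ^ 2) + ∫ z, u.fn z ^ 4 :=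
    integral_add u.memTwoFour.sq u.memTwoFour.four
  rw [h, ← sq_norm_realL2]
  exact add_le_add u.norm_fn_sq_le u.integral_four_le

end Shrira

/-! ### Translation invariance and local compactness -/

namespace Shrira

theorem mul_hat_translate (m : Plane → ℂ) (a : Plane) (u : RealL2) :
    (fun ζ => m ζ * hat (translate a u) ζ) =ᵐ[volume] fun ζ => phase a ζ * (m ζ * hat u ζ) := by
  filter_upwards [hat_translate a u] with ζ hζ
  rw [hζ]; ring

theorem translate_mem_multiplierDomain {m : Plane → ℂ} (a : Plane) {u : RealL2}
    (hu : u ∈ multiplierDomain m) : translate a u ∈ multiplierDomain m := by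
  have hu' : MemLp (fun ζ => m ζ * hat u ζ) 2 volume := hu
  refine MemLp.ae_eq (mul_hat_translate m a u).symm (MemLp.of_le hu'
    ((continuous_phase a).aestronglyMeasurable.mul hu'.aestronglyMeasurable)
    (Eventually.of_forall fun ζ => ?_))
  rw [norm_mul, norm_phase, one_mul]

/-- By Plancherel: translation multiplies both transforms by the same phase of modulus one, which
cancels. -/
theorem inner_multiplier_translate {m : Plane → ℂ} (a : Plane) {u v : RealL2}
    (hu : u ∈ multiplierDomain m) (hv : v ∈ multiplierDomain m) :
    inner ℂ (multiplier m (translate a u) (translate_mem_multiplierDomain a hu))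
      (multiplier m (translate a v) (translate_mem_multiplierDomain a hv)) =
    inner ℂ (multiplier m u hu) (multiplier m v hv) := by
  rw [← Lp.inner_fourier_eq, ← Lp.inner_fourier_eq (multiplier m u hu), L2.inner_def, L2.inner_def]
  refine integral_congr_ae ?_
  filter_upwards [fourier_multiplier m _ (translate_mem_multiplierDomain a hu),
    fourier_multiplier m _ (translate_mem_multiplierDomain a hv), fourier_multiplier m u hu,
    fourier_multiplier m v hv, mul_hat_translate m a u, mul_hat_translate m a v]
    with ζ h1 h2 h3 h4 h5 h6
  rw [h1, h2, h3, h4, h5, h6, RCLike.inner_apply, RCLike.inner_apply, map_mul]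
  have h7 : phase a ζ * (starRingEnd ℂ) (phase a ζ) = 1 := by
    rw [Complex.mul_conj, Complex.normSq_eq_norm_sq, norm_phase]; simp
  linear_combination (m ζ * hat v ζ * (starRingEnd ℂ) (m ζ * hat u ζ)) * h7

theorem inner_translate (a : Plane) (u v : RealL2) :
    inner ℝ (translate a u) (translate a v) = inner ℝ u v := by
  rw [L2.inner_def, L2.inner_def,
    ← integral_add_right_eq_self (fun z => inner ℝ (u z) (v z)) a]
  refine integral_congr_ae ?_
  filter_upwards [coeFn_translate a u, coeFn_translate a v] with z h1 h2
  rw [h1, h2]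

theorem translate_translate_neg (a : Plane) (u : RealL2) : translate a (translate (-a) u) = u := by
  ext1
  filter_upwards [coeFn_translate a (translate (-a) u),
    (measurePreserving_add_right_plane a).quasiMeasurePreserving.ae (coeFn_translate (-a) u)]
    with z h1 h2
  rw [h1, h2, add_neg_cancel_right]

variable {c : ℝ}

/-- The translations of the energy space. -/
def Energy.translate (a : Plane) (u : Energy c) : Energy c :=
  (⟨Shrira.translate a u.fn, translate_mem_multiplierDomain a u.val.2.1,
    translate_mem_multiplierDomain a u.val.2.2⟩ : energySpace)

theorem Energy.fn_translate (a : Plane) (u : Energy c) :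
    (u.translate a).fn = Shrira.translate a u.fn := rfl

theorem Energy.translate_translate_neg (a : Plane) (u : Energy c) :
    (u.translate (-a)).translate a = u :=
  Subtype.ext (Shrira.translate_translate_neg a u.fn)

variable [hc : Fact (0 < c)]

theorem Energy.inner_translate (a : Plane) (u v : Energy c) :
    inner ℝ (u.translate a) (v.translate a) = inner ℝ u v := by
  rw [Energy.inner_def, Energy.inner_def, energyInner, energyInner]
  congr 1
  · congr 1
    · exact congrArg (c * ·) (Shrira.inner_translate a u.fn v.fn)
    · exact congrArg Complex.re (inner_multiplier_translate a u.val.2.1 v.val.2.1)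
  · exact congrArg Complex.re (inner_multiplier_translate a u.val.2.2 v.val.2.2)

theorem Energy.norm_translate (a : Plane) (u : Energy c) : ‖u.translate a‖ = ‖u‖ := by
  rw [← sq_eq_sq₀ (norm_nonneg _) (norm_nonneg _), ← real_inner_self_eq_norm_sq,
    ← real_inner_self_eq_norm_sq, Energy.inner_translate]

/-- The evaluation of the low frequency part at a point, as a functional on the energy space. -/
def Energy.lowPassL (A : ℝ) (x : Plane) : Energy c →L[ℝ] ℂ :=
  ((innerSL ℂ (cutoff A x)).restrictScalars ℝ).comp
    (hatL.toContinuousLinearMap.comp Energy.fnL)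

theorem Energy.lowPassL_apply (A : ℝ) (x : Plane) (u : Energy c) :
    Energy.lowPassL A x u = lowPass A (hat u.fn) x := (lowPass_eq_inner A _ x).symm

/-- Weak convergence of sequences in a real inner product space. -/
def WeaklyTendsto {H : Type*} [NormedAddCommGroup H] [InnerProductSpace ℝ H] (v : ℕ → H) (u : H) :
    Prop := ∀ h, Tendsto (fun n => inner ℝ (v n) h) atTop (𝓝 (inner ℝ u h))

theorem WeaklyTendsto.map_real {H : Type*} [NormedAddCommGroup H] [InnerProductSpace ℝ H]
    [CompleteSpace H] {v : ℕ → H} {u : H} (hv : WeaklyTendsto v u) (T : H →L[ℝ] ℝ) :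
    Tendsto (fun n => T (v n)) atTop (𝓝 (T u)) := by
  have h : ∀ w, T w = inner ℝ w ((InnerProductSpace.toDual ℝ H).symm T) := fun w => by
    rw [real_inner_comm, InnerProductSpace.toDual_symm_apply]
  simp_rw [h]
  exact hv _

theorem WeaklyTendsto.map_complex {H : Type*} [NormedAddCommGroup H] [InnerProductSpace ℝ H]
    [CompleteSpace H] {v : ℕ → H} {u : H} (hv : WeaklyTendsto v u) (T : H →L[ℝ] ℂ) :
    Tendsto (fun n => T (v n)) atTop (𝓝 (T u)) := by
  have h1 := (Complex.continuous_ofReal.tendsto _).comp (hv.map_real (Complex.reCLM.comp T))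
  have h2 := (Complex.continuous_ofReal.tendsto _).comp (hv.map_real (Complex.imCLM.comp T))
  have h3 := h1.add (h2.mul_const Complex.I)
  have key : ∀ w : ℂ, (w.re : ℂ) + w.im * Complex.I = w := Complex.re_add_im
  simpa [Function.comp_def, key] using h3

theorem aestronglyMeasurable_lowPass (A : ℝ) (G : ComplexL2) :
    AEStronglyMeasurable (lowPass A G) volume :=
  (Lp.aestronglyMeasurable _).congr (fourierInv_lowPart A G)

/-- A square integrable positive weight. -/
def localWeight (z : Plane) : ℝ := ((1 + ‖z‖) ^ 2)⁻¹

theorem localWeight_pos (z : Plane) : 0 < localWeight z := by unfold localWeight; positivity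

theorem localWeight_le_one (z : Plane) : localWeight z ≤ 1 := by
  unfold localWeight
  refine inv_le_one_of_one_le₀ (one_le_pow₀ ?_)
  linarith [norm_nonneg z]

theorem continuous_localWeight : Continuous localWeight := by
  unfold localWeight
  refine Continuous.inv₀ (by fun_prop) fun z => ?_
  positivity

theorem integrable_sq_localWeight : Integrable (fun z => localWeight z ^ 2) volume := by
  have h := integrable_one_add_norm (E := Plane) (μ := volume) (r := 4) (by simp; norm_num)
  refine h.congr (Eventually.of_forall fun z => ?_)
  have : 0 ≤ 1 + ‖z‖ := by positivity
  simp only [localWeight]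
  rw [Real.rpow_neg this, show (4 : ℝ) = ((4 : ℕ) : ℝ) by norm_num, Real.rpow_natCast, inv_pow]
  ring

theorem Energy.integrable_weight_sq (d : Energy c) :
    Integrable (fun z => (localWeight z * d.fn z) ^ 2) volume := by
  refine d.memTwoFour.sq.mono' ((continuous_localWeight.aestronglyMeasurable.mul
    d.memTwoFour.meas).pow 2) (Eventually.of_forall fun z => ?_)
  rw [Real.norm_of_nonneg (by positivity), mul_pow]
  have h1 := localWeight_pos z
  have h2 : localWeight z ^ 2 ≤ 1 := pow_le_one₀ h1.le (localWeight_le_one z)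
  nlinarith [sq_nonneg (d.fn z)]

theorem integrable_weight_sq_lowPass (A : ℝ) (G : ComplexL2) :
    Integrable (fun z => localWeight z ^ 2 * ‖lowPass A G z‖ ^ 2) volume := by
  refine (integrable_sq_localWeight.mul_const ((‖cutoff A 0‖ * ‖G‖) ^ 2)).mono'
    ((continuous_localWeight.pow 2).aestronglyMeasurable.mul
      ((aestronglyMeasurable_lowPass A G).norm.pow 2)) (Eventually.of_forall fun z => ?_)
  rw [Real.norm_of_nonneg (by positivity)]
  gcongr
  exact norm_lowPass_le A G z

theorem Energy.integral_weight_sq_le (d : Energy c) {A N : ℝ} (hA : 0 < A) (hN : ‖d‖ ^ 2 ≤ N) :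
    ∫ z, (localWeight z * d.fn z) ^ 2 ≤
      2 * (∫ z, localWeight z ^ 2 * ‖lowPass A (hat d.fn) z‖ ^ 2) + 2 * (N / A) := by
  set h : ComplexL2 := 𝓕⁻ (highPart A (hat d.fn)) with hh
  have hle : ∀ᵐ z, (localWeight z * d.fn z) ^ 2 ≤
      2 * (localWeight z ^ 2 * ‖lowPass A (hat d.fn) z‖ ^ 2) + 2 * ‖h z‖ ^ 2 := by
    filter_upwards [fourierInv_lowPart_add_highPart A (toComplex d.fn), ae_norm_toComplex d.fn]
      with z h1 h2
    have h3 : |d.fn z| ≤ ‖lowPass A (hat d.fn) z‖ + ‖h z‖ := by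
      rw [← h2, h1]; exact norm_add_le _ _
    have h4 : d.fn z ^ 2 ≤ (‖lowPass A (hat d.fn) z‖ + ‖h z‖) ^ 2 := by
      rw [← sq_abs]; gcongr
    have h5 := localWeight_pos z
    have h6 : localWeight z ^ 2 ≤ 1 := pow_le_one₀ h5.le (localWeight_le_one z)
    generalize ‖lowPass A (hat d.fn) z‖ = p at *
    generalize ‖h z‖ = q at *
    have h7 : d.fn z ^ 2 ≤ 2 * p ^ 2 + 2 * q ^ 2 := by nlinarith [sq_nonneg (p - q)]
    rw [mul_pow]
    calc localWeight z ^ 2 * d.fn z ^ 2 ≤ localWeight z ^ 2 * (2 * p ^ 2 + 2 * q ^ 2) := by gcongr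
      _ = 2 * (localWeight z ^ 2 * p ^ 2) + localWeight z ^ 2 * (2 * q ^ 2) := by ring
      _ ≤ 2 * (localWeight z ^ 2 * p ^ 2) + 1 * (2 * q ^ 2) := by gcongr
      _ = _ := by ring
  have hi1 := (integrable_weight_sq_lowPass A (hat d.fn)).const_mul 2
  have hi2 := (integrable_sq_norm h).const_mul 2
  refine (integral_mono_ae d.integrable_weight_sq (hi1.add hi2) hle).trans ?_
  rw [integral_add' hi1 hi2, integral_const_mul, integral_const_mul, ← sq_norm_complexL2, hh,
    norm_fourierInv_complexL2]
  gcongr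
  exact sq_norm_highPart_le (d.halfEnergyLE.mono hN) hA

/-- Weakly convergent bounded sequences of the energy space converge almost everywhere along a
subsequence. -/
theorem Energy.exists_subseq_ae_of_weaklyTendsto {v : ℕ → Energy c} {u : Energy c} {R : ℝ}
    (hv : WeaklyTendsto v u) (hR : ∀ n, ‖v n‖ ≤ R) :
    ∃ r : ℕ → ℕ, StrictMono r ∧
      ∀ᵐ z, Tendsto (fun n => (v (r n)).fn z) atTop (𝓝 (u.fn z)) := by
  have hcpos := hc.out
  set N := (R + ‖u‖) ^ 2 + 1 with hN
  have hN0 : 0 < N := by positivity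
  have hdN : ∀ n, ‖v n - u‖ ^ 2 ≤ N := by
    intro n
    have h1 : ‖v n - u‖ ≤ R + ‖u‖ := (norm_sub_le _ _).trans (by gcongr; exact hR n)
    have h2 := pow_le_pow_left₀ (norm_nonneg _) h1 2
    linarith
  -- Weak convergence gives convergence of the low frequencies at every point, and they are
  -- uniformly bounded; the square integrable weight supplies the dominating function on the
  -- unbounded plane.
  have hlow : ∀ A, Tendsto (fun n => ∫ z, localWeight z ^ 2 *
      ‖lowPass A (hat (v n - u).fn) z‖ ^ 2) atTop (𝓝 0) := by
    intro A
    have h := tendsto_integral_of_dominated_convergence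
      (F := fun n z => localWeight z ^ 2 * ‖lowPass A (hat (v n - u).fn) z‖ ^ 2)
      (f := fun _ => (0 : ℝ)) (μ := (volume : Measure Plane))
      (fun z => localWeight z ^ 2 * (‖cutoff A 0‖ ^ 2 * (c⁻¹ * N)))
      (fun n => (integrable_weight_sq_lowPass A _).aestronglyMeasurable)
      (integrable_sq_localWeight.mul_const _) (fun n => Eventually.of_forall fun z => ?_)
      (Eventually.of_forall fun z => ?_)
    · simpa using h
    · rw [Real.norm_of_nonneg (by positivity)]
      gcongr
      calc ‖lowPass A (hat (v n - u).fn) z‖ ^ 2 ≤ (‖cutoff A 0‖ * ‖hat (v n - u).fn‖) ^ 2 := by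
            gcongr; exact norm_lowPass_le A _ z
        _ = ‖cutoff A 0‖ ^ 2 * ‖(v n - u).fn‖ ^ 2 := by rw [norm_hat, mul_pow]
        _ ≤ ‖cutoff A 0‖ ^ 2 * (c⁻¹ * N) := by
            gcongr
            refine (v n - u).norm_fn_sq_le.trans ?_
            gcongr
            exact hdN n
    · have h1 := hv.map_complex (Energy.lowPassL A z)
      have h2 : Tendsto (fun n => lowPass A (hat (v n - u).fn) z) atTop (𝓝 0) := by
        have := h1.sub_const (Energy.lowPassL A z u)
        rw [sub_self] at this
        refine this.congr fun n => ?_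
        rw [← Energy.lowPassL_apply, map_sub]
      simpa using ((h2.norm.pow 2).const_mul (localWeight z ^ 2))
  have hlim : Tendsto (fun n => ∫ z, (localWeight z * (v n - u).fn z) ^ 2) atTop (𝓝 0) := by
    rw [Metric.tendsto_atTop']
    intro ε hε
    -- High frequencies then contribute at most 2(ε/8) and low ones eventually less than 2(ε/4),
    -- below `ε` in total.
    set A := 8 * N / ε with hA
    have hA0 : 0 < A := by positivity
    have hNA : N / A = ε / 8 := by rw [hA]; field_simp
    obtain ⟨n₀, hn₀⟩ := eventually_atTop.1
      ((hlow A).eventually_lt_const (by positivity : (0 : ℝ) < ε / 4))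
    refine ⟨n₀, fun n hn => ?_⟩
    have h0 : 0 ≤ ∫ z, (localWeight z * (v n - u).fn z) ^ 2 :=
      integral_nonneg fun z => by positivity
    rw [Real.dist_eq, sub_zero, abs_of_nonneg h0]
    have h1 := (v n - u).integral_weight_sq_le hA0 (hdN n)
    have h2 := hn₀ n hn.le
    rw [hNA] at h1
    linarith
  have hae : ∀ n, (fun z => (localWeight z * (v n - u).fn z) ^ 2) =ᵐ[volume]
      fun z => (localWeight z * (v n).fn z - localWeight z * u.fn z) ^ 2 := by
    intro n
    have h1 : (v n - u).fn = (v n).fn - u.fn := rfl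
    rw [h1]
    filter_upwards [Lp.coeFn_sub (v n).fn u.fn] with z hz
    rw [hz, Pi.sub_apply]; ring
  obtain ⟨r, hr, hra⟩ := exists_subseq_ae_of_tendsto_integral_sq (ν := volume)
    (v := fun n z => localWeight z * (v n).fn z) (u := fun z => localWeight z * u.fn z)
    (fun n => continuous_localWeight.aestronglyMeasurable.mul (v n).memTwoFour.meas)
    (continuous_localWeight.aestronglyMeasurable.mul u.memTwoFour.meas)
    (fun n => (v n - u).integrable_weight_sq.congr (hae n))
    (hlim.congr fun n => integral_congr_ae (hae n))
  refine ⟨r, hr, ?_⟩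
  filter_upwards [hra] with z hz
  have hw := (localWeight_pos z).ne'
  have := hz.const_mul (localWeight z)⁻¹
  simpa [← mul_assoc, inv_mul_cancel₀ hw] using this

end Shrira

/-! ### The action functional and its nontrivial critical point -/

namespace Shrira

/-- Continuous functions of at most cubic growth, vanishing at least linearly at the origin. -/
structure CubicGrowth (f : ℝ → ℝ) (C : ℝ) : Prop where
  continuous : Continuous f
  nonneg : 0 ≤ C
  bound : ∀ s, |f s| ≤ C * (|s| + |s| ^ 3)

theorem rpow_le_add_pow_three {t q : ℝ} (ht : 0 ≤ t) (hq : 1 ≤ q) (hq' : q ≤ 3) :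
    t ^ q ≤ t + t ^ 3 := by
  rcases le_total t 1 with h | h
  · have := Real.rpow_le_rpow_of_exponent_ge' ht h zero_le_one hq
    rw [Real.rpow_one] at this
    have : 0 ≤ t ^ 3 := by positivity
    linarith
  · have h1 := Real.rpow_le_rpow_of_exponent_le h hq'
    rw [show (3 : ℝ) = ((3 : ℕ) : ℝ) by norm_num, Real.rpow_natCast] at h1
    linarith

theorem cubicGrowth_of_rpow {f : ℝ → ℝ} (hf : Continuous f) {C p : ℝ} (hC : 0 < C) (hp : 2 < p)
    (hp' : p < 4) (hfC : ∀ s, |f s| ≤ C * (|s| + |s| ^ (p - 1))) : CubicGrowth f (2 * C) := by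
  refine ⟨hf, by positivity, fun s => (hfC s).trans ?_⟩
  have h1 := rpow_le_add_pow_three (abs_nonneg s) (q := p - 1) (by linarith) (by linarith)
  have h2 : 0 ≤ |s| ^ 3 := by positivity
  calc C * (|s| + |s| ^ (p - 1)) ≤ C * (|s| + (|s| + |s| ^ 3)) := by gcongr
    _ ≤ 2 * C * (|s| + |s| ^ 3) := by nlinarith

/-- Growth strictly between linear and cubic is dominated by the square, up to small multiples of
the linear and cubic terms. -/
theorem exists_quadratic_bound {f : ℝ → ℝ} {C p : ℝ} (hC : 0 < C) (hp : 2 < p) (hp' : p < 4)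
    (hfC : ∀ s, |f s| ≤ C * (|s| + |s| ^ (p - 1))) (hf0 : f =o[𝓝 0] fun s : ℝ => |s|) {ε : ℝ}
    (hε : 0 < ε) : ∃ K, 0 < K ∧ ∀ s, |f s| ≤ ε * (|s| + |s| ^ 3) + K * |s| ^ 2 := by
  obtain ⟨δ, hδ, hsmall⟩ := Metric.eventually_nhds_iff.1 (hf0.def hε)
  -- Strict subcriticality p < 4 enters here: beyond `R` the growth is a small multiple of the cube.
  obtain ⟨R, hR1, hR⟩ : ∃ R : ℝ, 1 ≤ R ∧ 2 * C * R ^ (-(4 - p)) ≤ ε := by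
    have h := (tendsto_rpow_neg_atTop (y := 4 - p) (by linarith)).const_mul (2 * C)
    rw [mul_zero] at h
    obtain ⟨R, h1, h2⟩ := ((eventually_ge_atTop 1).and (h.eventually_lt_const hε)).exists
    exact ⟨R, h1, h2.le⟩
  -- Below `δ` the linear term suffices and above `R` the cubic one; in between f is bounded, and
  -- |s|²/δ² ≥ 1.
  refine ⟨C * (R + R ^ (p - 1)) / δ ^ 2, by positivity, fun s => ?_⟩
  have hs := abs_nonneg s
  have hs3 : 0 ≤ |s| ^ 3 := by positivity
  have hKs : 0 ≤ C * (R + R ^ (p - 1)) / δ ^ 2 * |s| ^ 2 := by positivity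
  rcases lt_or_ge |s| δ with h1 | h1
  · have h2 := hsmall (y := s) (by simpa using h1)
    simp only [Real.norm_eq_abs, abs_abs] at h2
    nlinarith [mul_nonneg hε.le hs3]
  rcases le_total |s| R with h2 | h2
  · have h3 : |f s| ≤ C * (R + R ^ (p - 1)) := by
      refine (hfC s).trans ?_
      gcongr
      linarith
    have h4 : C * (R + R ^ (p - 1)) ≤ C * (R + R ^ (p - 1)) / δ ^ 2 * |s| ^ 2 := by
      rw [div_mul_eq_mul_div, le_div_iff₀ (by positivity)]
      gcongr
    nlinarith [mul_nonneg hε.le hs3, mul_nonneg hε.le hs]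
  · have hs1 : 1 ≤ |s| := hR1.trans h2
    have hspos : 0 < |s| := by linarith
    have h3 : |s| ≤ |s| ^ (p - 1) := by
      have := Real.rpow_le_rpow_of_exponent_le hs1 (by linarith : (1 : ℝ) ≤ p - 1)
      rwa [Real.rpow_one] at this
    have h4 : |s| ^ (p - 1) = |s| ^ 3 * |s| ^ (-(4 - p)) := by
      rw [← Real.rpow_natCast, ← Real.rpow_add hspos]
      congr 1; push_cast; ring
    have h5 : |s| ^ (-(4 - p)) ≤ R ^ (-(4 - p)) :=
      Real.rpow_le_rpow_of_nonpos (by linarith) h2 (by linarith)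
    have h6 : |f s| ≤ ε * |s| ^ 3 := by
      calc |f s| ≤ C * (|s| + |s| ^ (p - 1)) := hfC s
        _ ≤ C * (|s| ^ (p - 1) + |s| ^ (p - 1)) := by gcongr
        _ = |s| ^ 3 * (2 * C * |s| ^ (-(4 - p))) := by rw [h4]; ring
        _ ≤ |s| ^ 3 * (2 * C * R ^ (-(4 - p))) := by gcongr
        _ ≤ |s| ^ 3 * ε := by gcongr
        _ = ε * |s| ^ 3 := mul_comm _ _
    nlinarith [mul_nonneg hε.le hs]

/-- Near the origin the primitive is small compared with the square. -/
theorem exists_primitive_bound {f : ℝ → ℝ} (hf : Continuous f) (hq : ∀ ε > 0, ∃ K, 0 < K ∧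
    ∀ s, |f s| ≤ ε * (|s| + |s| ^ 3) + K * |s| ^ 2) {ε : ℝ} (hε : 0 < ε) :
    ∃ K, 0 < K ∧ ∀ s, primitive f s ≤ ε * s ^ 2 + K * s ^ 4 := by
  obtain ⟨K, hK, hb⟩ := hq (ε / 2) (by positivity)
  -- Completing the square: K|s|³ ≤ εs²/2 + K²s⁴/(2ε); the remaining ε/2 comes from the cubic term
  -- in the bound of `f`.
  refine ⟨ε / 2 + K ^ 2 / (2 * ε), by positivity, fun s => ?_⟩
  obtain ⟨t, ht, h1⟩ := exists_primitive_sub_eq hf 0 s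
  have h2 := abs_le_add_of_mem_uIcc ht
  have h0 : primitive f 0 = 0 := by simp [primitive]
  rw [h0, sub_zero, sub_zero] at h1
  rw [abs_zero, zero_add, sub_zero] at h2
  have h3 : |f t| ≤ ε / 2 * (|s| + |s| ^ 3) + K * |s| ^ 2 := by
    refine (hb t).trans ?_
    gcongr
  have h4 : s ^ 2 = |s| ^ 2 := (sq_abs s).symm
  have h5 : s ^ 4 = |s| ^ 4 := by rw [show (4 : ℕ) = 2 * 2 by norm_num, pow_mul, pow_mul, sq_abs]
  rw [h1, h4, h5]
  have hs := abs_nonneg s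
  calc f t * s ≤ |f t| * |s| := by rw [← abs_mul]; exact le_abs_self _
    _ ≤ (ε / 2 * (|s| + |s| ^ 3) + K * |s| ^ 2) * |s| := by gcongr
    _ ≤ ε * |s| ^ 2 + (ε / 2 + K ^ 2 / (2 * ε)) * |s| ^ 4 := by
        generalize |s| = t at *
        have : ε * t ^ 2 + (ε / 2 + K ^ 2 / (2 * ε)) * t ^ 4
            - (ε / 2 * (t + t ^ 3) + K * t ^ 2) * t = t ^ 2 * (ε - K * t) ^ 2 / (2 * ε) := by
          field_simp; ring
        have h6 : 0 ≤ t ^ 2 * (ε - K * t) ^ 2 / (2 * ε) := by positivity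
        linarith

variable {c : ℝ}

theorem Energy.coeFn_add (u v : Energy c) :
    (u + v).fn =ᵐ[volume] fun z => u.fn z + v.fn z := Lp.coeFn_add u.fn v.fn

theorem Energy.coeFn_sub (u v : Energy c) :
    (u - v).fn =ᵐ[volume] fun z => u.fn z - v.fn z := Lp.coeFn_sub u.fn v.fn

theorem Energy.coeFn_smul (a : ℝ) (u : Energy c) :
    (a • u).fn =ᵐ[volume] fun z => a * u.fn z := Lp.coeFn_smul a u.fn

variable [hc : Fact (0 < c)]

theorem Energy.tendsto_integral_twoFour {v : ℕ → Energy c} {u : Energy c}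
    (hv : Tendsto v atTop (𝓝 u)) :
    Tendsto (fun n => ∫ z, twoFour ((v n).fn z - u.fn z)) atTop (𝓝 0) := by
  have h1 := tendsto_iff_norm_sub_tendsto_zero.1 hv
  have h2 : Tendsto (fun n => c⁻¹ * ‖v n - u‖ ^ 2 + 64 * Real.pi * ‖v n - u‖ ^ 4) atTop
      (𝓝 (c⁻¹ * 0 ^ 2 + 64 * Real.pi * 0 ^ 4)) :=
    ((h1.pow 2).const_mul _).add ((h1.pow 4).const_mul _)
  simp only [ne_eq, OfNat.ofNat_ne_zero, not_false_eq_true, zero_pow, mul_zero, add_zero] at h2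
  refine squeeze_zero (fun n => integral_nonneg fun z => twoFour_nonneg _) (fun n => ?_) h2
  refine le_trans (le_of_eq (integral_congr_ae ?_)) (v n - u).integral_twoFour_le
  filter_upwards [(v n).coeFn_sub u] with z hz
  rw [hz]

theorem Energy.exists_subseq_ae {v : ℕ → Energy c} {u : Energy c} (hv : Tendsto v atTop (𝓝 u)) :
    ∃ r : ℕ → ℕ, StrictMono r ∧ ∀ᵐ z, Tendsto (fun n => (v (r n)).fn z) atTop (𝓝 (u.fn z)) := by
  refine exists_subseq_ae_of_tendsto_integral_sq (ν := volume) (v := fun n => ((v n).fn : Plane → ℝ))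
    (u := u.fn) (fun n => (v n).memTwoFour.meas) u.memTwoFour.meas
    (fun n => ((v n).memTwoFour.sub u.memTwoFour).sq) ?_
  refine squeeze_zero (fun n => integral_nonneg fun z => by positivity) (fun n => ?_)
    (Energy.tendsto_integral_twoFour hv)
  refine integral_mono ((v n).memTwoFour.sub u.memTwoFour).sq
    ((v n).memTwoFour.sub u.memTwoFour).integrable fun z => ?_
  simp only [twoFour]
  nlinarith [pow_nonneg (sq_nonneg ((v n).fn z - u.fn z)) 2]

theorem Energy.integral_twoFour_le_of_norm_le {u : Energy c} {R : ℝ} (h : ‖u‖ ≤ R) :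
    ∫ z, twoFour (u.fn z) ≤ c⁻¹ * R ^ 2 + 64 * Real.pi * R ^ 4 := by
  have hcpos := hc.out
  have hpi := Real.pi_pos
  refine u.integral_twoFour_le.trans ?_
  gcongr

/-- The action functional. -/
def action (f : ℝ → ℝ) (u : Energy c) : ℝ := ‖u‖ ^ 2 / 2 - ∫ z, primitive f (u.fn z)

variable {f : ℝ → ℝ} {C : ℝ}

theorem CubicGrowth.integrable_comp_mul (hf : CubicGrowth f C) (u h : Energy c) :
    Integrable (fun z => f (u.fn z) * h.fn z) volume :=
  _root_.integrable_comp_mul hf.continuous hf.bound u.memTwoFour h.memTwoFour hf.nonneg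

theorem CubicGrowth.integrable_primitive (hf : CubicGrowth f C) (u : Energy c) :
    Integrable (fun z => primitive f (u.fn z)) volume :=
  Shrira.integrable_primitive hf.continuous hf.bound hf.nonneg u.memTwoFour

/-- The derivative of the action functional. -/
def actionDeriv (hf : CubicGrowth f C) (u : Energy c) : Energy c →ₗ[ℝ] ℝ where
  toFun h := inner ℝ u h - ∫ z, f (u.fn z) * h.fn z
  map_add' h k := by
    have e : ∫ z, f (u.fn z) * (h + k).fn z =
        (∫ z, f (u.fn z) * h.fn z) + ∫ z, f (u.fn z) * k.fn z := by
      rw [← integral_add (hf.integrable_comp_mul u h) (hf.integrable_comp_mul u k)]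
      refine integral_congr_ae ?_
      filter_upwards [h.coeFn_add k] with z hz
      rw [hz, mul_add]
    rw [e, inner_add_right]; ring
  map_smul' a h := by
    have e : ∫ z, f (u.fn z) * (a • h).fn z = a * ∫ z, f (u.fn z) * h.fn z := by
      rw [← integral_const_mul]
      refine integral_congr_ae ?_
      filter_upwards [h.coeFn_smul a] with z hz
      rw [hz]; ring
    rw [e, inner_smul_right, RingHom.id_apply, smul_eq_mul]; ring

theorem actionDeriv_apply (hf : CubicGrowth f C) (u h : Energy c) :
    actionDeriv hf u h = inner ℝ u h - ∫ z, f (u.fn z) * h.fn z := rfl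

/-- Strong convergence gives convergence almost everywhere only along subsequences, which is enough
since every subsequence has a further one with the same limit. -/
theorem continuous_action (hf : CubicGrowth f C) : Continuous (action f : Energy c → ℝ) := by
  rw [continuous_iff_seqContinuous]
  intro v u hv
  refine ((hv.norm.pow 2).div_const 2).sub (tendsto_of_subseq_tendsto fun ns hns => ?_)
  have hv' := hv.comp hns
  obtain ⟨r, hr, hra⟩ := Energy.exists_subseq_ae hv'
  exact ⟨r, tendsto_integral_primitive hf.continuous hf.bound hf.nonneg
    (fun n => (v (ns (r n))).memTwoFour) u.memTwoFour
    (Energy.tendsto_integral_twoFour (hv'.comp hr.tendsto_atTop)) hra⟩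

theorem continuous_actionDeriv (hf : CubicGrowth f C) (h : Energy c) :
    Continuous fun u : Energy c => actionDeriv hf u h := by
  rw [continuous_iff_seqContinuous]
  intro v u hv
  simp only [Function.comp_def, actionDeriv_apply]
  refine (hv.inner tendsto_const_nhds).sub (tendsto_of_subseq_tendsto fun ns hns => ?_)
  have hv' := hv.comp hns
  obtain ⟨r, hr, hra⟩ := Energy.exists_subseq_ae hv'
  obtain ⟨R, hR⟩ := hv.norm.bddAbove_range
  exact ⟨r, tendsto_integral_comp_mul_of_bounded hf.continuous hf.bound hf.nonneg
    (fun n => (v (ns (r n))).memTwoFour) u.memTwoFour h.memTwoFour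
    (fun n => Energy.integral_twoFour_le_of_norm_le (hR ⟨ns (r n), rfl⟩)) hra⟩

/-- This is the differentiability that the mountain pass argument requires. Two extractions give
convergence almost everywhere of base points and directions; the shift `n₀` ensures `s ≤ 1`, as the
majorant of the difference quotients demands. -/
theorem tendsto_action_slope (hf : CubicGrowth f C) {u h : Energy c} {v k : ℕ → Energy c}
    {s : ℕ → ℝ} (hv : Tendsto v atTop (𝓝 u)) (hk : Tendsto k atTop (𝓝 h))
    (hs : Tendsto s atTop (𝓝 0)) (hs0 : ∀ n, 0 < s n) :
    ∃ r : ℕ → ℕ, Tendsto r atTop atTop ∧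
      Tendsto (fun n => (action f (v (r n) + s (r n) • k (r n)) - action f (v (r n))) / s (r n))
        atTop (𝓝 (actionDeriv hf u h)) := by
  obtain ⟨r₁, hr₁, hv₁⟩ := Energy.exists_subseq_ae hv
  obtain ⟨r₂, hr₂, hk₂⟩ := Energy.exists_subseq_ae (hk.comp hr₁.tendsto_atTop)
  obtain ⟨n₀, hn₀⟩ := eventually_atTop.1 (hs.eventually_lt_const one_pos)
  have hshift : Tendsto (fun n : ℕ => n + n₀) atTop atTop := tendsto_add_atTop_nat n₀
  let r : ℕ → ℕ := fun n => r₁ (r₂ (n + n₀))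
  have hr : Tendsto r atTop atTop :=
    hr₁.tendsto_atTop.comp (hr₂.tendsto_atTop.comp hshift)
  refine ⟨r, hr, ?_⟩
  have hr0 : ∀ n, n₀ ≤ r n := fun n =>
    (Nat.le_add_left n₀ n).trans (((hr₂.id_le _).trans (hr₁.id_le _)))
  have hslope := tendsto_integral_primitive_slope (ν := volume) hf.continuous hf.bound hf.nonneg
    (v := fun n => (v (r n)).fn) (w := fun n => (k (r n)).fn) (u := u.fn) (h := h.fn)
    (s := fun n => s (r n)) (fun n => (v (r n)).memTwoFour) u.memTwoFour
    (fun n => (k (r n)).memTwoFour) h.memTwoFour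
    (Energy.tendsto_integral_twoFour (hv.comp hr)) (Energy.tendsto_integral_twoFour (hk.comp hr))
    (by filter_upwards [hv₁] with z hz; exact hz.comp (hr₂.tendsto_atTop.comp hshift))
    (by filter_upwards [hk₂] with z hz; exact hz.comp hshift)
    (hs.comp hr) (fun n => hs0 _) (fun n => (hn₀ _ (hr0 n)).le)
  have hquad : Tendsto (fun n => inner ℝ (v (r n)) (k (r n)) + s (r n) * ‖k (r n)‖ ^ 2 / 2) atTop
      (𝓝 (inner ℝ u h + 0 * ‖h‖ ^ 2 / 2)) :=
    ((hv.comp hr).inner (hk.comp hr)).add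
      (((hs.comp hr).mul ((hk.comp hr).norm.pow 2)).div_const 2)
  rw [zero_mul, zero_div, add_zero] at hquad
  refine (hquad.sub hslope).congr fun n => ?_
  have e : ∫ z, primitive f ((v (r n) + s (r n) • k (r n)).fn z) =
      ∫ z, primitive f ((v (r n)).fn z + s (r n) * (k (r n)).fn z) := by
    refine integral_congr_ae ?_
    filter_upwards [(v (r n)).coeFn_add (s (r n) • k (r n)), (k (r n)).coeFn_smul (s (r n))]
      with z h1 h2
    rw [h1, h2]
  have hne := (hs0 (r n)).ne'
  rw [action, action, e, norm_add_sq_real, inner_smul_right, norm_smul, mul_pow, Real.norm_eq_abs,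
    sq_abs]
  field_simp
  ring

/-- Scalar product and Lebesgue measure are invariant under translations, so translating an almost
critical point keeps it almost critical. -/
theorem actionDeriv_translate (hf : CubicGrowth f C) (a : Plane) (u h : Energy c) :
    actionDeriv hf (u.translate a) h = actionDeriv hf u (h.translate (-a)) := by
  rw [actionDeriv_apply, actionDeriv_apply]
  congr 1
  · rw [← Energy.inner_translate a u, Energy.translate_translate_neg]
  · rw [← integral_add_right_eq_self (fun z => f (u.fn z) * (h.translate (-a)).fn z) a]
    refine integral_congr_ae ?_
    filter_upwards [coeFn_translate a u.fn,
      (measurePreserving_add_right_plane a).quasiMeasurePreserving.ae (coeFn_translate (-a) h.fn)]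
      with z h1 h2
    rw [Energy.fn_translate, Energy.fn_translate, h1, h2, add_neg_cancel_right]

/-- The action has the mountain pass geometry at the origin. -/
theorem exists_action_lower_bound (hf : CubicGrowth f C) (hq : ∀ ε > 0, ∃ K, 0 < K ∧
    ∀ s, |f s| ≤ ε * (|s| + |s| ^ 3) + K * |s| ^ 2) :
    ∃ ρ > 0, ∀ u : Energy c, ‖u‖ ≤ ρ → ‖u‖ ^ 2 / 8 ≤ action f u := by
  have hcpos := hc.out
  have hpi := Real.pi_pos
  obtain ⟨K, hK, hb⟩ := exists_primitive_bound hf.continuous hq (ε := c / 8) (by positivity)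
  -- The quadratic part of ∫ F costs ‖u‖²/8 (choice c/8 above), and this radius limits the quartic
  -- part to ‖u‖²/4: 1/2 - 1/8 - 1/4 = 1/8.
  refine ⟨Real.sqrt (1 / (4 * (K * (64 * Real.pi)))), Real.sqrt_pos.2 (by positivity),
    fun u hu => ?_⟩
  have h1 : ∫ z, primitive f (u.fn z) ≤ c / 8 * (∫ z, u.fn z ^ 2) + K * ∫ z, u.fn z ^ 4 := by
    rw [← integral_const_mul, ← integral_const_mul, ← integral_add
      (u.memTwoFour.sq.const_mul _) (u.memTwoFour.four.const_mul _)]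
    exact integral_mono (hf.integrable_primitive u)
      ((u.memTwoFour.sq.const_mul _).add (u.memTwoFour.four.const_mul _)) fun z => hb _
  have h2 : c / 8 * (∫ z, u.fn z ^ 2) ≤ ‖u‖ ^ 2 / 8 := by
    rw [← sq_norm_realL2]
    calc c / 8 * ‖u.fn‖ ^ 2 ≤ c / 8 * (c⁻¹ * ‖u‖ ^ 2) := by gcongr; exact u.norm_fn_sq_le
      _ = ‖u‖ ^ 2 / 8 := by field_simp
  have h3 : ‖u‖ ^ 2 ≤ 1 / (4 * (K * (64 * Real.pi))) := by
    have := pow_le_pow_left₀ (norm_nonneg u) hu 2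
    rwa [Real.sq_sqrt (by positivity)] at this
  have h4 : K * ∫ z, u.fn z ^ 4 ≤ ‖u‖ ^ 2 / 4 := by
    calc K * ∫ z, u.fn z ^ 4 ≤ K * (64 * Real.pi * ‖u‖ ^ 4) := by
          gcongr; exact u.integral_four_le
      _ = K * (64 * Real.pi) * ‖u‖ ^ 2 * ‖u‖ ^ 2 := by ring
      _ ≤ K * (64 * Real.pi) * (1 / (4 * (K * (64 * Real.pi)))) * ‖u‖ ^ 2 := by gcongr
      _ = ‖u‖ ^ 2 / 4 := by field_simp
  rw [action]
  linarith

/-- Almost critical points are bounded, by the Ambrosetti-Rabinowitz condition. -/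
theorem norm_le_of_almost_critical (hf : CubicGrowth f C) {μ : ℝ} (hμ : 2 < μ)
    (hAR : ∀ s, s ≠ 0 → 0 < μ * primitive f s ∧ μ * primitive f s ≤ s * f s) {B : ℝ} {u : Energy c}
    (hB : action f u ≤ B) (hu : |actionDeriv hf u u| ≤ ‖u‖) :
    ‖u‖ ≤ (|B| + 1) / (1 / 2 - 1 / μ) + 1 := by
  have hκ : 0 < 1 / 2 - 1 / μ := by
    have : 1 / μ < 1 / 2 := one_div_lt_one_div_of_lt (by norm_num) hμ
    linarith
  have hμ0 : 0 < μ := by linarith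
  have h1 : μ * ∫ z, primitive f (u.fn z) ≤ ∫ z, f (u.fn z) * u.fn z := by
    rw [← integral_const_mul]
    refine integral_mono ((hf.integrable_primitive u).const_mul μ) (hf.integrable_comp_mul u u)
      fun z => ?_
    rcases eq_or_ne (u.fn z) 0 with h | h
    · simp [h, primitive]
    · simpa [mul_comm] using (hAR _ h).2
  have h2 := actionDeriv_apply hf u u
  rw [real_inner_self_eq_norm_sq] at h2
  have h3 := abs_le.1 hu
  rw [action] at hB
  -- Comes from S(u) - S'(u)u/μ, in which the nonlinear terms have a favourable sign. A quadratic
  -- quantity bounded by a linear one bounds the norm.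
  have h4 : (1 / 2 - 1 / μ) * ‖u‖ ^ 2 ≤ |B| + ‖u‖ := by
    have h5 : (∫ z, primitive f (u.fn z)) ≤ (∫ z, f (u.fn z) * u.fn z) / μ := by
      rw [le_div_iff₀ hμ0]; linarith
    have h6 : (∫ z, f (u.fn z) * u.fn z) / μ = ‖u‖ ^ 2 / μ - actionDeriv hf u u / μ := by
      rw [h2]; ring
    have h7 : -(actionDeriv hf u u / μ) ≤ ‖u‖ := by
      rw [← neg_div, div_le_iff₀ hμ0]
      nlinarith [norm_nonneg u]
    have h8 := le_abs_self B
    have h9 : (1 / 2 - 1 / μ) * ‖u‖ ^ 2 = ‖u‖ ^ 2 / 2 - ‖u‖ ^ 2 / μ := by ring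
    linarith
  by_contra! hcon
  have hx1 : 1 < ‖u‖ := by
    have : 0 ≤ (|B| + 1) / (1 / 2 - 1 / μ) := by positivity
    linarith
  have h5 : |B| + 1 < (1 / 2 - 1 / μ) * ‖u‖ := by
    have : (|B| + 1) / (1 / 2 - 1 / μ) < ‖u‖ := by linarith
    rwa [div_lt_iff₀' hκ] at this
  nlinarith [abs_nonneg B]

theorem Energy.integrable_three (u : Energy c) : Integrable (fun z => |u.fn z| ^ 3) volume := by
  refine u.memTwoFour.integrable.mono' (u.memTwoFour.meas.norm.pow 3)
    (Eventually.of_forall fun z => ?_)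
  rw [Real.norm_of_nonneg (by positivity), ← twoFour_abs]
  unfold twoFour
  nlinarith [sq_nonneg (|u.fn z| - 1), sq_nonneg (|u.fn z|), sq_nonneg (|u.fn z| * (|u.fn z| - 1))]

/-- Almost critical points at positive levels do not vanish in `L³`. -/
theorem exists_lower_bound_integral_three (hf : CubicGrowth f C) (hq : ∀ ε > 0, ∃ K, 0 < K ∧
    ∀ s, |f s| ≤ ε * (|s| + |s| ^ 3) + K * |s| ^ 2) (hF : ∀ s, 0 ≤ primitive f s) {a R : ℝ}
    (ha : 0 < a) :
    ∃ δ > 0, ∀ u : Energy c, a ≤ action f u → ‖u‖ ≤ R → |actionDeriv hf u u| ≤ a →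
      δ ≤ ∫ z, |u.fn z| ^ 3 := by
  have hcpos := hc.out
  have hpi := Real.pi_pos
  set T := c⁻¹ * R ^ 2 + 64 * Real.pi * R ^ 4 + 1 with hT
  have hT0 : 0 < T := by positivity
  obtain ⟨K, hK, hb⟩ := hq (a / (2 * T)) (by positivity)
  -- S(u) ≥ a and F ≥ 0 give ‖u‖² ≥ 2a, so ∫ f(u)u ≥ a by almost criticality; the ε-term takes at
  -- most a/2 of it, leaving a/2 for K∫|u|³.
  refine ⟨a / (2 * K), by positivity, fun u h1 h2 h3 => ?_⟩
  have h4 : ∫ z, f (u.fn z) * u.fn z ≤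
      a / (2 * T) * (∫ z, twoFour (u.fn z)) + K * ∫ z, |u.fn z| ^ 3 := by
    rw [← integral_const_mul, ← integral_const_mul, ← integral_add
      (u.memTwoFour.integrable.const_mul _) (u.integrable_three.const_mul _)]
    refine integral_mono (hf.integrable_comp_mul u u)
      ((u.memTwoFour.integrable.const_mul _).add (u.integrable_three.const_mul _)) fun z => ?_
    have h5 := hb (u.fn z)
    simp only
    rw [← twoFour_abs]
    calc f (u.fn z) * u.fn z ≤ |f (u.fn z)| * |u.fn z| := by rw [← abs_mul]; exact le_abs_self _
      _ ≤ (a / (2 * T) * (|u.fn z| + |u.fn z| ^ 3) + K * |u.fn z| ^ 2) * |u.fn z| := by gcongr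
      _ = _ := by unfold twoFour; ring
  have h5 : a / (2 * T) * (∫ z, twoFour (u.fn z)) ≤ a / 2 := by
    calc a / (2 * T) * (∫ z, twoFour (u.fn z)) ≤ a / (2 * T) * T := by
          gcongr
          have := Energy.integral_twoFour_le_of_norm_le h2
          linarith
      _ = a / 2 := by field_simp
  have h6 := actionDeriv_apply hf u u
  rw [real_inner_self_eq_norm_sq] at h6
  have h7 : 0 ≤ ∫ z, primitive f (u.fn z) := integral_nonneg fun z => hF _
  have h8 := abs_le.1 h3
  rw [action] at h1
  rw [div_le_iff₀ (by positivity)]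
  linarith

/-- Bounded sets not vanishing in `L³` have low frequencies that are somewhere large. -/
theorem exists_lowPass_lower_bound {δ : ℝ} (hδ : 0 < δ) (R : ℝ) :
    ∃ A M : ℝ, 0 < M ∧ ∀ u : Energy c, ‖u‖ ≤ R → δ ≤ ∫ z, |u.fn z| ^ 3 →
      ∃ x, M ≤ ‖lowPass A (hat u.fn) x‖ := by
  have hcpos := hc.out
  have hpi := Real.pi_pos
  set N := R ^ 2 + 1 with hN
  have hN0 : 0 < N := by positivity
  -- With these choices of `s`, `A`, `M` the bound of `integral_three_le` is δ/4 + 2(δ/8 + δ/8) =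
  -- 3δ/4, a contradiction if the low frequencies stay below `M`.
  set s := δ / (8 * (64 * Real.pi * N ^ 2)) with hs
  have hs0 : 0 < s := by positivity
  set A := 8 * N / (s * δ) with hA
  have hA0 : 0 < A := by positivity
  set M := δ / (16 * (c⁻¹ * N)) with hM
  have hM0 : 0 < M := by positivity
  refine ⟨A, M, hM0, fun u hu hδu => ?_⟩
  by_contra! hcon
  have hR2 : ‖u‖ ^ 2 ≤ N := by
    have := pow_le_pow_left₀ (norm_nonneg u) hu 2
    linarith
  have h1 := integral_three_le (u := toComplex u.fn) (u.halfEnergyLE.mono hR2) hN0 hA0 hs0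
    fun x => (hcon x).le
  have h2 : ∫ z, ‖toComplex u.fn z‖ ^ 3 = ∫ z, |u.fn z| ^ 3 := by
    refine integral_congr_ae ?_
    filter_upwards [ae_norm_toComplex u.fn] with z hz
    rw [hz]
  rw [h2, norm_toComplex] at h1
  have h3 : 4 * M * ‖u.fn‖ ^ 2 ≤ δ / 4 := by
    calc 4 * M * ‖u.fn‖ ^ 2 ≤ 4 * M * (c⁻¹ * N) := by
          gcongr
          refine u.norm_fn_sq_le.trans ?_
          gcongr
      _ = δ / 4 := by rw [hM]; field_simp; norm_num
  have h4 : N / A / s = δ / 8 := by rw [hA]; field_simp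
  have h5 : s * (64 * Real.pi * N ^ 2) = δ / 8 := by rw [hs]; field_simp
  rw [h4, h5] at h1
  linarith

/-- The existence of a nontrivial critical point. -/
theorem exists_critical_point (hf : CubicGrowth f C) (hq : ∀ ε > 0, ∃ K, 0 < K ∧
    ∀ s, |f s| ≤ ε * (|s| + |s| ^ 3) + K * |s| ^ 2) {μ : ℝ} (hμ : 2 < μ)
    (hAR : ∀ s, s ≠ 0 → 0 < μ * primitive f s ∧ μ * primitive f s ≤ s * f s)
    {e : Energy c} (he : action f e < 0) :
    ∃ φ : Energy c, φ ≠ 0 ∧ ∀ χ, actionDeriv hf φ χ = 0 := by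
  have hμ0 : 0 < μ := by linarith
  have hF : ∀ s, 0 ≤ primitive f s := by
    intro s
    rcases eq_or_ne s 0 with rfl | h
    · simp [primitive]
    · exact (pos_of_mul_pos_right (hAR s h).1 hμ0.le).le
  obtain ⟨ρ, hρ, hlow⟩ := exists_action_lower_bound (c := c) hf hq
  have hρe : ρ ≤ ‖e‖ := by
    by_contra! h
    have h1 := hlow e h.le
    have h2 : 0 ≤ ‖e‖ ^ 2 / 8 := by positivity
    linarith
  have ha : 0 < ρ ^ 2 / 8 := by positivity
  have hS0 : action f (0 : Energy c) < ρ ^ 2 / 8 := by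
    have h0 : ∫ z, primitive f ((0 : Energy c).fn z) = 0 := by
      have : ∀ᵐ z, primitive f ((0 : Energy c).fn z) = 0 := by
        have h1 : (0 : Energy c).fn = 0 := rfl
        rw [h1]
        filter_upwards [Lp.coeFn_zero ℝ 2 (volume : Measure Plane)] with z hz
        rw [hz]; simp [primitive]
      rw [integral_congr_ae this, integral_zero]
    rw [action, h0, norm_zero]
    simpa using ha
  obtain ⟨B, hB⟩ := exists_almost_critical_of_mountain_pass (S := (action f : Energy c → ℝ))
    (S' := actionDeriv hf) (continuous_action hf) (continuous_actionDeriv hf)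
    (fun u h v k s hv hk hs hs0 => tendsto_action_slope hf hv hk hs hs0) hS0 (he.trans ha) hρ.le
    hρe (fun u hu => by have := hlow u hu.le; rwa [hu] at this)
  set R := (|B| + 1) / (1 / 2 - 1 / μ) + 1 with hR
  have hR1 : 1 ≤ R := by
    have hκ : 0 < 1 / 2 - 1 / μ := by
      have : 1 / μ < 1 / 2 := one_div_lt_one_div_of_lt (by norm_num) hμ
      linarith
    have : 0 ≤ (|B| + 1) / (1 / 2 - 1 / μ) := by positivity
    linarith
  obtain ⟨δ, hδ, h3⟩ := exists_lower_bound_integral_three (c := c) hf hq hF (R := R) ha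
  obtain ⟨A, M, hM, hlp⟩ := exists_lowPass_lower_bound (c := c) hδ R
  -- The 1 serves the a priori bound of the norm; ρ²/(8R) makes |S'(u)u| at most the level ρ²/8 once
  -- ‖u‖ ≤ R; n + 1 makes the derivatives tend to 0.
  have hε : ∀ n : ℕ, 0 < min 1 (ρ ^ 2 / 8 / R) / ((n : ℝ) + 1) := fun n => by positivity
  have hε1 : ∀ n : ℕ, min 1 (ρ ^ 2 / 8 / R) / ((n : ℝ) + 1) ≤ min 1 (ρ ^ 2 / 8 / R) := fun n =>
    div_le_self (by positivity) (by linarith [(Nat.cast_nonneg n : (0 : ℝ) ≤ n)])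
  choose u hua huB hu' using fun n => hB _ (hε n)
  have huR : ∀ n, ‖u n‖ ≤ R := fun n => by
    refine norm_le_of_almost_critical hf hμ hAR (huB n) ((hu' n (u n)).trans ?_)
    have := (hε1 n).trans (min_le_left _ _)
    nlinarith [norm_nonneg (u n)]
  have hx : ∀ n, ∃ x, M ≤ ‖lowPass A (hat (u n).fn) x‖ := fun n => by
    refine hlp (u n) (huR n) (h3 (u n) (hua n) (huR n) ((hu' n (u n)).trans ?_))
    calc min 1 (ρ ^ 2 / 8 / R) / ((n : ℝ) + 1) * ‖u n‖ ≤ ρ ^ 2 / 8 / R * R :=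
          mul_le_mul ((hε1 n).trans (min_le_right _ _)) (huR n) (norm_nonneg _) (by positivity)
      _ = ρ ^ 2 / 8 := by field_simp
  choose x hx using hx
  -- Recentring at the points of concentration: the low-frequency value at 0 is now at least `M` in
  -- modulus, which prevents the weak limit from vanishing.
  let v : ℕ → Energy c := fun n => (u n).translate (x n)
  have hvR : ∀ n, ‖v n‖ ≤ R := fun n => by rw [Energy.norm_translate]; exact huR n
  obtain ⟨φ, r, hr, hweak⟩ := exists_weakly_convergent_subseq hvR
  have hweak' : WeaklyTendsto (fun n => v (r n)) φ := hweak
  obtain ⟨q, hqm, hae⟩ := Energy.exists_subseq_ae_of_weaklyTendsto hweak' fun n => hvR (r n)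
  refine ⟨φ, ?_, fun χ => ?_⟩
  · rintro rfl
    have h1 := (hweak'.map_complex (Energy.lowPassL A 0)).norm
    rw [map_zero, norm_zero] at h1
    have h2 : M ≤ 0 := by
      refine ge_of_tendsto' h1 fun n => ?_
      rw [Energy.lowPassL_apply, Energy.fn_translate, lowPass_hat_translate, zero_add]
      exact hx (r n)
    linarith
  · have h1 : Tendsto (fun n => actionDeriv hf (v (r (q n))) χ) atTop
        (𝓝 (actionDeriv hf φ χ)) := by
      simp only [actionDeriv_apply]
      refine ((hweak χ).comp hqm.tendsto_atTop).sub ?_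
      exact tendsto_integral_comp_mul_of_bounded hf.continuous hf.bound hf.nonneg
        (fun n => (v (r (q n))).memTwoFour) φ.memTwoFour χ.memTwoFour
        (fun n => Energy.integral_twoFour_le_of_norm_le (hvR _)) hae
    have h2 : Tendsto (fun n => actionDeriv hf (v n) χ) atTop (𝓝 0) := by
      have h4 : Tendsto (fun n : ℕ => min 1 (ρ ^ 2 / 8 / R) / ((n : ℝ) + 1) * ‖χ‖) atTop (𝓝 0) := by
        have h5 := (tendsto_one_div_add_atTop_nhds_zero_nat (𝕜 := ℝ)).const_mul
          (min 1 (ρ ^ 2 / 8 / R))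
        have h6 := h5.mul_const ‖χ‖
        rw [mul_zero, zero_mul] at h6
        refine h6.congr fun n => ?_
        ring
      refine squeeze_zero_norm (fun n => ?_) h4
      rw [Real.norm_eq_abs, actionDeriv_translate, ← Energy.norm_translate (-x n) χ]
      exact hu' n _
    exact tendsto_nhds_unique h1 (h2.comp (hr.tendsto_atTop.comp hqm.tendsto_atTop))

end Shrira

/-! ### Symbols, Schwartz test functions and the Hilbert transform -/

namespace Shrira

open scoped RealInnerProductSpace ContDiff ComplexConjugate

/-- A real-valued Schwartz function as a complex-valued one. -/
def complexify (g : 𝓢(Plane, ℝ)) : 𝓢(Plane, ℂ) := g.postcompCLM Complex.ofRealCLM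

theorem complexify_apply (g : 𝓢(Plane, ℝ)) (z : Plane) : complexify g z = (g z : ℂ) := rfl

theorem lineDeriv_complexify (v : Plane) (g : 𝓢(Plane, ℝ)) :
    ∂_{v} (complexify g) = complexify (∂_{v} g) := by
  ext z
  rw [complexify_apply, SchwartzMap.lineDerivOp_apply_eq_fderiv,
    SchwartzMap.lineDerivOp_apply_eq_fderiv]
  have h := (Complex.ofRealCLM.hasFDerivAt (x := g z)).comp z g.differentiableAt.hasFDerivAt
  have h2 : fderiv ℝ (complexify g) z = Complex.ofRealCLM.comp (fderiv ℝ g z) := h.fderiv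
  rw [h2]; rfl

/-- The unit vector in the direction of `y`. -/
def ey : Plane := EuclideanSpace.single 1 1

theorem laplacian_eq_add {F : Type*} [NormedAddCommGroup F] [NormedSpace ℝ F] (ψ : 𝓢(Plane, F)) :
    Δ ψ = ∂_{ex} (∂_{ex} ψ) + ∂_{ey} (∂_{ey} ψ) := by
  rw [SchwartzMap.laplacian_eq_sum (EuclideanSpace.basisFun (Fin 2) ℝ), Fin.sum_univ_two]
  simp [ex, ey]

theorem laplacian_complexify (g : 𝓢(Plane, ℝ)) : Δ (complexify g) = complexify (Δ g) := by
  rw [laplacian_eq_add, laplacian_eq_add, lineDeriv_complexify, lineDeriv_complexify,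
    lineDeriv_complexify, lineDeriv_complexify]
  exact (map_add (SchwartzMap.postcompCLM Complex.ofRealCLM) _ _).symm

theorem fourier_lineDeriv_apply (v : Plane) (ψ : 𝓢(Plane, ℂ)) (ζ : Plane) :
    (𝓕 (∂_{v} ψ)) ζ = 2 * Real.pi * Complex.I * ((⟪ζ, v⟫ : ℝ) : ℂ) * (𝓕 ψ) ζ := by
  have : (inner ℝ · v : Plane → ℝ).HasTemperateGrowth := ((innerSL ℝ).flip v).hasTemperateGrowth
  rw [SchwartzMap.fourier_lineDerivOp_eq, smul_apply,
    SchwartzMap.smulLeftCLM_apply_apply this, smul_eq_mul, Complex.real_smul]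
  ring

theorem fourier_lineDeriv_ex (ψ : 𝓢(Plane, ℂ)) (ζ : Plane) :
    (𝓕 (∂_{ex} ψ)) ζ = Complex.I * (xi ζ : ℂ) * (𝓕 ψ) ζ := by
  rw [fourier_lineDeriv_apply]
  have : (⟪ζ, ex⟫ : ℝ) = ζ 0 := by simp [ex, EuclideanSpace.inner_single_right]
  rw [this, xi]; push_cast; ring

theorem fourier_lineDeriv_ey (ψ : 𝓢(Plane, ℂ)) (ζ : Plane) :
    (𝓕 (∂_{ey} ψ)) ζ = Complex.I * (eta ζ : ℂ) * (𝓕 ψ) ζ := by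
  rw [fourier_lineDeriv_apply]
  have : (⟪ζ, ey⟫ : ℝ) = ζ 1 := by simp [ey, EuclideanSpace.inner_single_right]
  rw [this, eta]; push_cast; ring

theorem fourier_laplacian (ψ : 𝓢(Plane, ℂ)) (ζ : Plane) :
    (𝓕 (Δ ψ)) ζ = -((xi ζ ^ 2 + eta ζ ^ 2 : ℝ) : ℂ) * (𝓕 ψ) ζ := by
  rw [laplacian_eq_add, FourierTransform.fourier_add, add_apply, fourier_lineDeriv_ex,
    fourier_lineDeriv_ex, fourier_lineDeriv_ey, fourier_lineDeriv_ey]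
  push_cast
  linear_combination ((xi ζ : ℂ) ^ 2 + (eta ζ : ℂ) ^ 2) * (𝓕 ψ) ζ * Complex.I_mul_I

theorem toComplex_toLp (g : 𝓢(Plane, ℝ)) : toComplex (g.toLp 2) = (complexify g).toLp 2 := by
  ext1
  filter_upwards [coeFn_toComplex (g.toLp 2), g.coeFn_toLp 2, (complexify g).coeFn_toLp 2]
    with z h1 h2 h3
  rw [h1, h2, h3, complexify_apply]

theorem hat_toLp (g : 𝓢(Plane, ℝ)) : hat (g.toLp 2) =ᵐ[volume] fun ζ => (𝓕 (complexify g)) ζ := by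
  rw [hat, toComplex_toLp, SchwartzMap.toLp_fourier_eq]
  exact SchwartzMap.coeFn_toLp _ 2 _

theorem hat_lineDeriv_toLp (g : 𝓢(Plane, ℝ)) :
    hat ((∂_{ex} g).toLp 2) =ᵐ[volume] fun ζ => Complex.I * (xi ζ : ℂ) * (𝓕 (complexify g)) ζ := by
  filter_upwards [hat_toLp (∂_{ex} g)] with ζ hζ
  rw [hζ, ← lineDeriv_complexify, fourier_lineDeriv_ex]

theorem measurable_xi : Measurable xi := by unfold xi; fun_prop

theorem measurable_eta : Measurable eta := by unfold eta; fun_prop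

theorem measurable_symDx : Measurable symDx :=
  Complex.measurable_ofReal.comp (measurable_xi.abs.pow_const _)

theorem measurable_symDxInvDy : Measurable symDxInvDy :=
  (Complex.measurable_ofReal.comp (measurable_xi.abs.pow_const _)).mul
    (measurable_const.mul (Complex.measurable_ofReal.comp measurable_eta))

theorem memLp_of_norm_le_add {a : Plane → ℂ} (ha : AEStronglyMeasurable a volume)
    (ψ₁ ψ₂ : 𝓢(Plane, ℂ)) (h : ∀ᵐ ζ, ‖a ζ‖ ≤ ‖ψ₁ ζ‖ + ‖ψ₂ ζ‖) : MemLp a 2 volume := by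
  refine MemLp.of_le ((ψ₁.memLp 2).norm.add (ψ₂.memLp 2).norm) ha ?_
  filter_upwards [h] with ζ hζ
  refine hζ.trans (le_of_eq ?_)
  rw [Pi.add_apply, Real.norm_of_nonneg (by positivity)]

theorem sqrt_le_one_add {t : ℝ} (ht : 0 ≤ t) : t ^ (1 / 2 : ℝ) ≤ 1 + t := by
  rw [← Real.sqrt_eq_rpow]
  exact Real.sqrt_le_iff.2 ⟨by positivity, by nlinarith⟩

/-- The `x`-derivatives of Schwartz functions belong to the energy space. -/
theorem lineDeriv_toLp_mem_energySpace (g : 𝓢(Plane, ℝ)) :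
    (∂_{ex} g).toLp 2 ∈ energySpace := by
  set h : 𝓢(Plane, ℂ) := complexify g with hh
  have hm : AEStronglyMeasurable (hat ((∂_{ex} g).toLp 2)) volume := Lp.aestronglyMeasurable _
  constructor
  · refine memLp_of_norm_le_add (measurable_symDx.aestronglyMeasurable.mul hm)
      (𝓕 (∂_{ex} h)) (𝓕 (∂_{ex} (∂_{ex} h))) ?_
    filter_upwards [hat_lineDeriv_toLp g] with ζ hζ
    rw [hζ, fourier_lineDeriv_ex (∂_{ex} h), ← fourier_lineDeriv_ex, norm_mul, norm_mul, norm_mul,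
      Complex.norm_I, one_mul, symDx, Complex.norm_real, Complex.norm_real, Real.norm_eq_abs,
      Real.norm_eq_abs, abs_of_nonneg (Real.rpow_nonneg (abs_nonneg _) _)]
    have := sqrt_le_one_add (abs_nonneg (xi ζ))
    nlinarith [norm_nonneg ((𝓕 (∂_{ex} h)) ζ)]
  -- The factor ξ of the x-derivative turns |ξ|^{-1/2} into |ξ|^{1/2} ≤ 1 + |ξ|, and the two
  -- summands are transforms of Schwartz functions.
  · refine memLp_of_norm_le_add (measurable_symDxInvDy.aestronglyMeasurable.mul hm)
      (𝓕 (∂_{ey} h)) (𝓕 (∂_{ex} (∂_{ey} h))) ?_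
    filter_upwards [hat_lineDeriv_toLp g, ae_xi_ne_zero] with ζ hζ hne
    have hpos : 0 < |xi ζ| := abs_pos.2 hne
    have e : |xi ζ| ^ (-1 / 2 : ℝ) * |xi ζ| = |xi ζ| ^ (1 / 2 : ℝ) := by
      nth_rewrite 2 [← Real.rpow_one |xi ζ|]
      rw [← Real.rpow_add hpos]; norm_num
    have e2 : ‖symDxInvDy ζ * hat ((∂_{ex} g).toLp 2) ζ‖ =
        |xi ζ| ^ (1 / 2 : ℝ) * ‖(𝓕 (∂_{ey} h)) ζ‖ := by
      rw [hζ, fourier_lineDeriv_ey, symDxInvDy, ← e]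
      simp only [norm_mul, Complex.norm_I, one_mul, Complex.norm_real, Real.norm_eq_abs]
      rw [abs_of_nonneg (Real.rpow_nonneg (abs_nonneg _) _)]
      ring
    rw [e2, fourier_lineDeriv_ex (∂_{ey} h), norm_mul, norm_mul, Complex.norm_I, one_mul,
      Complex.norm_real, Real.norm_eq_abs]
    have := sqrt_le_one_add (abs_nonneg (xi ζ))
    nlinarith [norm_nonneg ((𝓕 (∂_{ey} h)) ζ)]

theorem conj_fourier (ψ : Plane → ℂ) (z : Plane) :
    conj (𝓕 (fun ζ => conj (ψ ζ)) z) = 𝓕 ψ (-z) := by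
  rw [Real.fourier_eq, Real.fourier_eq, ← integral_conj]
  refine integral_congr_ae (Eventually.of_forall fun ζ => ?_)
  simp only [Circle.smul_def, smul_eq_mul, map_mul, Complex.conj_conj, inner_neg_right, neg_neg,
    AddChar.map_neg_eq_inv, Circle.coe_inv_eq_conj]

theorem fourier_comp_neg_apply (ψ : Plane → ℂ) (z : Plane) :
    𝓕 (fun ζ => ψ (-ζ)) z = 𝓕 ψ (-z) := by
  rw [Real.fourier_eq, Real.fourier_eq, ← integral_neg_eq_self]
  refine integral_congr_ae (Eventually.of_forall fun ζ => ?_)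
  simp

/-- The Fourier transform of a real-valued function is Hermitian. -/
theorem hat_neg (u : RealL2) : (fun ζ => hat u (-ζ)) =ᵐ[volume] fun ζ => conj (hat u ζ) := by
  have hm := Lp.memLp (hat u)
  have h1 : MemLp (fun ζ => hat u (-ζ)) 2 volume :=
    hm.comp_measurePreserving (Measure.measurePreserving_neg volume)
  have h2 : MemLp (fun ζ => conj (hat u ζ)) 2 volume := hm.star
  refine ae_eq_of_integral_schwartz_smul_eq (h1.locallyIntegrable (by norm_num))
    (h2.locallyIntegrable (by norm_num)) fun ψ hψ => ?_
  have hc1 : HasCompactSupport (fun ζ => ψ (-ζ)) := hψ.comp_homeomorph (Homeomorph.neg Plane)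
  have hc2 : HasCompactSupport (fun ζ => conj (ψ ζ)) := hψ.comp_left (map_zero _)
  let ψ₁ : 𝓢(Plane, ℂ) := hc1.toSchwartzMap ((ψ.smooth ⊤).comp contDiff_neg)
  let ψ₂ : 𝓢(Plane, ℂ) := hc2.toSchwartzMap (Complex.conjCLE.contDiff.comp (ψ.smooth ⊤))
  have e1 : ∀ z, (𝓕 ψ₁) z = 𝓕 (ψ : Plane → ℂ) (-z) := fun z => fourier_comp_neg_apply ψ z
  have e2 : ∀ z, conj ((𝓕 ψ₂) z) = 𝓕 (ψ : Plane → ℂ) (-z) := fun z => conj_fourier ψ z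
  have i1 : ∫ ζ, ψ ζ • hat u (-ζ) = ∫ z, (𝓕 ψ₁) z • toComplex u z := by
    rw [← integral_schwartz_smul_fourier, ← integral_neg_eq_self]
    refine integral_congr_ae (Eventually.of_forall fun ζ => ?_)
    simp only [neg_neg]; rfl
  have i2 : ∫ ζ, ψ ζ • conj (hat u ζ) = conj (∫ z, (𝓕 ψ₂) z • toComplex u z) := by
    rw [← integral_schwartz_smul_fourier, ← integral_conj]
    refine integral_congr_ae (Eventually.of_forall fun ζ => ?_)
    have : ψ₂ ζ = conj (ψ ζ) := rfl
    simp only [this, smul_eq_mul, map_mul, Complex.conj_conj]; rfl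
  rw [i1, i2, ← integral_conj]
  refine integral_congr_ae ?_
  filter_upwards [coeFn_toComplex u] with z hz
  rw [hz, smul_eq_mul, smul_eq_mul, map_mul, e1, e2, Complex.conj_ofReal]

theorem xi_neg (ζ : Plane) : xi (-ζ) = -xi ζ := by simp [xi]

theorem eta_neg (ζ : Plane) : eta (-ζ) = -eta ζ := by simp [eta]

theorem symDx_neg (ζ : Plane) : symDx (-ζ) = conj (symDx ζ) := by
  rw [symDx, symDx, xi_neg, abs_neg, Complex.conj_ofReal]

theorem symDxInvDy_neg (ζ : Plane) : symDxInvDy (-ζ) = conj (symDxInvDy ζ) := by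
  rw [symDxInvDy, symDxInvDy, xi_neg, eta_neg, abs_neg, map_mul, map_mul, Complex.conj_ofReal,
    Complex.conj_ofReal, Complex.conj_I]
  push_cast; ring

theorem inner_multiplier_eq (m : Plane → ℂ) {u v : RealL2}
    (hu : u ∈ multiplierDomain m) (hv : v ∈ multiplierDomain m) :
    inner ℂ (multiplier m u hu) (multiplier m v hv) =
      ∫ ζ, m ζ * hat v ζ * conj (m ζ * hat u ζ) := by
  rw [← Lp.inner_fourier_eq, L2.inner_def]
  refine integral_congr_ae ?_
  filter_upwards [fourier_multiplier m u hu, fourier_multiplier m v hv] with ζ h1 h2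
  rw [h1, h2, RCLike.inner_apply]

/-- Multipliers with Hermitian symbols preserve real-valued functions, so their scalar products
are real. -/
theorem conj_inner_multiplier {m : Plane → ℂ} (hm : ∀ ζ, m (-ζ) = conj (m ζ)) {u v : RealL2}
    (hu : u ∈ multiplierDomain m) (hv : v ∈ multiplierDomain m) :
    conj (inner ℂ (multiplier m u hu) (multiplier m v hv)) =
      inner ℂ (multiplier m u hu) (multiplier m v hv) := by
  rw [inner_multiplier_eq, ← integral_conj, ← integral_neg_eq_self]
  refine integral_congr_ae ?_
  filter_upwards [hat_neg u, hat_neg v] with ζ h1 h2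
  simp only [h1, h2, hm, map_mul, Complex.conj_conj]

/-- Since |ξ|ξ = sgn(ξ)ξ² and |ξ|⁻¹ξ = sgn ξ, the symbols of the two derivative terms tested with
g_x add up to i sgn(ξ)(ξ² + η²), up to sign and conjugation the symbol of ℋΔ. -/
theorem symbol_identity {x : ℝ} (hx : x ≠ 0) (y : ℝ) (a b : ℂ) :
    ((|x| ^ (1 / 2 : ℝ) : ℝ) : ℂ) * (Complex.I * x * b) * conj (((|x| ^ (1 / 2 : ℝ) : ℝ) : ℂ) * a)
      + ((|x| ^ (-1 / 2 : ℝ) : ℝ) : ℂ) * (Complex.I * (y : ℂ)) * (Complex.I * x * b) *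
        conj (((|x| ^ (-1 / 2 : ℝ) : ℝ) : ℂ) * (Complex.I * (y : ℂ)) * a)
      = -conj (-Complex.I * ((Real.sign x : ℝ) : ℂ) * a * conj (-((x ^ 2 + y ^ 2 : ℝ) : ℂ) * b)) := by
  have hpos : 0 < |x| := abs_pos.2 hx
  have h1 : ((|x| ^ (1 / 2 : ℝ) : ℝ) : ℂ) * ((|x| ^ (1 / 2 : ℝ) : ℝ) : ℂ) = (|x| : ℝ) := by
    rw [← Complex.ofReal_mul, ← Real.rpow_add hpos]; norm_num
  have h2 : ((|x| ^ (-1 / 2 : ℝ) : ℝ) : ℂ) * ((|x| ^ (-1 / 2 : ℝ) : ℝ) : ℂ) = ((|x|⁻¹ : ℝ) : ℂ) := by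
    rw [← Complex.ofReal_mul, ← Real.rpow_add hpos]; norm_num [Real.rpow_neg_one]
  have h3 : |x| * x = Real.sign x * x ^ 2 := by
    rcases lt_or_gt_of_ne hx with h | h
    · rw [abs_of_neg h, Real.sign_of_neg h]; ring
    · rw [abs_of_pos h, Real.sign_of_pos h]; ring
  have h4 : |x|⁻¹ * x = Real.sign x := by
    rcases lt_or_gt_of_ne hx with h | h
    · rw [abs_of_neg h, Real.sign_of_neg h]; field_simp
    · rw [abs_of_pos h, Real.sign_of_pos h]; field_simp
  have h3' : ((|x| : ℝ) : ℂ) * x = (Real.sign x : ℝ) * (x : ℂ) ^ 2 := by exact_mod_cast h3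
  have h4' : ((|x|⁻¹ : ℝ) : ℂ) * x = (Real.sign x : ℝ) := by exact_mod_cast h4
  simp only [map_mul, map_neg, Complex.conj_ofReal, Complex.conj_I, Complex.conj_conj]
  generalize ((|x| ^ (1 / 2 : ℝ) : ℝ) : ℂ) = p at *
  generalize ((|x| ^ (-1 / 2 : ℝ) : ℝ) : ℂ) = q at *
  generalize ((|x| : ℝ) : ℂ) = r at *
  generalize ((|x|⁻¹ : ℝ) : ℂ) = r' at *
  generalize ((Real.sign x : ℝ) : ℂ) = σ at *
  push_cast
  have hI := Complex.I_mul_I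
  generalize Complex.I = i at *
  generalize conj a = a' at *
  linear_combination (i * x * b * a') * h1 + (i * b * a') * h3' - (y ^ 2 * i ^ 3 * x * b * a') * h2
    - (y ^ 2 * i ^ 3 * b * a') * h4' - (y ^ 2 * i * σ * b * a') * hI

/-- The form `(D_x^{1/2} φ, D_x^{1/2} g_x) + (D_x^{-1/2} φ_y, D_x^{-1/2} g_{xy})` is
`-∫ ℋφ Δg`. -/
theorem integral_hilbertX_laplacian (φ : energySpace) (g : 𝓢(Plane, ℝ)) :
    ∫ z, hilbertX φ z * (Δ (complexify g)) z =
      -(inner ℂ (halfDx φ) (halfDx ⟨_, lineDeriv_toLp_mem_energySpace g⟩)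
        + inner ℂ (invHalfDxDy φ) (invHalfDxDy ⟨_, lineDeriv_toLp_mem_energySpace g⟩)) := by
  have hmem := lineDeriv_toLp_mem_energySpace g
  have hr1 := conj_inner_multiplier symDx_neg φ.2.1 hmem.1
  have hr2 := conj_inner_multiplier symDxInvDy_neg φ.2.2 hmem.2
  -- Both scalar products are real, so they may be replaced by their conjugates, which places φ in
  -- the same slot as in the integral with ℋφ.
  rw [halfDx, halfDx, invHalfDxDy, invHalfDxDy, ← hr1, ← hr2, ← map_add, inner_multiplier_eq,
    inner_multiplier_eq]
  have hL : ∫ z, hilbertX φ z * (Δ (complexify g)) z =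
      inner ℂ ((Δ (complexify g)).toLp 2 : ComplexL2) (hilbertX φ) := by
    rw [L2.inner_def]
    refine integral_congr_ae ?_
    filter_upwards [(Δ (complexify g)).coeFn_toLp 2] with z hz
    rw [hz, RCLike.inner_apply, laplacian_complexify, complexify_apply, Complex.conj_ofReal]
  rw [hL, ← Lp.inner_fourier_eq, SchwartzMap.toLp_fourier_eq, L2.inner_def]
  have hi1 : Integrable (fun ζ => symDx ζ * hat ((∂_{ex} g).toLp 2) ζ *
      conj (symDx ζ * hat (φ : RealL2) ζ)) volume :=
    MemLp.integrable_mul (p := 2) (q := 2) hmem.1 (MemLp.star φ.2.1)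
  have hi2 : Integrable (fun ζ => symDxInvDy ζ * hat ((∂_{ex} g).toLp 2) ζ *
      conj (symDxInvDy ζ * hat (φ : RealL2) ζ)) volume :=
    MemLp.integrable_mul (p := 2) (q := 2) hmem.2 (MemLp.star φ.2.2)
  rw [← integral_add hi1 hi2, ← integral_conj, ← integral_neg]
  refine integral_congr_ae ?_
  filter_upwards [(𝓕 (Δ (complexify g))).coeFn_toLp 2,
    fourier_multiplier symHilbert (φ : RealL2) (mem_domain_hilbert φ), hat_lineDeriv_toLp g,
    ae_xi_ne_zero] with ζ h1 h2 h3 h4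
  have h5 : (𝓕 (hilbertX φ) : ComplexL2) ζ = symHilbert ζ * hat (φ : RealL2) ζ := h2
  rw [h1, h5, h3, fourier_laplacian, RCLike.inner_apply]
  have key := symbol_identity h4 (eta ζ) (hat (φ : RealL2) ζ) ((𝓕 (complexify g)) ζ)
  simp only [symDx, symDxInvDy, symHilbert]
  rw [key, map_neg, neg_neg, Complex.conj_conj]

end Shrira

/-! ### From the weak form to the distributional equation -/

namespace Shrira

open scoped RealInnerProductSpace ContDiff ComplexConjugate

theorem eq_complexify_add (ψ : 𝓢(Plane, ℂ)) :
    ψ = complexify (ψ.postcompCLM Complex.reCLM) +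
      Complex.I • complexify (ψ.postcompCLM Complex.imCLM) := by
  ext z
  rw [add_apply, smul_apply, complexify_apply, complexify_apply, smul_eq_mul, mul_comm]
  exact (Complex.re_add_im (ψ z)).symm

theorem laplacian_add_smul (a b : 𝓢(Plane, ℂ)) (t : ℂ) : Δ (a + t • b) = Δ a + t • Δ b := by
  rw [← SchwartzMap.laplacianCLM_eq (𝕜 := ℂ), map_add, map_smul, SchwartzMap.laplacianCLM_eq,
    SchwartzMap.laplacianCLM_eq]

theorem lineDeriv_add_smul (v : Plane) (a b : 𝓢(Plane, ℂ)) (t : ℂ) :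
    ∂_{v} (a + t • b) = ∂_{v} a + t • ∂_{v} b := by
  rw [lineDerivOp_add, lineDerivOp_smul]

theorem integral_mul_add_smul {w : Plane → ℂ}
    (hw : ∀ ψ : 𝓢(Plane, ℂ), Integrable (fun z => w z * ψ z) volume) (a b : 𝓢(Plane, ℂ)) (t : ℂ) :
    ∫ z, w z * (a + t • b) z = (∫ z, w z * a z) + t * ∫ z, w z * b z := by
  rw [← integral_const_mul, ← integral_add (hw a) ((hw b).const_mul t)]
  refine integral_congr_ae (Eventually.of_forall fun z => ?_)
  simp only [add_apply, smul_apply, smul_eq_mul]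
  ring

theorem integrable_complexL2_mul_schwartz (u : ComplexL2) (ψ : 𝓢(Plane, ℂ)) :
    Integrable (fun z => u z * ψ z) volume :=
  MemLp.integrable_mul (p := 2) (q := 2) (Lp.memLp u) (ψ.memLp 2)

theorem memTwoFour_norm_schwartz (ψ : 𝓢(Plane, ℂ)) : MemTwoFour (fun z => ‖ψ z‖) volume := by
  refine ⟨ψ.continuous.norm.aestronglyMeasurable, ?_, ?_⟩
  · have h := (ψ.memLp 2).integrable_norm_rpow (by norm_num) (by norm_num)
    simpa using h
  · have h := (ψ.memLp 4).integrable_norm_rpow (by norm_num) (by norm_num)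
    refine h.congr (Eventually.of_forall fun z => ?_)
    simp only [ENNReal.toReal_ofNat]
    rw [show (4 : ℝ) = ((4 : ℕ) : ℝ) by norm_num, Real.rpow_natCast]

/-- The weak form with the test function g_x. The scalar products being real, taking real parts in
`energyInner` loses nothing. Complex test functions follow by splitting into real and imaginary
parts. -/
theorem solitaryWaveEq_complexify {c : ℝ} {f : ℝ → ℝ} (φ : energySpace) (hw : SolvesWeakForm c f φ)
    (g : 𝓢(Plane, ℝ)) :
    (c : ℂ) * (∫ z, (((φ : RealL2) z : ℝ) : ℂ) * (∂_{ex} (complexify g)) z)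
      - (∫ z, hilbertX φ z * (Δ (complexify g)) z)
      - (∫ z, ((f ((φ : RealL2) z) : ℝ) : ℂ) * (∂_{ex} (complexify g)) z) = 0 := by
  have hmem := lineDeriv_toLp_mem_energySpace g
  obtain ⟨-, h⟩ := hw ⟨_, hmem⟩
  have e1 : ∫ z, (((φ : RealL2) z : ℝ) : ℂ) * (∂_{ex} (complexify g)) z =
      ((inner ℝ (φ : RealL2) ((∂_{ex} g).toLp 2) : ℝ) : ℂ) := by
    rw [L2.inner_def, ← integral_complex_ofReal]
    refine integral_congr_ae ?_
    filter_upwards [(∂_{ex} g).coeFn_toLp 2] with z hz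
    rw [hz, lineDeriv_complexify, complexify_apply, ← Complex.ofReal_mul, RCLike.inner_apply,
      conj_trivial, mul_comm]
  have e2 : ∫ z, ((f ((φ : RealL2) z) : ℝ) : ℂ) * (∂_{ex} (complexify g)) z =
      ((∫ z, f ((φ : RealL2) z) * ((∂_{ex} g).toLp 2 : RealL2) z : ℝ) : ℂ) := by
    rw [← integral_complex_ofReal]
    refine integral_congr_ae ?_
    filter_upwards [(∂_{ex} g).coeFn_toLp 2] with z hz
    rw [hz, lineDeriv_complexify, complexify_apply, ← Complex.ofReal_mul]
  have r1 := Complex.conj_eq_iff_re.1 (conj_inner_multiplier symDx_neg φ.2.1 hmem.1)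
  have r2 := Complex.conj_eq_iff_re.1 (conj_inner_multiplier symDxInvDy_neg φ.2.2 hmem.2)
  change (((inner ℂ (halfDx φ) (halfDx ⟨_, hmem⟩)).re : ℝ) : ℂ) = _ at r1
  change (((inner ℂ (invHalfDxDy φ) (invHalfDxDy ⟨_, hmem⟩)).re : ℝ) : ℂ) = _ at r2
  change _ = inner ℂ (halfDx φ) (halfDx ⟨_, hmem⟩) at r1
  change _ = inner ℂ (invHalfDxDy φ) (invHalfDxDy ⟨_, hmem⟩) at r2
  rw [e1, e2, integral_hilbertX_laplacian, ← r1, ← r2, ← h, energyInner]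
  push_cast
  ring

variable {c : ℝ} [hc : Fact (0 < c)] {f : ℝ → ℝ} {C : ℝ}

theorem CubicGrowth.integrable_comp_mul_schwartz (hf : CubicGrowth f C) (φ : Energy c)
    (ψ : 𝓢(Plane, ℂ)) : Integrable (fun z => ((f (φ.fn z) : ℝ) : ℂ) * ψ z) volume := by
  have h := _root_.integrable_comp_mul hf.continuous hf.bound φ.memTwoFour
    (memTwoFour_norm_schwartz ψ) hf.nonneg
  refine h.mono ?_ (Eventually.of_forall fun z => ?_)
  · exact (Complex.continuous_ofReal.comp_aestronglyMeasurable
      (hf.continuous.comp_aestronglyMeasurable φ.memTwoFour.meas)).mul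
      ψ.continuous.aestronglyMeasurable
  · rw [norm_mul, norm_mul, Complex.norm_real, norm_norm]

/-- Weak solutions solve the solitary wave equation in the sense of tempered distributions. -/
theorem solvesSolitaryWaveEq_of_weakForm (hf : CubicGrowth f C) (φ : Energy c)
    (hw : SolvesWeakForm c f φ.val) : SolvesSolitaryWaveEq c f φ.fn := by
  have hi := hf.integrable_comp_mul_schwartz φ
  refine ⟨hi, fun ψ => ?_⟩
  have h1 := solitaryWaveEq_complexify φ.val hw (ψ.postcompCLM Complex.reCLM)
  have h2 := solitaryWaveEq_complexify φ.val hw (ψ.postcompCLM Complex.imCLM)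
  have hφ : ∀ θ : 𝓢(Plane, ℂ), Integrable (fun z => ((φ.fn z : ℝ) : ℂ) * θ z) volume := fun θ => by
    refine (integrable_complexL2_mul_schwartz (toComplex φ.fn) θ).congr ?_
    filter_upwards [coeFn_toComplex φ.fn] with z hz
    rw [hz]
  rw [eq_complexify_add ψ, lineDeriv_add_smul, laplacian_add_smul, integral_mul_add_smul hφ,
    integral_mul_add_smul (integrable_complexL2_mul_schwartz _), integral_mul_add_smul hi]
  change (c : ℂ) * (∫ z, ((φ.fn z : ℝ) : ℂ) * _) - _ - _ = 0 at h1
  change (c : ℂ) * (∫ z, ((φ.fn z : ℝ) : ℂ) * _) - _ - _ = 0 at h2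
  have h3 : (φ.val : RealL2) = φ.fn := rfl
  rw [h3] at h1 h2
  linear_combination h1 + Complex.I * h2

/-- The action is negative far away in the direction of a function on which the primitive grows
superquadratically. -/
theorem exists_action_neg (w : Energy c) (hw : Tendsto (fun l : ℝ => (l ^ 2)⁻¹ *
    ∫ z, primitive f (l * w.fn z)) atTop atTop) : ∃ e : Energy c, action f e < 0 := by
  obtain ⟨l, h1, h2⟩ := ((hw.eventually_gt_atTop (‖w‖ ^ 2 / 2)).and (eventually_gt_atTop 0)).exists
  refine ⟨l • w, ?_⟩
  have e : ∫ z, primitive f ((l • w).fn z) = ∫ z, primitive f (l * w.fn z) := by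
    refine integral_congr_ae ?_
    filter_upwards [w.coeFn_smul l] with z hz
    rw [hz]
  rw [action, e, norm_smul, mul_pow, Real.norm_eq_abs, sq_abs]
  rw [lt_inv_mul_iff₀ (by positivity)] at h1
  linarith

end Shrira

end

theorem theorem2p15
    (c : ℝ) (hc : 0 < c)
    (f : ℝ → ℝ)
    (hf_cont : Continuous f) (hf_zero : f 0 = 0)
    (C p : ℝ) (hC : 0 < C) (hp : 2 < p) (hp' : p < 4)
    (hf_growth : ∀ u : ℝ, |f u| ≤ C * (|u| + |u| ^ (p - 1)))
    (hf_small : f =o[𝓝 0] (fun u : ℝ => |u|))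
    (μ : ℝ) (hμ : 2 < μ)
    (hf_AR : ∀ u : ℝ, u ≠ 0 →
      0 < μ * Shrira.primitive f u ∧ μ * Shrira.primitive f u ≤ u * f u)
    (hf_super : ∃ ω : Shrira.energySpace,
      Tendsto (fun l : ℝ => (l ^ 2)⁻¹ *
        ∫ z, Shrira.primitive f (l * (ω : Shrira.RealL2) z)) atTop atTop) :
    ∃ φ : Shrira.energySpace, φ ≠ 0 ∧
      Shrira.SolvesSolitaryWaveEq c f φ ∧ Shrira.SolvesWeakForm c f φ := by
  have : Fact (0 < c) := ⟨hc⟩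
  have hf := Shrira.cubicGrowth_of_rpow hf_cont hC hp hp' hf_growth
  obtain ⟨ω, hω⟩ := hf_super
  obtain ⟨e, he⟩ := Shrira.exists_action_neg (c := c) (f := f) ω hω
  obtain ⟨φ, hφ0, hφ⟩ := Shrira.exists_critical_point hf
    (fun ε hε => Shrira.exists_quadratic_bound hC hp hp' hf_growth hf_small hε) hμ hf_AR he
  -- The scalar product of `Energy c` is `energyInner c` by definition, so the vanishing of the
  -- derivative is the weak form.
  have hw : Shrira.SolvesWeakForm c f φ.val := fun χ =>
    ⟨hf.integrable_comp_mul φ (χ : Shrira.Energy c), sub_eq_zero.1 (hφ (χ : Shrira.Energy c))⟩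
  exact ⟨φ.val, hφ0, Shrira.solvesSolitaryWaveEq_of_weakForm hf φ hw, hw⟩
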